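/- **Setting.** Let $(X,d)$ be an unbounded proper metric space of bounded geometry (there is $\varepsilon>0$ such that for every $r>0$ there is $N_r\in\mathbb N$ such that every open ball of radius $r$ is covered by at most $N_r$ open balls of radius $\varepsilon$) with property A$'$: for every $t>0$ there are non-zero measurable functions $\varrho_j\colon X\to[0,1]$, $j\in\mathbb N$, with $\sum_j\varrho_j=1$ pointwise, $\sup_j\operatorname{diam}(\operatorname{spt}\varrho_j)<\infty$, $\sum_j|\varrho_j(x)-\varrho_j(y)|<t$ whenever $d(x,y)\le 1/t$, and such that every ball meets only finitely many of the sets $\operatorname{spt}\varrho_j$. Let $\mu$ be a Radon measure on $X$, let $1<p<\infty$, and write $L_p=L_p(X,\mu)$ (complex-valued functions). Let $\beta X$ be the Stone–Čech compactification of $X$ and $\Gamma X=\beta X\setminus X$. For measurable $K\subseteq X$ let $M_{1_K}$ be multiplication by the indicator function of $K$. A bounded operator $A$ on $L_p$ has finite propagation if $\sup\{\operatorname{dist}(K,K') : K,K'\subseteq X \text{ measurable},\ M_{1_{K'}}AM_{1_K}\ne0\}<\infty$; let $\mathrm{BDO}^p$ be the operator-norm closure of the set of these operators. Let $M^p\subseteq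 L_p$ be a closed subspace and $P\in\mathrm{BDO}^p$ a bounded projection of $L_p$ onto $M^p$ such that $M_{1_K}P$ and $PM_{1_K}$ are compact for all compact $K\subseteq X$. Let $\mathcal A^p$ be the set of bounded operators $A$ on $M^p$ with $AP\in\mathrm{BDO}^p$. Let $x_0\in X$. For each $x\in X$ let $\phi_x\colon X\to X$ be a bijective isometry with $\phi_x(x_0)=x$ and $\mu\circ\phi_x\ll\mu\ll\mu\circ\phi_x$, and let $h_x\colon X\to\mathbb C$ be measurable with $|h_x|^p=\frac{\mathrm d(\mu\circ\phi_x)}{\mathrm d\mu}$ $\mu$-almost everywhere. Assume that for $\mu$-almost every $y\in X$ the maps $x\mapsto\phi_x(y)$ and $x\mapsto h_x(y)$ are continuous. Let $U_x$ be the isometric isomorphism $U_xf=(f\circ\phi_x)\cdot h_x$ of $L_p$, and assume that for all compact $K,K'\subseteq X$ the map $x\mapsto M_{1_K}U_xPU_x^{-1}M_{1_{K'}}$ extends to a norm-continuous map on $\beta X$. **Corollary 4.33.** Let $A\in\mathcal A^p$. For every $x\in\Gamma X$ the limits $$P_x=\lim_{y\to x,\ y\in X}U_yPU_y^{-1},\qquad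 B_x=\lim_{y\to x,\ y\in X}U_yAPU_y^{-1}$$ exist in the weak operator topology, and $B_x$ maps $\operatorname{ran}P_x$ into itself, so that the limit operator $A_x:=B_x|_{\operatorname{ran}P_x}$ is a well-defined bounded operator on $\operatorname{ran}P_x$. Moreover, $$\bigcup_{x\in\Gamma X}\sigma(A_x)=\sigma_{\mathrm{ess}}(A),$$ where $\sigma(A_x)$ is the spectrum of $A_x$ as an operator on $\operatorname{ran}P_x$ and $\sigma_{\mathrm{ess}}(A)=\{\lambda\in\mathbb C : \lambda I-A \text{ is not a Fredholm operator on } M^p\}$. -/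

import Mathlib

open MeasureTheory Filter Topology Set
open scoped ENNReal NNReal

set_option linter.unusedSectionVars false

noncomputable section

namespace BandDominated

/-! ### Geometry of the metric space -/

section Geometry

variable (X : Type*) [MetricSpace X]

/-- Bounded geometry: for one `ε > 0`, every ball of radius `r` is covered by at most `N r` balls
of radius `ε`, with `N r` independent of the centre. -/
def BoundedGeometry : Prop :=
  ∃ ε : ℝ, 0 < ε ∧ ∀ r : ℝ, 0 < r → ∃ N : ℕ, ∀ x : X, ∃ s : Finset X,
    s.card ≤ N ∧ Metric.ball x r ⊆ ⋃ y ∈ s, Metric.ball y ε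

/-- Property A′: for every `t > 0` there are countably many non-zero measurable functions
`ϱ j : X → [0, 1]` which sum to one, have uniformly bounded supports, vary by less than `t` in
`ℓ¹` on pairs of points at distance at most `1 / t`, and are such that every ball meets only
finitely many of the supports (so that all sums below are finite sums). -/
def PropertyAPrime [MeasurableSpace X] : Prop :=
  ∀ t : ℝ, 0 < t → ∃ ϱ : ℕ → X → ℝ,
    (∀ j, Measurable (ϱ j)) ∧ (∀ j, ϱ j ≠ 0) ∧ (∀ j x, ϱ j x ∈ Icc (0 : ℝ) 1) ∧
    (∀ x, HasSum (fun j => ϱ j x) 1) ∧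
    (⨆ j, Metric.ediam (tsupport (ϱ j))) < ∞ ∧
    (∀ x y, dist x y ≤ 1 / t → ∑' j, |ϱ j x - ϱ j y| < t) ∧
    (∀ (x : X) (s : ℝ), 0 < s → {j | (tsupport (ϱ j) ∩ Metric.ball x s).Nonempty}.Finite)

/-- The boundary `ΓX = βX \ X` of the Stone-Čech compactification. -/
def boundary : Set (StoneCech X) := (range (stoneCechUnit : X → StoneCech X))ᶜ

variable {X}

/-- The distance `inf {d(x, y) : x ∈ K, y ∈ K'}` of two sets. -/
def setDist (K K' : Set X) : ℝ≥0∞ := ⨅ x ∈ K, ⨅ y ∈ K', edist x y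

end Geometry

/-! ### Band-dominated operators on `L_p` -/

section Operators

variable {X : Type*} [MeasurableSpace X] {μ : Measure X} {p : ℝ≥0}
  [Fact (1 ≤ (p : ℝ≥0∞))]

lemma memLp_cutoff {K : Set X} (hK : MeasurableSet K) (f : Lp ℂ p μ) :
    MemLp (K.indicator f) p μ :=
  (Lp.memLp f).indicator hK

/-- Multiplication by the indicator function of a measurable set, as a linear map. -/
def cutoffₗ {K : Set X} (hK : MeasurableSet K) : Lp ℂ p μ →ₗ[ℂ] Lp ℂ p μ where
  toFun f := (memLp_cutoff hK f).toLp (K.indicator f)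
  map_add' f g := by
    refine Lp.ext ?_
    filter_upwards [(memLp_cutoff hK (f + g)).coeFn_toLp, (memLp_cutoff hK f).coeFn_toLp,
      (memLp_cutoff hK g).coeFn_toLp, Lp.coeFn_add f g,
      Lp.coeFn_add ((memLp_cutoff hK f).toLp _) ((memLp_cutoff hK g).toLp _)]
      with x h₁ h₂ h₃ h₄ h₅
    rw [h₁, h₅, Pi.add_apply, h₂, h₃]
    by_cases hx : x ∈ K
    · rw [indicator_of_mem hx, indicator_of_mem hx, indicator_of_mem hx, h₄, Pi.add_apply]
    · rw [indicator_of_notMem hx, indicator_of_notMem hx, indicator_of_notMem hx, add_zero]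
  map_smul' c f := by
    refine Lp.ext ?_
    filter_upwards [(memLp_cutoff hK (c • f)).coeFn_toLp, (memLp_cutoff hK f).coeFn_toLp,
      Lp.coeFn_smul c f, Lp.coeFn_smul c ((memLp_cutoff hK f).toLp _)] with x h₁ h₂ h₃ h₄
    rw [h₁, RingHom.id_apply, h₄, Pi.smul_apply, h₂]
    by_cases hx : x ∈ K
    · rw [indicator_of_mem hx, indicator_of_mem hx, h₃, Pi.smul_apply]
    · rw [indicator_of_notMem hx, indicator_of_notMem hx, smul_zero]

lemma norm_cutoffₗ_le {K : Set X} (hK : MeasurableSet K) (f : Lp ℂ p μ) :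
    ‖cutoffₗ hK f‖ ≤ 1 * ‖f‖ := by
  have h : ‖cutoffₗ hK f‖ = (eLpNorm (K.indicator f) p μ).toReal :=
    Lp.norm_toLp _ (memLp_cutoff hK f)
  rw [one_mul, h, Lp.norm_def]
  exact ENNReal.toReal_mono (Lp.eLpNorm_ne_top f) (eLpNorm_indicator_le _)

/-- The operator of multiplication by the indicator function of a measurable set `K`. -/
def cutoff {K : Set X} (hK : MeasurableSet K) : Lp ℂ p μ →L[ℂ] Lp ℂ p μ :=
  LinearMap.mkContinuous (cutoffₗ (μ := μ) (p := p) hK) 1 (fun f => norm_cutoffₗ_le hK f)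

lemma cutoff_ae {K : Set X} (hK : MeasurableSet K) (f : Lp ℂ p μ) :
    cutoff hK f =ᵐ[μ] K.indicator f :=
  (memLp_cutoff hK f).coeFn_toLp

variable [MetricSpace X]

/-- The propagation (band width) of a bounded operator on `L_p`. -/
def propagation (A : Lp ℂ p μ →L[ℂ] Lp ℂ p μ) : ℝ≥0∞ :=
  ⨆ (K : Set X) (K' : Set X) (hK : MeasurableSet K) (hK' : MeasurableSet K')
    (_ : cutoff hK' ∘L A ∘L cutoff hK ≠ 0), setDist K K'

variable (μ p) in
/-- The band-dominated operators on `L_p`: the norm closure of the set of operators of finite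
propagation. -/
def BDO : Set (Lp ℂ p μ →L[ℂ] Lp ℂ p μ) := closure {A | propagation A < ∞}

/-- The assumptions on a bounded projection `P` of `L_p` onto the closed subspace `M`: it is
band-dominated, and its products with indicators of compact sets are compact operators. -/
structure IsAdmissibleProjection [BorelSpace X] (M : Submodule ℂ (Lp ℂ p μ))
    (P : Lp ℂ p μ →L[ℂ] M) : Prop where
  isClosed : IsClosed (M : Set (Lp ℂ p μ))
  apply_coe : ∀ f : M, P f = f
  mem_BDO : M.subtypeL ∘L P ∈ BDO μ p
  compact_left : ∀ (K : Set X) (hK : IsCompact K),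
    IsCompactOperator (cutoff hK.measurableSet ∘L (M.subtypeL ∘L P))
  compact_right : ∀ (K : Set X) (hK : IsCompact K),
    IsCompactOperator ((M.subtypeL ∘L P) ∘L cutoff hK.measurableSet)

/-- The extension `A P` to `L_p` of an operator `A` on the range `M` of the projection `P`. -/
def compProj {M : Submodule ℂ (Lp ℂ p μ)} (P : Lp ℂ p μ →L[ℂ] M) (A : M →L[ℂ] M) :
    Lp ℂ p μ →L[ℂ] Lp ℂ p μ :=
  M.subtypeL ∘L A ∘L P

/-- The class `𝒜^p` of band-dominated operators on `M`. -/
def bandDominatedOn {M : Submodule ℂ (Lp ℂ p μ)} (P : Lp ℂ p μ →L[ℂ] M) : Set (M →L[ℂ] M) :=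
  {A | compProj P A ∈ BDO μ p}

end Operators

/-- The essential spectrum: the complex numbers `z` such that `z - A` is not Fredholm. -/
def essentialSpectrum {E : Type*} [NormedAddCommGroup E] [NormedSpace ℂ E] (A : E →L[ℂ] E) :
    Set ℂ :=
  {z | ¬ (algebraMap ℂ (E →L[ℂ] E) z - A).IsFredholm}

/-! ### Shifts -/

section Shifts

variable {X : Type*} [MetricSpace X] [MeasurableSpace X]

/-- A system of shifts on `(X, d, μ)`: bijective isometries `φ x` with `φ x base = x` under which
`μ` is quasi-invariant, and measurable weights `h x` with `|h x|^p = d(μ ∘ φ x) / dμ`, both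
depending continuously on `x`. The measure `μ ∘ φ x`, `E ↦ μ (φ x (E))`, is the image of `μ` under
the inverse of `φ x`. -/
structure ShiftSystem (μ : Measure X) (p : ℝ≥0) where
  base : X
  φ : X → X ≃ᵢ X
  h : X → X → ℂ
  φ_base : ∀ x, φ x base = x
  map_ac : ∀ x, μ.map (φ x).symm ≪ μ
  ac_map : ∀ x, μ ≪ μ.map (φ x).symm
  measurable_h : ∀ x, Measurable (h x)
  enorm_h_rpow : ∀ x, (fun y => ‖h x y‖ₑ ^ (p : ℝ)) =ᵐ[μ] (μ.map (φ x).symm).rnDeriv μ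
  continuous_φ : ∀ᵐ y ∂μ, Continuous fun x => φ x y
  continuous_h : ∀ᵐ y ∂μ, Continuous fun x => h x y

namespace ShiftSystem

variable [ProperSpace X] [BorelSpace X] {μ : Measure X} [μ.Regular] {p : ℝ≥0}

lemma quasiMeasurePreserving (S : ShiftSystem μ p) (x : X) :
    Measure.QuasiMeasurePreserving (S.φ x) μ μ := by
  refine ⟨(S.φ x).continuous.measurable, ?_⟩
  have h := (S.ac_map x).map (S.φ x).continuous.measurable
  rw [Measure.map_map (S.φ x).continuous.measurable (S.φ x).symm.continuous.measurable] at h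
  have : (S.φ x) ∘ (S.φ x).symm = id := by ext y; simp
  rwa [this, Measure.map_id] at h

lemma lintegral_shift (S : ShiftSystem μ p) (x : X) {f : X → ℝ≥0∞} (hf : Measurable f) :
    ∫⁻ y, ‖S.h x y‖ₑ ^ (p : ℝ) * f (S.φ x y) ∂μ = ∫⁻ y, f y ∂μ := by
  have : SigmaFinite (μ.map (S.φ x).symm) :=
    (S.φ x).symm.toHomeomorph.toMeasurableEquiv.sigmaFinite_map
  have hφ : Measurable (S.φ x) := (S.φ x).continuous.measurable
  have h₁ : ∫⁻ y, ‖S.h x y‖ₑ ^ (p : ℝ) * f (S.φ x y) ∂μ =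
      ∫⁻ y, (μ.map (S.φ x).symm).rnDeriv μ y * f (S.φ x y) ∂μ := by
    refine lintegral_congr_ae ?_
    filter_upwards [S.enorm_h_rpow x] with y hy
    rw [← hy]
  rw [h₁, lintegral_rnDeriv_mul (f := fun y => f (S.φ x y)) (S.map_ac x)
      (hf.comp hφ).aemeasurable,
    lintegral_map (f := fun y => f (S.φ x y)) (hf.comp hφ) (S.φ x).symm.continuous.measurable]
  simp

lemma h_ne_zero (S : ShiftSystem μ p) (hp : p ≠ 0) (x : X) : ∀ᵐ y ∂μ, S.h x y ≠ 0 := by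
  have : SigmaFinite (μ.map (S.φ x).symm) :=
    (S.φ x).symm.toHomeomorph.toMeasurableEquiv.sigmaFinite_map
  filter_upwards [S.enorm_h_rpow x, Measure.rnDeriv_pos' (S.ac_map x)] with y h₁ h₂ h₃
  rw [← h₁, h₃, enorm_zero, ENNReal.zero_rpow_of_pos (by positivity)] at h₂
  exact lt_irrefl _ h₂

lemma eLpNorm_shift (S : ShiftSystem μ p) (hp : p ≠ 0) (x : X) {f : X → ℂ} (hf : Measurable f) :
    eLpNorm (fun y => f (S.φ x y) * S.h x y) p μ = eLpNorm f p μ := by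
  rw [eLpNorm_nnreal_eq_lintegral hp, eLpNorm_nnreal_eq_lintegral hp]
  congr 1
  rw [← S.lintegral_shift x (f := fun y => ‖f y‖ₑ ^ (p : ℝ)) (hf.enorm.pow_const _)]
  refine lintegral_congr fun y => ?_
  rw [enorm_mul, ENNReal.mul_rpow_of_nonneg _ _ p.coe_nonneg, mul_comm]

lemma exponent_ne_zero [hp : Fact (1 ≤ (p : ℝ≥0∞))] : p ≠ 0 := by
  rintro rfl
  simpa using hp.out

variable [Fact (1 ≤ (p : ℝ≥0∞))]

lemma memLp_shift (S : ShiftSystem μ p) (x : X) (f : Lp ℂ p μ) :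
    MemLp (fun y => f (S.φ x y) * S.h x y) p μ := by
  have hf : Measurable f := (Lp.stronglyMeasurable f).measurable
  refine ⟨((hf.comp (S.φ x).continuous.measurable).mul
    (S.measurable_h x)).aestronglyMeasurable, ?_⟩
  rw [S.eLpNorm_shift exponent_ne_zero x hf]
  exact Lp.eLpNorm_lt_top f

/-- The shift `f ↦ (f ∘ φ x) · h x` as a linear isometry of `L_p`. -/
def shiftₗᵢ (S : ShiftSystem μ p) (x : X) : Lp ℂ p μ →ₗᵢ[ℂ] Lp ℂ p μ where
  toFun f := (S.memLp_shift x f).toLp (fun y => f (S.φ x y) * S.h x y)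
  map_add' f g := by
    refine Lp.ext ?_
    filter_upwards [(S.memLp_shift x (f + g)).coeFn_toLp, (S.memLp_shift x f).coeFn_toLp,
      (S.memLp_shift x g).coeFn_toLp, (S.quasiMeasurePreserving x).ae (Lp.coeFn_add f g),
      Lp.coeFn_add ((S.memLp_shift x f).toLp _) ((S.memLp_shift x g).toLp _)]
      with y h₁ h₂ h₃ h₄ h₅
    rw [h₁, h₅, Pi.add_apply, h₂, h₃, h₄, Pi.add_apply, add_mul]
  map_smul' c f := by
    refine Lp.ext ?_
    filter_upwards [(S.memLp_shift x (c • f)).coeFn_toLp, (S.memLp_shift x f).coeFn_toLp,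
      (S.quasiMeasurePreserving x).ae (Lp.coeFn_smul c f),
      Lp.coeFn_smul c ((S.memLp_shift x f).toLp _)] with y h₁ h₂ h₃ h₄
    rw [h₁, RingHom.id_apply, h₄, Pi.smul_apply, h₂, h₃, Pi.smul_apply, smul_eq_mul,
      smul_eq_mul, mul_assoc]
  norm_map' f := by
    rw [LinearMap.coe_mk, AddHom.coe_mk, Lp.norm_toLp, Lp.norm_def,
      S.eLpNorm_shift exponent_ne_zero x (Lp.stronglyMeasurable f).measurable]

lemma shiftₗᵢ_ae (S : ShiftSystem μ p) (x : X) (f : Lp ℂ p μ) :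
    S.shiftₗᵢ x f =ᵐ[μ] fun y => f (S.φ x y) * S.h x y :=
  (S.memLp_shift x f).coeFn_toLp

lemma shiftₗᵢ_surjective (S : ShiftSystem μ p) (x : X) : Function.Surjective (S.shiftₗᵢ x) := by
  intro g
  have hg : Measurable g := (Lp.stronglyMeasurable g).measurable
  set f : X → ℂ := fun z => g ((S.φ x).symm z) / S.h x ((S.φ x).symm z) with hf_def
  have hf : Measurable f :=
    (hg.div (S.measurable_h x)).comp (S.φ x).symm.continuous.measurable
  have hfg : (fun y => f (S.φ x y) * S.h x y) =ᵐ[μ] g := by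
    filter_upwards [S.h_ne_zero exponent_ne_zero x] with y hy
    simp [hf_def, hy]
  have hfp : MemLp f p μ := by
    refine ⟨hf.aestronglyMeasurable, ?_⟩
    rw [← S.eLpNorm_shift exponent_ne_zero x hf, eLpNorm_congr_ae hfg]
    exact Lp.eLpNorm_lt_top g
  refine ⟨hfp.toLp f, Lp.ext ?_⟩
  filter_upwards [S.shiftₗᵢ_ae x (hfp.toLp f),
    (S.quasiMeasurePreserving x).ae hfp.coeFn_toLp, hfg] with y h₁ h₂ h₃
  rw [h₁, h₂, h₃]

/-- The shift `U_x f = (f ∘ φ x) · h x`, an isometric isomorphism of `L_p`. -/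
def U (S : ShiftSystem μ p) (x : X) : Lp ℂ p μ ≃ₗᵢ[ℂ] Lp ℂ p μ :=
  LinearIsometryEquiv.ofSurjective (S.shiftₗᵢ x) (S.shiftₗᵢ_surjective x)

lemma U_ae (S : ShiftSystem μ p) (x : X) (f : Lp ℂ p μ) :
    S.U x f =ᵐ[μ] fun y => f (S.φ x y) * S.h x y :=
  S.shiftₗᵢ_ae x f

/-- The conjugate `U_x B U_x⁻¹` of an operator `B`. -/
def conj (S : ShiftSystem μ p) (B : Lp ℂ p μ →L[ℂ] Lp ℂ p μ) (x : X) :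
    Lp ℂ p μ →L[ℂ] Lp ℂ p μ :=
  (S.U x : Lp ℂ p μ →L[ℂ] Lp ℂ p μ) ∘L B ∘L ((S.U x).symm : Lp ℂ p μ →L[ℂ] Lp ℂ p μ)

/-- For all compact `K, K'`, the map `x ↦ 1_K U_x B U_x⁻¹ 1_K'` extends to a norm continuous map
on the Stone-Čech compactification. -/
def ExtendsToStoneCech (S : ShiftSystem μ p) (B : Lp ℂ p μ →L[ℂ] Lp ℂ p μ) : Prop :=
  ∀ (K K' : Set X) (hK : IsCompact K) (hK' : IsCompact K'),
    ∃ F : StoneCech X → (Lp ℂ p μ →L[ℂ] Lp ℂ p μ), Continuous F ∧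
      ∀ x, F (stoneCechUnit x) =
        cutoff hK.measurableSet ∘L S.conj B x ∘L cutoff hK'.measurableSet

/-- `B'` is the limit, in the weak operator topology, of `U_y B U_y⁻¹` as `y ∈ X` tends to the
point `x` of the Stone-Čech compactification, that is, along every net in `X` converging to
`x`. -/
def IsWeakLimit (S : ShiftSystem μ p) (B : Lp ℂ p μ →L[ℂ] Lp ℂ p μ) (x : StoneCech X)
    (B' : Lp ℂ p μ →L[ℂ] Lp ℂ p μ) : Prop :=
  Tendsto (fun y => ContinuousLinearMapWOT.ofCLM (S.conj B y)) (comap stoneCechUnit (𝓝 x))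
    (𝓝 (ContinuousLinearMapWOT.ofCLM B'))

/-- The limit operator of `A` at `x`: `proj` is the weak limit `P_x` of `U_y P U_y⁻¹`, and `op` is
the operator on the range of `P_x` obtained by restricting the weak limit of `U_y A P U_y⁻¹`. -/
structure LimitOperator (S : ShiftSystem μ p) {M : Submodule ℂ (Lp ℂ p μ)}
    (P : Lp ℂ p μ →L[ℂ] M) (A : M →L[ℂ] M) (x : StoneCech X) where
  proj : Lp ℂ p μ →L[ℂ] Lp ℂ p μ
  op : proj.range →L[ℂ] proj.range
  isWeakLimit_proj : S.IsWeakLimit (M.subtypeL ∘L P) x proj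
  isWeakLimit_op : ∃ B : Lp ℂ p μ →L[ℂ] Lp ℂ p μ, S.IsWeakLimit (compProj P A) x B ∧
    ∀ v : proj.range, (op v : Lp ℂ p μ) = B v

end ShiftSystem

end Shifts

end BandDominated

end

/-!
# The essential spectrum as the union of the spectra of the limit operators

Write `Q` for the projection `P` regarded as an operator on `L_p`, `T = A P`, and
`G = T + (1 - Q)`, which is band-dominated. The conjugates `U_y B U_y⁻¹` of an operator `B` are
`S.conj B y`, and `z - A` belongs to the same class as `A`, so it suffices to show that `A` is
Fredholm if and only if its limit operators are invertible.

*Existence of limits.* Since `Q` is compact on balls and its conjugates extend continuously to the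
Stone-Čech compactification, conjugates of `Q` map bounded families to families which converge
locally along ultrafilters (`IsLocallyCompactProjection.exists_tendsto_ballCut`), and `T = Q T`
inherits this. The limits do not depend on the ultrafilter, because the matrix coefficients
of `U_y T U_y⁻¹` are bounded continuous functions of `y`. So `U_y T U_y⁻¹` even converges strongly
(`IsLocallyCompactProjection.exists_isStrongLimit`).

*Fredholm operators have invertible limit operators.* An inverse of `A` modulo compact operators is
shifted to infinity; compact operators disappear in this process, as `U_y⁻¹ f` tends weakly to zero
(`limit_injective_of_isFredholm`, `limit_surjective_of_isFredholm`).

*Invertible limit operators imply Fredholmness.* Property A′ gives partitions of unity whose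
commutators with `G` are as small as desired in the sense of `ℓ_p`; they are made constant on the
cells of a decomposition of bounded geometry, so that the commutators can be estimated cell by cell
(`exists_slowPartition`). If `‖G f‖ ≤ c ‖f‖`, then some piece of `f` satisfies the same estimate
with a slightly larger constant. Repeating this from large scales to small ones gives a *chain* of
almost minimisers with a common centre, whose quality improves along the chain
(`exists_localisation_chain`). If `G` were not bounded below off every ball, then the chains would
produce one boundary point at which the limit of `G` is not bounded below at all, against its
invertibility (`exists_bounded_below_off_ball`). In particular all limits of `G` at the boundary
have a common lower bound, so their inverses are uniformly bounded. Local compactness turns these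
inverses into approximate solutions of `G g = f` for `f` with small support far away
(`exists_local_solution`), and partitions of unity glue them (`exists_solution_off_ball`). Hence `A`
is bounded below modulo a compact operator, and the projection onto its cokernel is compact, which
makes the cokernel finite-dimensional (`isFredholm_of_limit_bijective`).
-/

noncomputable section

namespace BandDominated

/-! ### Compact operators and a criterion for being Fredholm -/

section Abstract

/-- A compact operator maps a bounded family to a family that converges along every
ultrafilter. -/
lemma exists_tendsto_of_isCompactOperator {ι E F : Type*} [NormedAddCommGroup E]
    [NormedSpace ℂ E] [NormedAddCommGroup F] [NormedSpace ℂ F] {K : E →L[ℂ] F}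
    (hK : IsCompactOperator K) (l : Ultrafilter ι) {g : ι → E} {C : ℝ} (hg : ∀ i, ‖g i‖ ≤ C) :
    ∃ z, Tendsto (fun i => K (g i)) l (𝓝 z) := by
  have hK' : IsCompactOperator (K : E →ₗ[ℂ] F) := hK
  obtain ⟨S, hS, hKS⟩ := hK'.image_closedBall_subset_compact C
  have hmem : ∀ i, K (g i) ∈ S := fun i =>
    hKS ⟨g i, mem_closedBall_zero_iff.2 (hg i), rfl⟩
  obtain ⟨z, -, hz⟩ := hS.ultrafilter_le_nhds (l.map fun i => K (g i))
    (le_principal_iff.2 (Eventually.of_forall (f := (l : Filter ι)) hmem))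
  exact ⟨z, hz⟩

/-- In a complete space, uniform limits of families that converge along an ultrafilter converge
along it. -/
lemma exists_tendsto_of_approx {ι F : Type*} [NormedAddCommGroup F] [CompleteSpace F]
    (l : Ultrafilter ι) {v : ι → F}
    (h : ∀ ε : ℝ, 0 < ε → ∃ u : ι → F, (∃ z, Tendsto u l (𝓝 z)) ∧ ∀ i, ‖v i - u i‖ ≤ ε) :
    ∃ z, Tendsto v l (𝓝 z) := by
  refine cauchy_map_iff_exists_tendsto.1 ?_
  rw [Metric.cauchy_iff]
  refine ⟨inferInstance, fun ε hε => ?_⟩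
  obtain ⟨u, ⟨z, hz⟩, hu⟩ := h (ε / 4) (by positivity)
  refine ⟨v '' {i | dist (u i) z < ε / 4}, image_mem_map
    (hz (Metric.ball_mem_nhds z (by positivity))), ?_⟩
  rintro _ ⟨i, hi, rfl⟩ _ ⟨j, hj, rfl⟩
  have h₁ := hu i
  have h₂ := hu j
  rw [← dist_eq_norm] at h₁ h₂
  have h₃ : dist (u i) z < ε / 4 := hi
  have h₄ : dist (u j) z < ε / 4 := hj
  have h₅ := dist_triangle4 (v i) (u i) (u j) (v j)
  have h₆ := dist_triangle_right (u i) (u j) z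
  rw [dist_comm (u j) (v j)] at h₅
  linarith

/-- Compact operators map bounded weakly null families to norm null families. -/
lemma tendsto_zero_of_weakly_null {ι E F : Type*} [NormedAddCommGroup E]
    [NormedSpace ℂ E] [NormedAddCommGroup F] [NormedSpace ℂ F] {K : E →L[ℂ] F}
    (hK : IsCompactOperator K) {l : Filter ι} {g : ι → E} {C : ℝ} (hg : ∀ i, ‖g i‖ ≤ C)
    (h : ∀ ℓ : E →L[ℂ] ℂ, Tendsto (fun i => ℓ (g i)) l (𝓝 0)) :
    Tendsto (fun i => K (g i)) l (𝓝 0) := by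
  rw [tendsto_iff_ultrafilter]
  intro u hu
  obtain ⟨z, hz⟩ := exists_tendsto_of_isCompactOperator hK u hg
  suffices z = 0 by rwa [this] at hz
  by_contra hz0
  obtain ⟨ℓ, hℓ⟩ := SeparatingDual.exists_ne_zero (R := ℂ) hz0
  refine hℓ ?_
  exact tendsto_nhds_unique ((ℓ.continuous.tendsto z).comp hz) ((h (ℓ.comp K)).mono_left hu)

variable {E F : Type*} [NormedAddCommGroup E] [NormedSpace ℂ E] [CompleteSpace E]
  [NormedAddCommGroup F] [NormedSpace ℂ F]

/-- An almost null sequence of an operator that is bounded below modulo a compact one converges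
along an ultrafilter. -/
lemma exists_tendsto_of_bounded_below_mod_compact {A : E →L[ℂ] E} {K : E →L[ℂ] F}
    (hK : IsCompactOperator K) {C : ℝ} (hC : ∀ f, ‖f‖ ≤ C * (‖A f‖ + ‖K f‖)) {ι : Type*}
    (l : Ultrafilter ι) {f : ι → E} {R : ℝ} (hf : ∀ i, ‖f i‖ ≤ R)
    (hAf : Tendsto (fun i => A (f i)) l (𝓝 0)) : ∃ z, Tendsto f l (𝓝 z) := by
  obtain ⟨w, hw⟩ := exists_tendsto_of_isCompactOperator hK l hf
  refine cauchy_map_iff_exists_tendsto.1 ?_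
  rw [Metric.cauchy_iff]
  refine ⟨inferInstance, fun ε hε => ?_⟩
  set δ := ε / (4 * (|C| + 1)) with hδ
  have hδ0 : 0 < δ := by positivity
  refine ⟨f '' ({i | dist (A (f i)) 0 < δ} ∩ {i | dist (K (f i)) w < δ}), image_mem_map
    (inter_mem (hAf (Metric.ball_mem_nhds _ hδ0)) (hw (Metric.ball_mem_nhds _ hδ0))), ?_⟩
  rintro _ ⟨i, ⟨hi, hi'⟩, rfl⟩ _ ⟨j, ⟨hj, hj'⟩, rfl⟩
  have h₁ : dist (A (f i)) (A (f j)) < 2 * δ := by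
    have : dist (A (f i)) (A (f j)) ≤ _ := dist_triangle_right _ _ 0
    have h1 : dist (A (f i)) 0 < δ := hi
    have h2 : dist (A (f j)) 0 < δ := hj
    linarith
  have h₂ : dist (K (f i)) (K (f j)) < 2 * δ := by
    have : dist (K (f i)) (K (f j)) ≤ _ := dist_triangle_right _ _ w
    have h1 : dist (K (f i)) w < δ := hi'
    have h2 : dist (K (f j)) w < δ := hj'
    linarith
  have h₃ := hC (f i - f j)
  rw [map_sub, map_sub, ← dist_eq_norm, ← dist_eq_norm, ← dist_eq_norm] at h₃
  have h₄ : C * (dist (A (f i)) (A (f j)) + dist (K (f i)) (K (f j))) ≤ |C| * (4 * δ) := by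
    refine (mul_le_mul_of_nonneg_right (le_abs_self C) (by positivity)).trans ?_
    exact mul_le_mul_of_nonneg_left (by linarith) (abs_nonneg C)
  have h₅ : |C| * (4 * δ) < (|C| + 1) * (4 * δ) := by
    apply mul_lt_mul_of_pos_right (by linarith) (by positivity)
  have h₆ : (|C| + 1) * (4 * δ) = ε := by
    rw [hδ]; field_simp
  linarith

/-- If every operator out of `E` which annihilates the range of `A` is compact, then the range, as
soon as it is closed, has finite codimension: the quotient map is open and compact. -/
lemma finite_quotient_of_isCompactOperator {V : Submodule ℂ E} (hV : IsClosed (V : Set E))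
    (h : IsCompactOperator (V.mkQL : E →L[ℂ] E ⧸ V)) : V.CoFG := by
  have := hV
  obtain ⟨S, hS, hVS⟩ := IsCompactOperator.image_ball_subset_compact
    (f := (V.mkQL : E →L[ℂ] E ⧸ V).toLinearMap) h 1
  have hopen : V.mkQL '' Metric.ball 0 1 ∈ 𝓝 (0 : E ⧸ V) := by
    have h0 : Metric.ball (0 : E) 1 ∈ 𝓝 0 := Metric.ball_mem_nhds _ one_pos
    have := V.isOpenMap_mkQ.image_mem_nhds h0
    simpa using this
  have hS0 : S ∈ 𝓝 (0 : E ⧸ V) := mem_of_superset hopen hVS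
  exact FiniteDimensional.of_totallyBounded_nhds_zero ℂ hS0 hS.totallyBounded

lemma isFredholm_of_bounded_below_mod_compact {A : E →L[ℂ] E} {K : E →L[ℂ] F}
    (hK : IsCompactOperator K) {C : ℝ} (hC : ∀ f, ‖f‖ ≤ C * (‖A f‖ + ‖K f‖))
    (hcok : IsClosed (A.range : Set E) → IsCompactOperator (A.range.mkQL : E →L[ℂ] E ⧸ A.range)) :
    A.IsFredholm := by
  have hker : FiniteDimensional ℂ A.ker := by
    by_contra hinf
    obtain ⟨R, f, -, hfR, hf⟩ := exists_seq_norm_le_one_le_norm_sub (𝕜 := ℂ) hinf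
    obtain ⟨z, hz⟩ := exists_tendsto_of_bounded_below_mod_compact hK hC (hyperfilter ℕ)
      (f := fun n => (f n : E)) hfR (by
        have : (fun n => A (f n : E)) = fun _ => 0 := funext fun n => (f n).2
        rw [this]
        exact tendsto_const_nhds)
    have hmem := hz (Metric.ball_mem_nhds z (half_pos one_pos))
    have hinf' : Set.Infinite ((fun n => (f n : E)) ⁻¹' Metric.ball z (1 / 2)) := fun hfin =>
      notMem_hyperfilter_of_finite hfin hmem
    obtain ⟨m, hm, n, hn, hmn⟩ := hinf'.nontrivial
    have h₁ : dist (f m : E) z < 1 / 2 := hm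
    have h₂ : dist (f n : E) z < 1 / 2 := hn
    have h₃ := dist_triangle_right (f m : E) (f n) z
    have h₄ : (1 : ℝ) ≤ ‖(f m : E) - f n‖ := hf hmn
    rw [← dist_eq_norm] at h₄
    linarith
  obtain ⟨E₁, hE₁, hcompl⟩ :=
    (Submodule.ClosedComplemented.of_finiteDimensional A.ker).exists_isClosed_isCompl
  have hbelow : ∃ c : ℝ, 0 < c ∧ ∀ f ∈ E₁, c * ‖f‖ ≤ ‖A f‖ := by
    by_contra! hno
    have : ∀ n : ℕ, ∃ f ∈ E₁, ‖f‖ = 1 ∧ ‖A f‖ ≤ 1 / (n + 1) := by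
      intro n
      obtain ⟨f, hf, hlt⟩ := hno (1 / (n + 1)) (by positivity)
      have hf0 : ‖f‖ ≠ 0 := by
        intro h0
        rw [h0, mul_zero] at hlt
        rw [norm_eq_zero.1 h0, map_zero, norm_zero] at hlt
        exact lt_irrefl _ hlt
      refine ⟨((‖f‖⁻¹ : ℝ) : ℂ) • f, E₁.smul_mem _ hf, ?_, ?_⟩
      · rw [norm_smul]
        simp [hf0]
      · rw [map_smul, norm_smul]
        simp only [Complex.norm_real, norm_inv, norm_norm]
        rw [inv_mul_le_iff₀ (by positivity)]
        linarith
    choose f hfE hf1 hfA using this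
    have hA0 : Tendsto (fun n => A (f n)) atTop (𝓝 0) :=
      squeeze_zero_norm hfA tendsto_one_div_add_atTop_nhds_zero_nat
    obtain ⟨z, hz⟩ := exists_tendsto_of_bounded_below_mod_compact hK hC (hyperfilter ℕ)
      (fun n => (hf1 n).le) (hA0.mono_left Nat.hyperfilter_le_atTop)
    have hz1 : ‖z‖ = 1 := tendsto_nhds_unique hz.norm (by simp [hf1])
    have hzE : z ∈ E₁ := hE₁.mem_of_tendsto hz (Eventually.of_forall hfE)
    have hzA : A z = 0 := tendsto_nhds_unique ((A.continuous.tendsto z).comp hz)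
      (hA0.mono_left Nat.hyperfilter_le_atTop)
    have : z = 0 := by
      have := hcompl.disjoint
      rw [Submodule.disjoint_def] at this
      exact this z hzA hzE
    rw [this, norm_zero] at hz1
    exact zero_ne_one hz1
  obtain ⟨c, hc, hbelow⟩ := hbelow
  have hanti : AntilipschitzWith (Real.toNNReal c⁻¹) (A.comp E₁.subtypeL) := by
    refine ContinuousLinearMap.antilipschitz_of_bound _ fun f => ?_
    rw [Real.coe_toNNReal _ (by positivity), inv_mul_eq_div, le_div_iff₀ hc, mul_comm]
    exact hbelow f f.2
  have := hE₁.completeSpace_coe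
  have hrange : (A.range : Set E) = Set.range (A.comp E₁.subtypeL) := by
    ext y
    constructor
    · rintro ⟨x, rfl⟩
      obtain ⟨a, ha, b, hb, rfl⟩ := Submodule.mem_sup.1
        (hcompl.sup_eq_top ▸ Submodule.mem_top (x := x))
      refine ⟨⟨b, hb⟩, ?_⟩
      have : A a = 0 := ha
      simp [this]
    · rintro ⟨x, rfl⟩
      exact ⟨x, rfl⟩
  have hclosed : IsClosed (A.range : Set E) := by
    rw [hrange]
    exact hanti.isClosed_range (A.comp E₁.subtypeL).uniformContinuous
  have hcofg : A.range.CoFG := finite_quotient_of_isCompactOperator hclosed (hcok hclosed)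
  have := hclosed.completeSpace_coe
  have hmaps : MapsTo A E₁ A.range := fun x _ => ⟨x, rfl⟩
  have hE₁fg : E₁.CoFG := by
    have e := Submodule.quotientEquivOfIsCompl E₁ A.ker hcompl.symm
    exact Module.Finite.equiv e.symm
  refine ContinuousLinearMap.IsFredholm.of_isInvertible_restrict hE₁ hclosed hmaps ?_
  have hinj : (A.restrict hmaps).ker = ⊥ := by
    refine LinearMap.ker_eq_bot.2 fun a b hab => ?_
    refine hanti.injective ?_
    exact congrArg Subtype.val hab
  have hsurj : (A.restrict hmaps).range = ⊤ := by
    refine LinearMap.range_eq_top.2 fun y => ?_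
    have hy : (y : E) ∈ (A.range : Set E) := y.2
    rw [hrange] at hy
    obtain ⟨x, hx⟩ := hy
    exact ⟨x, Subtype.ext hx⟩
  exact ⟨ContinuousLinearEquiv.ofBijective _ hinj hsurj, by ext x; simp⟩

end Abstract

/-! ### Supports, multiplication operators and norms in `L_p` -/

section LpFacts

variable {X : Type*} [MeasurableSpace X] {μ : Measure X} {p : ℝ≥0}

lemma one_le_exponent [h : Fact (1 ≤ (p : ℝ≥0∞))] : (1 : ℝ) ≤ p := by
  have := h.out
  exact_mod_cast this

lemma exponent_pos [h : Fact (1 ≤ (p : ℝ≥0∞))] : (0 : ℝ) < p :=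
  one_pos.trans_le one_le_exponent

lemma enorm_rpow_eq_lintegral [Fact (1 ≤ (p : ℝ≥0∞))] (f : Lp ℂ p μ) :
    ‖f‖ₑ ^ (p : ℝ) = ∫⁻ x, ‖f x‖ₑ ^ (p : ℝ) ∂μ := by
  rw [Lp.enorm_def, eLpNorm_nnreal_pow_eq_lintegral ShiftSystem.exponent_ne_zero]

/-- The function `f` vanishes almost everywhere off the set `K`. -/
def SuppIn (f : Lp ℂ p μ) (K : Set X) : Prop := ∀ᵐ x ∂μ, x ∉ K → f x = 0

lemma SuppIn.mono {f : Lp ℂ p μ} {K L : Set X} (h : SuppIn f K) (hKL : K ⊆ L) : SuppIn f L := by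
  filter_upwards [h] with x hx hxL using hx fun hxK => hxL (hKL hxK)

lemma SuppIn.inter {f : Lp ℂ p μ} {K L : Set X} (h : SuppIn f K) (h' : SuppIn f L) :
    SuppIn f (K ∩ L) := by
  filter_upwards [h, h'] with x h₁ h₂ hx
  by_cases hxK : x ∈ K
  · exact h₂ fun hxL => hx ⟨hxK, hxL⟩
  · exact h₁ hxK

lemma SuppIn.eq_zero {f : Lp ℂ p μ} (h : SuppIn f ∅) : f = 0 := by
  refine Lp.ext ?_
  filter_upwards [h, Lp.coeFn_zero ℂ (p : ℝ≥0∞) μ] with x h₁ h₂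
  rw [h₂, h₁ (notMem_empty x), Pi.zero_apply]

variable [Fact (1 ≤ (p : ℝ≥0∞))]

lemma SuppIn.smul {f : Lp ℂ p μ} {K : Set X} (h : SuppIn f K) (c : ℂ) : SuppIn (c • f) K := by
  filter_upwards [h, Lp.coeFn_smul c f] with x h₁ h₂ hx
  rw [h₂, Pi.smul_apply, h₁ hx, smul_zero]

lemma SuppIn.add {f g : Lp ℂ p μ} {K : Set X} (hf : SuppIn f K) (hg : SuppIn g K) :
    SuppIn (f + g) K := by
  filter_upwards [hf, hg, Lp.coeFn_add f g] with x h₁ h₂ h₃ hx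
  rw [h₃, Pi.add_apply, h₁ hx, h₂ hx, add_zero]

lemma suppIn_cutoff {K : Set X} (hK : MeasurableSet K) (f : Lp ℂ p μ) :
    SuppIn (cutoff hK f) K := by
  filter_upwards [cutoff_ae hK f] with x hx hxK
  rw [hx, indicator_of_notMem hxK]

lemma SuppIn.cutoff {K L : Set X} (hL : MeasurableSet L) {f : Lp ℂ p μ} (hf : SuppIn f K) :
    SuppIn (cutoff hL f) K := by
  filter_upwards [cutoff_ae hL f, hf] with x hx h₁ hxK
  rw [hx]
  by_cases hxL : x ∈ L
  · rw [indicator_of_mem hxL, h₁ hxK]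
  · rw [indicator_of_notMem hxL]

lemma SuppIn.cutoff_eq {K : Set X} (hK : MeasurableSet K) {f : Lp ℂ p μ} (hf : SuppIn f K) :
    BandDominated.cutoff hK f = f := by
  refine Lp.ext ?_
  filter_upwards [cutoff_ae hK f, hf] with x hx h₁
  rw [hx]
  by_cases hxK : x ∈ K
  · rw [indicator_of_mem hxK]
  · rw [indicator_of_notMem hxK, h₁ hxK]

lemma SuppIn.cutoff_eq_zero {K L : Set X} (hK : MeasurableSet K) {f : Lp ℂ p μ}
    (hf : SuppIn f L) (hKL : Disjoint K L) : BandDominated.cutoff hK f = 0 := by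
  refine SuppIn.eq_zero (((suppIn_cutoff hK f).inter (hf.cutoff hK)).mono ?_)
  exact hKL.le_bot

lemma norm_cutoff_le {K : Set X} (hK : MeasurableSet K) :
    ‖(cutoff hK : Lp ℂ p μ →L[ℂ] Lp ℂ p μ)‖ ≤ 1 :=
  LinearMap.mkContinuous_norm_le _ zero_le_one _

lemma norm_cutoff_apply_le {K : Set X} (hK : MeasurableSet K) (f : Lp ℂ p μ) :
    ‖cutoff hK f‖ ≤ ‖f‖ := by
  simpa using (cutoff hK).le_of_opNorm_le (norm_cutoff_le hK) f

lemma cutoff_compl {K : Set X} (hK : MeasurableSet K) (f : Lp ℂ p μ) :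
    cutoff hK.compl f = f - cutoff hK f := by
  refine Lp.ext ?_
  filter_upwards [cutoff_ae hK f, cutoff_ae hK.compl f, Lp.coeFn_sub f (cutoff hK f)]
    with x h₁ h₂ h₃
  rw [h₂, h₃, Pi.sub_apply, h₁]
  by_cases hxK : x ∈ K
  · rw [indicator_of_notMem (by simpa using hxK), indicator_of_mem hxK, sub_self]
  · rw [indicator_of_mem hxK, indicator_of_notMem hxK, sub_zero]

lemma cutoff_cutoff_of_subset {K L : Set X} (hK : MeasurableSet K) (hL : MeasurableSet L)
    (h : K ⊆ L) (f : Lp ℂ p μ) : cutoff hK (cutoff hL f) = cutoff hK f := by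
  refine Lp.ext ?_
  filter_upwards [cutoff_ae hK f, cutoff_ae hL f, cutoff_ae hK (cutoff hL f)] with x h₁ h₂ h₃
  rw [h₃, h₁]
  by_cases hxK : x ∈ K
  · rw [indicator_of_mem hxK, indicator_of_mem hxK, h₂, indicator_of_mem (h hxK)]
  · rw [indicator_of_notMem hxK, indicator_of_notMem hxK]

lemma norm_sub_cutoff_le {K : Set X} (hK : MeasurableSet K) (f : Lp ℂ p μ) :
    ‖f - cutoff hK f‖ ≤ ‖f‖ := by
  rw [← cutoff_compl]
  exact norm_cutoff_apply_le _ _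

lemma suppIn_sub_cutoff {K : Set X} (hK : MeasurableSet K) (f : Lp ℂ p μ) :
    SuppIn (f - cutoff hK f) Kᶜ := by
  rw [← cutoff_compl]
  exact suppIn_cutoff _ _

lemma enorm_add_rpow {K : Set X} {f g : Lp ℂ p μ} (hf : SuppIn f K) (hg : SuppIn g Kᶜ) :
    ‖f + g‖ₑ ^ (p : ℝ) = ‖f‖ₑ ^ (p : ℝ) + ‖g‖ₑ ^ (p : ℝ) := by
  have hp : (0 : ℝ) < p := exponent_pos
  rw [enorm_rpow_eq_lintegral, enorm_rpow_eq_lintegral, enorm_rpow_eq_lintegral,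
    ← lintegral_add_left (by fun_prop)]
  refine lintegral_congr_ae ?_
  filter_upwards [hf, hg, Lp.coeFn_add f g] with x h₁ h₂ h₃
  rw [h₃, Pi.add_apply]
  by_cases hx : x ∈ K
  · rw [h₂ (by simpa using hx)]
    simp [hp]
  · rw [h₁ hx]
    simp [hp]

lemma enorm_rpow_eq_ofReal (f : Lp ℂ p μ) : ‖f‖ₑ ^ (p : ℝ) = ENNReal.ofReal (‖f‖ ^ (p : ℝ)) := by
  rw [← ofReal_norm, ENNReal.ofReal_rpow_of_nonneg (norm_nonneg f) p.coe_nonneg]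

/-- The `p`-th power of the norm is additive on functions with disjoint supports. -/
lemma norm_add_rpow {K : Set X} {f g : Lp ℂ p μ} (hf : SuppIn f K) (hg : SuppIn g Kᶜ) :
    ‖f + g‖ ^ (p : ℝ) = ‖f‖ ^ (p : ℝ) + ‖g‖ ^ (p : ℝ) := by
  have h := enorm_add_rpow hf hg
  rw [enorm_rpow_eq_ofReal, enorm_rpow_eq_ofReal, enorm_rpow_eq_ofReal,
    ← ENNReal.ofReal_add (by positivity) (by positivity)] at h
  exact (ENNReal.ofReal_eq_ofReal_iff (by positivity) (by positivity)).1 h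

/-- A measurable function with values in the closed unit disc. -/
def IsMultiplier (ψ : X → ℂ) : Prop := Measurable ψ ∧ ∀ x, ‖ψ x‖ ≤ 1

lemma IsMultiplier.memLp {ψ : X → ℂ} (hψ : IsMultiplier ψ) (f : Lp ℂ p μ) :
    MemLp (fun x => ψ x * f x) p μ := by
  refine (Lp.memLp f).of_le (hψ.1.aestronglyMeasurable.mul (Lp.aestronglyMeasurable f))
    (Eventually.of_forall fun x => ?_)
  rw [norm_mul]
  exact mul_le_of_le_one_left (norm_nonneg _) (hψ.2 x)

/-- Multiplication by a measurable function of absolute value at most one. -/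
def mulOp {ψ : X → ℂ} (hψ : IsMultiplier ψ) : Lp ℂ p μ →L[ℂ] Lp ℂ p μ :=
  LinearMap.mkContinuous
    { toFun := fun f => (hψ.memLp f).toLp _
      map_add' := fun f g => by
        refine Lp.ext ?_
        filter_upwards [(hψ.memLp (f + g)).coeFn_toLp, (hψ.memLp f).coeFn_toLp,
          (hψ.memLp g).coeFn_toLp, Lp.coeFn_add f g,
          Lp.coeFn_add ((hψ.memLp f).toLp _) ((hψ.memLp g).toLp _)] with x h₁ h₂ h₃ h₄ h₅
        rw [h₁, h₅, Pi.add_apply, h₂, h₃, h₄, Pi.add_apply, mul_add]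
      map_smul' := fun c f => by
        refine Lp.ext ?_
        filter_upwards [(hψ.memLp (c • f)).coeFn_toLp, (hψ.memLp f).coeFn_toLp,
          Lp.coeFn_smul c f, Lp.coeFn_smul c ((hψ.memLp f).toLp _)] with x h₁ h₂ h₃ h₄
        rw [h₁, RingHom.id_apply, h₄, Pi.smul_apply, h₂, h₃, Pi.smul_apply, smul_eq_mul,
          smul_eq_mul, mul_left_comm] } 1 (fun f => by
      rw [one_mul]
      refine Lp.norm_le_norm_of_ae_le ?_
      filter_upwards [(hψ.memLp f).coeFn_toLp] with x hx
      rw [LinearMap.coe_mk, AddHom.coe_mk, hx, norm_mul]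
      exact mul_le_of_le_one_left (norm_nonneg _) (hψ.2 x))

lemma mulOp_ae {ψ : X → ℂ} (hψ : IsMultiplier ψ) (f : Lp ℂ p μ) :
    mulOp hψ f =ᵐ[μ] fun x => ψ x * f x :=
  (hψ.memLp f).coeFn_toLp

lemma SuppIn.mulOp {ψ : X → ℂ} (hψ : IsMultiplier ψ) {f : Lp ℂ p μ} {K : Set X}
    (hf : SuppIn f K) : SuppIn (mulOp hψ f) K := by
  filter_upwards [mulOp_ae hψ f, hf] with x h₁ h₂ hx
  rw [h₁, h₂ hx, mul_zero]

lemma suppIn_mulOp {ψ : X → ℂ} (hψ : IsMultiplier ψ) (f : Lp ℂ p μ) {K : Set X}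
    (hK : ∀ x ∉ K, ψ x = 0) : SuppIn (BandDominated.mulOp hψ f) K := by
  filter_upwards [mulOp_ae hψ f] with x h₁ hx
  rw [h₁, hK x hx, zero_mul]

end LpFacts

/-! ### Exhaustion by balls -/

section Balls

variable {X : Type*} [MetricSpace X] [MeasurableSpace X] [BorelSpace X] {μ : Measure X} {p : ℝ≥0}
  [Fact (1 ≤ (p : ℝ≥0∞))]

/-- Multiplication by the indicator function of a closed ball. -/
def ballCut (x : X) (r : ℝ) : Lp ℂ p μ →L[ℂ] Lp ℂ p μ :=
  cutoff (Metric.isClosed_closedBall (x := x) (ε := r)).measurableSet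

lemma suppIn_ballCut (x : X) (r : ℝ) (f : Lp ℂ p μ) :
    SuppIn (ballCut x r f) (Metric.closedBall x r) := suppIn_cutoff _ f

lemma SuppIn.ballCut_eq {x : X} {r : ℝ} {f : Lp ℂ p μ} (hf : SuppIn f (Metric.closedBall x r)) :
    ballCut x r f = f := hf.cutoff_eq _

lemma norm_ballCut_apply_le (x : X) (r : ℝ) (f : Lp ℂ p μ) : ‖ballCut x r f‖ ≤ ‖f‖ :=
  norm_cutoff_apply_le _ f

lemma suppIn_sub_ballCut (x : X) (r : ℝ) (f : Lp ℂ p μ) :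
    SuppIn (f - ballCut x r f) (Metric.closedBall x r)ᶜ := suppIn_sub_cutoff _ f

lemma ballCut_ballCut {x : X} {r s : ℝ} (h : r ≤ s) (f : Lp ℂ p μ) :
    ballCut x r (ballCut x s f) = ballCut x r f :=
  cutoff_cutoff_of_subset _ _ (Metric.closedBall_subset_closedBall h) f

/-- The restrictions of an `L_p` function to growing balls converge to it. -/
lemma tendsto_ballCut (x : X) (f : Lp ℂ p μ) :
    Tendsto (fun n : ℕ => ballCut x n f) atTop (𝓝 f) := by
  have hp : (0 : ℝ) < p := exponent_pos
  have h : Tendsto (fun n : ℕ => ‖f - ballCut x n f‖ₑ ^ (p : ℝ)) atTop (𝓝 0) := by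
    have h0 : (0 : ℝ≥0∞) = ∫⁻ _, 0 ∂μ := by simp
    have : ∀ n : ℕ, ‖f - ballCut x n f‖ₑ ^ (p : ℝ) =
        ∫⁻ y, (Metric.closedBall x n)ᶜ.indicator (fun y => ‖f y‖ₑ ^ (p : ℝ)) y ∂μ := by
      intro n
      rw [enorm_rpow_eq_lintegral]
      refine lintegral_congr_ae ?_
      have hB : MeasurableSet (Metric.closedBall x (n : ℝ)) :=
        Metric.isClosed_closedBall.measurableSet
      have he : f - ballCut x n f = cutoff hB.compl f := (cutoff_compl hB f).symm
      rw [he]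
      filter_upwards [cutoff_ae hB.compl f] with y hy
      rw [hy]
      by_cases hyB : y ∈ (Metric.closedBall x (n : ℝ))ᶜ
      · rw [indicator_of_mem hyB, indicator_of_mem hyB]
      · rw [indicator_of_notMem hyB, indicator_of_notMem hyB, enorm_zero,
          ENNReal.zero_rpow_of_pos hp]
    simp_rw [this]
    rw [h0]
    refine tendsto_lintegral_of_dominated_convergence' (fun y => ‖f y‖ₑ ^ (p : ℝ)) ?_ ?_ ?_ ?_
    · intro n
      refine AEMeasurable.indicator (by fun_prop)
        Metric.isClosed_closedBall.measurableSet.compl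
    · exact fun n => Eventually.of_forall fun y => indicator_le_self _ _ y
    · rw [← enorm_rpow_eq_lintegral]
      exact ENNReal.rpow_ne_top_of_nonneg hp.le enorm_ne_top
    · refine Eventually.of_forall fun y => ?_
      refine tendsto_const_nhds.congr' ?_
      filter_upwards [eventually_ge_atTop ⌈dist y x⌉₊] with n hn
      rw [indicator_of_notMem]
      simpa using (Nat.le_ceil _).trans (by exact_mod_cast hn : (⌈dist y x⌉₊ : ℝ) ≤ n)
  rw [tendsto_iff_edist_tendsto_0]
  have h' := h.ennrpow_const (p : ℝ)⁻¹
  rw [ENNReal.zero_rpow_of_pos (by positivity)] at h'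
  refine h'.congr fun n => ?_
  rw [ENNReal.rpow_rpow_inv hp.ne', edist_comm, edist_eq_enorm_sub]

lemma exists_norm_sub_ballCut_le (x : X) (f : Lp ℂ p μ) {ε : ℝ} (hε : 0 < ε) :
    ∃ n : ℕ, ‖f - ballCut x n f‖ ≤ ε := by
  have h := (tendsto_const_nhds (x := f)).sub (tendsto_ballCut x f)
  rw [sub_self] at h
  obtain ⟨n, hn⟩ := ((tendsto_zero_iff_norm_tendsto_zero.1 h).eventually_le_const hε).exists
  exact ⟨n, hn⟩

lemma eq_zero_of_forall_ballCut (x : X) {f : Lp ℂ p μ} (h : ∀ n : ℕ, ballCut x n f = 0) :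
    f = 0 :=
  tendsto_nhds_unique (tendsto_ballCut x f) (by simp [h])

/-- A bounded sequence in `L_p` which is consistent on growing balls consists of the restrictions
of one element of `L_p`: it is a Cauchy sequence, as the `p`-th powers of the norms are
increasing. -/
lemma exists_forall_ballCut_eq (x : X) {r : ℕ → Lp ℂ p μ} {C : ℝ} (hC : ∀ n, ‖r n‖ ≤ C)
    (hr : ∀ m n : ℕ, n ≤ m → ballCut x n (r m) = r n) : ∃ f, ∀ n : ℕ, ballCut x n f = r n := by
  have hp : (0 : ℝ) < p := exponent_pos
  have key : ∀ m n, n ≤ m → ‖r m‖ ^ (p : ℝ) = ‖r n‖ ^ (p : ℝ) + ‖r m - r n‖ ^ (p : ℝ) := by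
    intro m n hnm
    have h := norm_add_rpow (suppIn_ballCut x n (r m)) (suppIn_sub_ballCut x n (r m))
    rw [hr m n hnm, add_sub_cancel] at h
    exact h
  have hmono : Monotone fun n => ‖r n‖ ^ (p : ℝ) := by
    intro n m hnm
    have := key m n hnm
    have h0 : 0 ≤ ‖r m - r n‖ ^ (p : ℝ) := by positivity
    change ‖r n‖ ^ (p : ℝ) ≤ ‖r m‖ ^ (p : ℝ)
    linarith
  have hbdd : BddAbove (range fun n => ‖r n‖ ^ (p : ℝ)) := by
    refine ⟨C ^ (p : ℝ), ?_⟩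
    rintro _ ⟨n, rfl⟩
    exact Real.rpow_le_rpow (norm_nonneg _) (hC n) hp.le
  have hcau := (tendsto_atTop_ciSup hmono hbdd).cauchySeq
  have hcauchy : CauchySeq r := by
    rw [Metric.cauchySeq_iff'] at hcau ⊢
    intro ε hε
    obtain ⟨N, hN⟩ := hcau (ε ^ (p : ℝ)) (by positivity)
    refine ⟨N, fun n hn => ?_⟩
    have h := hN n hn
    rw [Real.dist_eq, key n N hn, add_sub_cancel_left, abs_of_nonneg (by positivity)] at h
    rw [dist_eq_norm]
    exact (Real.rpow_lt_rpow_iff (norm_nonneg _) hε.le hp).1 h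
  obtain ⟨f, hf⟩ := cauchySeq_tendsto_of_complete hcauchy
  refine ⟨f, fun n => ?_⟩
  refine tendsto_nhds_unique (((ballCut x n).continuous.tendsto f).comp hf) ?_
  refine tendsto_const_nhds.congr' ?_
  filter_upwards [eventually_ge_atTop n] with m hm
  exact (hr m n hm).symm

/-- For `p > 1`, a functional on `L_p` is small on functions which live far away: otherwise the
sum of two almost extremal functions with disjoint supports, of norm at most `2 ^ (1 / p) < 2`,
would contradict the bound for the functional. -/
lemma exists_norm_functional_le (hp1 : 1 < p) (x : X) (ℓ : Lp ℂ p μ →L[ℂ] ℂ) {ε : ℝ} (hε : 0 < ε) :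
    ∃ n : ℕ, ∀ f, SuppIn f (Metric.closedBall x n)ᶜ → ‖ℓ f‖ ≤ ε * ‖f‖ := by
  have hp : (0 : ℝ) < p := exponent_pos
  have hB : ∀ n : ℕ, MeasurableSet (Metric.closedBall x (n : ℝ)) := fun n =>
    Metric.isClosed_closedBall.measurableSet
  set a : ℕ → ℝ := fun n => ‖ℓ ∘L cutoff (hB n).compl‖ with ha_def
  have ha : ∀ (n : ℕ) f, SuppIn f (Metric.closedBall x (n : ℝ))ᶜ → ‖ℓ f‖ ≤ a n * ‖f‖ := by
    intro n f hf
    have h := (ℓ ∘L cutoff (hB n).compl).le_opNorm f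
    rwa [ContinuousLinearMap.comp_apply, hf.cutoff_eq (hB n).compl] at h
  have hbdd : BddBelow (range a) := ⟨0, by rintro _ ⟨n, rfl⟩; exact norm_nonneg _⟩
  set A := ⨅ n, a n with hA_def
  have hA0 : 0 ≤ A := le_ciInf fun n => norm_nonneg _
  suffices hA : A = 0 by
    obtain ⟨n, hn⟩ := exists_lt_of_ciInf_lt (show ⨅ n, a n < ε by rw [← hA_def, hA]; exact hε)
    exact ⟨n, fun f hf => (ha n f hf).trans (by gcongr)⟩
  by_contra hA
  have hApos : 0 < A := lt_of_le_of_ne hA0 (Ne.symm hA)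
  -- the near extremal functions, normalised so that `ℓ` is positive on them
  have ext : ∀ n : ℕ, ∀ c < A, ∃ f, SuppIn f (Metric.closedBall x (n : ℝ))ᶜ ∧ ‖f‖ ≤ 1 ∧
      c < ‖ℓ f‖ ∧ ∃ m : ℕ, SuppIn f (Metric.closedBall x (m : ℝ)) := by
    intro n c hc
    have hcn : c < a n := hc.trans_le (ciInf_le hbdd n)
    obtain ⟨f, hf1, hf⟩ := ContinuousLinearMap.exists_lt_apply_of_lt_opNorm
      (ℓ ∘L cutoff (hB n).compl) hcn
    rw [ContinuousLinearMap.comp_apply] at hf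
    set g := cutoff (hB n).compl f with hg
    have hlim := ((ℓ.continuous.tendsto g).comp (tendsto_ballCut x g)).norm
    obtain ⟨m, hm⟩ := (hlim.eventually_const_lt hf).exists
    exact ⟨ballCut x m g, (suppIn_cutoff _ f).cutoff _,
      ((norm_ballCut_apply_le _ _ _).trans (norm_cutoff_apply_le _ _)).trans hf1.le, hm, m,
      suppIn_ballCut _ _ _⟩
  have phase : ∀ z : ℂ, ∃ c : ℂ, ‖c‖ ≤ 1 ∧ c * z = ‖z‖ := by
    intro z
    by_cases hz : z = 0
    · exact ⟨0, by simp, by simp [hz]⟩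
    · refine ⟨‖z‖ / z, by simp [hz], ?_⟩
      field_simp
  have h2 : (2 : ℝ) ^ (p : ℝ)⁻¹ < 2 := by
    have : (p : ℝ)⁻¹ < 1 := inv_lt_one_of_one_lt₀ (by exact_mod_cast hp1)
    simpa using Real.rpow_lt_rpow_of_exponent_lt one_lt_two this
  have h2' : 0 < (2 : ℝ) ^ (p : ℝ)⁻¹ := by positivity
  have hlt : A < A * (2 / (2 : ℝ) ^ (p : ℝ)⁻¹) := by
    have : 1 < 2 / (2 : ℝ) ^ (p : ℝ)⁻¹ := by rwa [lt_div_iff₀ h2', one_mul]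
    nlinarith
  obtain ⟨b, hAb, hb⟩ := exists_between hlt
  obtain ⟨n, hn⟩ := exists_lt_of_ciInf_lt (show ⨅ n, a n < b from hAb)
  have hc : b * (2 : ℝ) ^ (p : ℝ)⁻¹ / 2 < A := by
    rw [div_lt_iff₀ two_pos, ← lt_div_iff₀ h2', mul_div_assoc]
    exact hb
  obtain ⟨f, hf, hf1, hfℓ, m, hfm⟩ := ext n _ hc
  obtain ⟨g, hg, hg1, hgℓ, -⟩ := ext (max m n) _ hc
  obtain ⟨c, hc1, hcf⟩ := phase (ℓ f)
  obtain ⟨d, hd1, hdg⟩ := phase (ℓ g)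
  have hsum : ‖c • f + d • g‖ ≤ (2 : ℝ) ^ (p : ℝ)⁻¹ := by
    have h := norm_add_rpow (hfm.smul c) ((hg.smul d).mono (compl_subset_compl.2
      (Metric.closedBall_subset_closedBall (by exact_mod_cast le_max_left m n))))
    have h₁ : ‖c • f‖ ^ (p : ℝ) ≤ 1 := Real.rpow_le_one (norm_nonneg _)
      (by rw [norm_smul]; exact mul_le_one₀ hc1 (norm_nonneg _) hf1) hp.le
    have h₂ : ‖d • g‖ ^ (p : ℝ) ≤ 1 := Real.rpow_le_one (norm_nonneg _)
      (by rw [norm_smul]; exact mul_le_one₀ hd1 (norm_nonneg _) hg1) hp.le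
    rw [Real.le_rpow_inv_iff_of_pos (norm_nonneg _) zero_le_two hp]
    linarith
  have hsupp : SuppIn (c • f + d • g) (Metric.closedBall x (n : ℝ))ᶜ :=
    (hf.smul c).add ((hg.smul d).mono (compl_subset_compl.2
      (Metric.closedBall_subset_closedBall (by exact_mod_cast le_max_right m n))))
  have h := ha n _ hsupp
  rw [map_add, map_smul, map_smul, smul_eq_mul, smul_eq_mul, hcf, hdg, ← Complex.ofReal_add,
    Complex.norm_real, Real.norm_of_nonneg (by positivity)] at h
  have h' : a n * ‖c • f + d • g‖ ≤ b * (2 : ℝ) ^ (p : ℝ)⁻¹ :=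
    mul_le_mul hn.le hsum (norm_nonneg _) (by linarith)
  linarith

end Balls

/-! ### Continuity and locality of the shifts -/

section Scheffe

variable {X : Type*} [MeasurableSpace X] {μ : Measure X} {p : ℝ≥0} [Fact (1 ≤ (p : ℝ≥0∞))]

/-- Almost everywhere convergence together with constancy of the norm implies convergence in
`L_p`. This is Fatou's lemma for `2 ^ (p - 1) * (|u n| ^ p + |v| ^ p) - |u n - v| ^ p`. -/
lemma tendsto_of_ae_tendsto_of_norm_eq {u : ℕ → Lp ℂ p μ} {v : Lp ℂ p μ}
    (hae : ∀ᵐ x ∂μ, Tendsto (fun n => u n x) atTop (𝓝 (v x))) (hn : ∀ n, ‖u n‖ = ‖v‖) :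
    Tendsto u atTop (𝓝 v) := by
  have hp : (0 : ℝ) < p := exponent_pos
  set c : ℝ≥0∞ := 2 ^ ((p : ℝ) - 1) with hc
  have hctop : c ≠ ∞ := ENNReal.rpow_ne_top_of_nonneg (by linarith [one_le_exponent (p := p)])
    ENNReal.ofNat_ne_top
  set I : ℝ≥0∞ := ‖v‖ₑ ^ (p : ℝ) with hI
  have hItop : I ≠ ∞ := ENNReal.rpow_ne_top_of_nonneg hp.le enorm_ne_top
  set J : ℝ≥0∞ := c * (I + I) with hJ
  have hJtop : J ≠ ∞ := ENNReal.mul_ne_top hctop (ENNReal.add_ne_top.2 ⟨hItop, hItop⟩)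
  have hun : ∀ n, ‖u n‖ₑ ^ (p : ℝ) = I := fun n => by
    rw [enorm_rpow_eq_ofReal, hn, hI, enorm_rpow_eq_ofReal]
  set F : ℕ → X → ℝ≥0∞ := fun n x => c * (‖u n x‖ₑ ^ (p : ℝ) + ‖v x‖ₑ ^ (p : ℝ)) with hF
  set D : ℕ → X → ℝ≥0∞ := fun n x => ‖u n x - v x‖ₑ ^ (p : ℝ) with hD
  have hDF : ∀ n x, D n x ≤ F n x := by
    intro n x
    refine (ENNReal.rpow_le_rpow (enorm_sub_le) hp.le).trans ?_
    exact ENNReal.rpow_add_le_mul_rpow_add_rpow _ _ one_le_exponent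
  have hFint : ∀ n, ∫⁻ x, F n x ∂μ = J := by
    intro n
    rw [hF, lintegral_const_mul' _ _ hctop, lintegral_add_left (by fun_prop),
      ← enorm_rpow_eq_lintegral, ← enorm_rpow_eq_lintegral, hun]
  have hd : ∀ n, ∫⁻ x, D n x ∂μ = ‖u n - v‖ₑ ^ (p : ℝ) := by
    intro n
    rw [enorm_rpow_eq_lintegral]
    refine lintegral_congr_ae ?_
    filter_upwards [Lp.coeFn_sub (u n) v] with x hx
    rw [hx, Pi.sub_apply]
  have hdtop : ∀ n, ∫⁻ x, D n x ∂μ ≠ ∞ := fun n => by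
    rw [hd]
    exact ENNReal.rpow_ne_top_of_nonneg hp.le enorm_ne_top
  have hfatou := lintegral_liminf_le' (μ := μ) (u := atTop) (f := fun (n : ℕ) x => F n x - D n x)
    (fun n => by fun_prop)
  have hleft : J ≤ ∫⁻ x, liminf (fun n => F n x - D n x) atTop ∂μ := by
    have : ∫⁻ x, c * (‖v x‖ₑ ^ (p : ℝ) + ‖v x‖ₑ ^ (p : ℝ)) ∂μ = J := by
      rw [lintegral_const_mul' _ _ hctop, lintegral_add_left (by fun_prop),
        ← enorm_rpow_eq_lintegral]
    rw [← this]
    refine lintegral_mono_ae ?_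
    filter_upwards [hae] with x hx
    have h₁ : Tendsto (fun n => F n x) atTop
        (𝓝 (c * (‖v x‖ₑ ^ (p : ℝ) + ‖v x‖ₑ ^ (p : ℝ)))) :=
      ENNReal.Tendsto.const_mul ((hx.enorm.ennrpow_const _).add tendsto_const_nhds)
        (Or.inr hctop)
    have h₂ : Tendsto (fun n => D n x) atTop (𝓝 0) := by
      have := ((hx.sub_const (v x)).enorm).ennrpow_const (p : ℝ)
      simpa [hp] using this
    have h₃ := ENNReal.Tendsto.sub h₁ h₂ (Or.inr ENNReal.zero_ne_top)
    rw [h₃.liminf_eq, tsub_zero]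
  have hright : ∀ n, ∫⁻ x, F n x - D n x ∂μ = J - ∫⁻ x, D n x ∂μ := by
    intro n
    rw [lintegral_sub' (by fun_prop) (hdtop n) (Eventually.of_forall (hDF n)), hFint]
  simp_rw [hright] at hfatou
  have hlim : Tendsto (fun n => ∫⁻ x, D n x ∂μ) atTop (𝓝 0) := by
    rw [ENNReal.tendsto_nhds_zero]
    intro ε hε
    by_cases hJ0 : J = 0
    · refine Eventually.of_forall fun n => ?_
      have : ∫⁻ x, D n x ∂μ ≤ J := (lintegral_mono (hDF n)).trans_eq (hFint n)
      rw [hJ0] at this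
      exact this.trans (zero_le)
    · have hlt : J - ε < liminf (fun n => J - ∫⁻ x, D n x ∂μ) atTop :=
        (ENNReal.sub_lt_self hJtop hJ0 hε.ne').trans_le (hleft.trans hfatou)
      filter_upwards [eventually_lt_of_lt_liminf hlt] with n hn
      by_contra hlt'
      exact absurd hn (not_lt.2 (tsub_le_tsub_left (not_le.1 hlt').le J))
  rw [tendsto_iff_edist_tendsto_0]
  have h' := hlim.ennrpow_const (p : ℝ)⁻¹
  rw [ENNReal.zero_rpow_of_pos (by positivity)] at h'
  refine h'.congr fun n => ?_
  rw [hd, ENNReal.rpow_rpow_inv hp.ne', edist_eq_enorm_sub]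

end Scheffe

namespace ShiftSystem

variable {X : Type*} [MetricSpace X] [MeasurableSpace X] [ProperSpace X] [BorelSpace X]
  {μ : Measure X} [μ.Regular] {p : ℝ≥0} [Fact (1 ≤ (p : ℝ≥0∞))]

lemma conj_apply (S : ShiftSystem μ p) (B : Lp ℂ p μ →L[ℂ] Lp ℂ p μ) (y : X) (f : Lp ℂ p μ) :
    S.conj B y f = S.U y (B ((S.U y).symm f)) := rfl

lemma continuous_U (S : ShiftSystem μ p) (f : Lp ℂ p μ) : Continuous fun y => S.U y f := by
  refine continuous_of_uniform_approx_of_continuous fun u hu => ?_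
  obtain ⟨ε, hε, hu⟩ := Metric.mem_uniformity_dist.1 hu
  obtain ⟨g, -, hfg, hgc, hg⟩ := (Lp.memLp f).exists_hasCompactSupport_eLpNorm_sub_le
    ENNReal.coe_ne_top (ENNReal.ofReal_pos.2 (half_pos hε)).ne'
  refine ⟨fun y => S.U y (hg.toLp g), ?_, fun y => hu ?_⟩
  · rw [continuous_iff_seqContinuous]
    intro y y₀ hy
    refine tendsto_of_ae_tendsto_of_norm_eq ?_ fun n => by simp
    have hU : ∀ x, ∀ᵐ z ∂μ, S.U x (hg.toLp g) z = g (S.φ x z) * S.h x z := by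
      intro x
      filter_upwards [S.U_ae x (hg.toLp g),
        (S.quasiMeasurePreserving x).ae hg.coeFn_toLp] with z h₁ h₂
      rw [h₁, h₂]
    filter_upwards [ae_all_iff.2 fun n => hU (y n), hU y₀, S.continuous_φ, S.continuous_h]
      with z h₁ h₂ h₃ h₄
    simp only [Function.comp_apply, h₁, h₂]
    exact (((hgc.tendsto _).comp ((h₃.tendsto y₀).comp hy))).mul ((h₄.tendsto y₀).comp hy)
  · rw [dist_eq_norm, ← map_sub, LinearIsometryEquiv.norm_map]
    have h1 : ‖f - hg.toLp g‖ ≤ ε / 2 := by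
      have hf : f = (Lp.memLp f).toLp f := (Lp.toLp_coeFn f _).symm
      rw [hf, ← MemLp.toLp_sub, Lp.norm_toLp]
      exact ENNReal.toReal_le_of_le_ofReal (half_pos hε).le hfg
    linarith

lemma continuous_U_apply (S : ShiftSystem μ p) {v : X → Lp ℂ p μ} (hv : Continuous v) :
    Continuous fun y => S.U y (v y) := by
  rw [continuous_iff_continuousAt]
  intro y₀
  have h₁ : Tendsto (fun y => S.U y (v y₀)) (𝓝 y₀) (𝓝 (S.U y₀ (v y₀))) :=
    (S.continuous_U (v y₀)).tendsto y₀
  have h₂ : Tendsto (fun y => S.U y (v y - v y₀)) (𝓝 y₀) (𝓝 0) := by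
    rw [tendsto_zero_iff_norm_tendsto_zero]
    simp_rw [LinearIsometryEquiv.norm_map]
    simpa using ((hv.tendsto y₀).sub_const (v y₀)).norm
  simpa [ContinuousAt] using h₂.add h₁

lemma continuous_U_symm (S : ShiftSystem μ p) (f : Lp ℂ p μ) :
    Continuous fun y => (S.U y).symm f := by
  rw [continuous_iff_continuousAt]
  intro y₀
  have h := (S.continuous_U ((S.U y₀).symm f)).tendsto y₀
  rw [LinearIsometryEquiv.apply_symm_apply] at h
  have h' := tendsto_iff_norm_sub_tendsto_zero.1 h
  refine tendsto_iff_norm_sub_tendsto_zero.2 (h'.congr fun y => ?_)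
  rw [← LinearIsometryEquiv.norm_map (S.U y) ((S.U y).symm f - (S.U y₀).symm f), map_sub,
    LinearIsometryEquiv.apply_symm_apply, norm_sub_rev]

lemma continuous_conj (S : ShiftSystem μ p) (B : Lp ℂ p μ →L[ℂ] Lp ℂ p μ) (f : Lp ℂ p μ) :
    Continuous fun y => S.conj B y f :=
  S.continuous_U_apply (B.continuous.comp (S.continuous_U_symm f))

lemma norm_conj_apply_le (S : ShiftSystem μ p) (B : Lp ℂ p μ →L[ℂ] Lp ℂ p μ) (y : X)
    (f : Lp ℂ p μ) : ‖S.conj B y f‖ ≤ ‖B‖ * ‖f‖ := by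
  rw [conj_apply, LinearIsometryEquiv.norm_map]
  simpa using B.le_opNorm ((S.U y).symm f)

lemma conj_conj (S : ShiftSystem μ p) (B C : Lp ℂ p μ →L[ℂ] Lp ℂ p μ) (y : X) (f : Lp ℂ p μ) :
    S.conj B y (S.conj C y f) = S.conj (B ∘L C) y f := by
  simp [conj_apply]

lemma suppIn_U (S : ShiftSystem μ p) (y : X) {f : Lp ℂ p μ} {K : Set X} (hf : SuppIn f K) :
    SuppIn (S.U y f) (S.φ y ⁻¹' K) := by
  filter_upwards [S.U_ae y f, (S.quasiMeasurePreserving y).ae hf] with z h₁ h₂ hz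
  rw [h₁, h₂ hz, zero_mul]

lemma suppIn_U_symm (S : ShiftSystem μ p) (y : X) {f : Lp ℂ p μ} {K : Set X} (hf : SuppIn f K) :
    SuppIn ((S.U y).symm f) ((S.φ y).symm ⁻¹' K) := by
  have hq : Measure.QuasiMeasurePreserving (S.φ y).symm μ μ :=
    ⟨(S.φ y).symm.continuous.measurable, S.map_ac y⟩
  have h := S.U_ae y ((S.U y).symm f)
  rw [LinearIsometryEquiv.apply_symm_apply] at h
  have h' : ∀ᵐ z ∂μ, z ∉ K → (S.U y).symm f (S.φ y z) = 0 := by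
    filter_upwards [h, hf, S.h_ne_zero exponent_ne_zero y] with z h₁ h₂ h₃ hz
    have h₄ := h₂ hz
    rw [h₁] at h₄
    exact (mul_eq_zero.1 h₄).resolve_right h₃
  filter_upwards [hq.ae h'] with z hz hzK
  simpa using hz hzK

lemma preimage_closedBall (S : ShiftSystem μ p) (y : X) (r : ℝ) :
    S.φ y ⁻¹' Metric.closedBall y r = Metric.closedBall S.base r := by
  have h := (S.φ y).preimage_closedBall y r
  rwa [show (S.φ y).symm y = S.base by
    rw [IsometryEquiv.symm_apply_eq, S.φ_base]] at h

lemma preimage_symm_closedBall (S : ShiftSystem μ p) (y : X) (r : ℝ) :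
    (S.φ y).symm ⁻¹' Metric.closedBall S.base r = Metric.closedBall y r := by
  have h := (S.φ y).symm.preimage_closedBall S.base r
  rwa [IsometryEquiv.symm_symm, S.φ_base] at h

lemma suppIn_U_symm_closedBall (S : ShiftSystem μ p) (y : X) {r : ℝ} {f : Lp ℂ p μ}
    (hf : SuppIn f (Metric.closedBall S.base r)) :
    SuppIn ((S.U y).symm f) (Metric.closedBall y r) :=
  S.preimage_symm_closedBall y r ▸ S.suppIn_U_symm y hf

lemma suppIn_U_closedBall (S : ShiftSystem μ p) (y : X) {r : ℝ} {f : Lp ℂ p μ}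
    (hf : SuppIn f (Metric.closedBall y r)) :
    SuppIn (S.U y f) (Metric.closedBall S.base r) :=
  S.preimage_closedBall y r ▸ S.suppIn_U y hf

lemma U_symm_ballCut (S : ShiftSystem μ p) (y : X) (r : ℝ) (f : Lp ℂ p μ) :
    (S.U y).symm (ballCut S.base r f) = ballCut y r ((S.U y).symm f) := by
  have h₁ := S.suppIn_U_symm_closedBall y (suppIn_ballCut S.base r f)
  have h₂ := S.suppIn_U_symm y (suppIn_sub_ballCut S.base r f)
  rw [preimage_compl, S.preimage_symm_closedBall] at h₂
  have h₃ : ballCut y r ((S.U y).symm (f - ballCut S.base r f)) = 0 :=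
    h₂.cutoff_eq_zero _ disjoint_compl_right
  rw [map_sub, map_sub, h₁.ballCut_eq, sub_eq_zero] at h₃
  exact h₃.symm

lemma U_ballCut (S : ShiftSystem μ p) (y : X) (r : ℝ) (f : Lp ℂ p μ) :
    S.U y (ballCut y r f) = ballCut S.base r (S.U y f) := by
  have h := S.U_symm_ballCut y r (S.U y f)
  rw [LinearIsometryEquiv.symm_apply_apply] at h
  rw [← h, LinearIsometryEquiv.apply_symm_apply]

end ShiftSystem

/-! ### Band-dominated operators -/

section Band

variable {X : Type*} [MetricSpace X] [MeasurableSpace X] {μ : Measure X} {p : ℝ≥0}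
  [Fact (1 ≤ (p : ℝ≥0∞))]

lemma setDist_le_propagation {A : Lp ℂ p μ →L[ℂ] Lp ℂ p μ} {K K' : Set X} (hK : MeasurableSet K)
    (hK' : MeasurableSet K') (h : cutoff hK' ∘L A ∘L cutoff hK ≠ 0) :
    setDist K K' ≤ propagation A :=
  le_iSup_of_le K <| le_iSup_of_le K' <| le_iSup_of_le hK <| le_iSup_of_le hK' <|
    le_iSup_of_le h le_rfl

lemma propagation_le {A : Lp ℂ p μ →L[ℂ] Lp ℂ p μ} {c : ℝ≥0∞}
    (h : ∀ (K K' : Set X) (hK : MeasurableSet K) (hK' : MeasurableSet K'),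
      cutoff hK' ∘L A ∘L cutoff hK ≠ 0 → setDist K K' ≤ c) : propagation A ≤ c :=
  iSup_le fun K => iSup_le fun K' => iSup_le fun hK => iSup_le fun hK' => iSup_le fun h0 =>
    h K K' hK hK' h0

lemma propagation_add_le (A B : Lp ℂ p μ →L[ℂ] Lp ℂ p μ) :
    propagation (A + B) ≤ max (propagation A) (propagation B) := by
  refine propagation_le fun K K' hK hK' h => ?_
  by_cases hA : cutoff hK' ∘L A ∘L cutoff hK = 0
  · by_cases hB : cutoff hK' ∘L B ∘L cutoff hK = 0
    · exact absurd (by rw [ContinuousLinearMap.add_comp, ContinuousLinearMap.comp_add, hA, hB,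
        add_zero]) h
    · exact (setDist_le_propagation hK hK' hB).trans (le_max_right _ _)
  · exact (setDist_le_propagation hK hK' hA).trans (le_max_left _ _)

lemma propagation_smul_le (c : ℂ) (A : Lp ℂ p μ →L[ℂ] Lp ℂ p μ) :
    propagation (c • A) ≤ propagation A := by
  refine propagation_le fun K K' hK hK' h => setDist_le_propagation hK hK' fun hA => h ?_
  rw [ContinuousLinearMap.smul_comp, ContinuousLinearMap.comp_smul, hA, smul_zero]

lemma propagation_id : propagation (ContinuousLinearMap.id ℂ (Lp ℂ p μ)) = 0 := by
  refine le_antisymm (propagation_le fun K K' hK hK' h => ?_) zero_le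
  by_cases hKK' : Disjoint K' K
  · refine absurd (ContinuousLinearMap.ext fun f => ?_) h
    exact (suppIn_cutoff hK f).cutoff_eq_zero hK' hKK'
  · obtain ⟨x, hx', hx⟩ := not_disjoint_iff.1 hKK'
    refine (iInf₂_le x hx).trans ((iInf₂_le x hx').trans_eq (edist_self x))

lemma add_mem_BDO {A B : Lp ℂ p μ →L[ℂ] Lp ℂ p μ} (hA : A ∈ BDO μ p) (hB : B ∈ BDO μ p) :
    A + B ∈ BDO μ p :=
  map_mem_closure₂ continuous_add hA hB fun _ ha _ hb =>
    (propagation_add_le _ _).trans_lt (max_lt ha hb)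

lemma smul_mem_BDO (c : ℂ) {A : Lp ℂ p μ →L[ℂ] Lp ℂ p μ} (hA : A ∈ BDO μ p) :
    c • A ∈ BDO μ p :=
  map_mem_closure (continuous_const_smul c) hA fun _ ha =>
    (propagation_smul_le _ _).trans_lt ha

lemma sub_mem_BDO {A B : Lp ℂ p μ →L[ℂ] Lp ℂ p μ} (hA : A ∈ BDO μ p) (hB : B ∈ BDO μ p) :
    A - B ∈ BDO μ p := by
  have := add_mem_BDO hA (smul_mem_BDO (-1) hB)
  rwa [neg_one_smul, ← sub_eq_add_neg] at this

lemma id_mem_BDO : ContinuousLinearMap.id ℂ (Lp ℂ p μ) ∈ BDO μ p :=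
  subset_closure (by
    change propagation _ < ∞
    rw [propagation_id]
    exact ENNReal.zero_lt_top)

/-- An operator of finite propagation does not connect sets that are far apart. -/
lemma exists_cutoff_comp_eq_zero {A : Lp ℂ p μ →L[ℂ] Lp ℂ p μ} (hA : propagation A < ∞) :
    ∃ w : ℝ, 0 ≤ w ∧ ∀ (K K' : Set X) (hK : MeasurableSet K) (hK' : MeasurableSet K'),
      (∀ a ∈ K, ∀ b ∈ K', w ≤ dist a b) → cutoff hK' ∘L A ∘L cutoff hK = 0 := by
  refine ⟨(propagation A).toReal + 1, by positivity, fun K K' hK hK' h => ?_⟩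
  by_contra h0
  have h₁ := setDist_le_propagation hK hK' h0
  have h₂ : ENNReal.ofReal ((propagation A).toReal + 1) ≤ setDist K K' := by
    refine le_iInf₂ fun a ha => le_iInf₂ fun b hb => ?_
    rw [edist_dist]
    exact ENNReal.ofReal_le_ofReal (h a ha b hb)
  have h₃ := h₂.trans h₁
  rw [ENNReal.ofReal_le_iff_le_toReal hA.ne] at h₃
  linarith

/-- A band-dominated operator almost does not connect sets that are far apart. -/
lemma exists_norm_cutoff_le {A : Lp ℂ p μ →L[ℂ] Lp ℂ p μ} (hA : A ∈ BDO μ p) {ε : ℝ} (hε : 0 < ε) :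
    ∃ w : ℝ, 0 ≤ w ∧ ∀ (K K' : Set X) (_ : MeasurableSet K) (hK' : MeasurableSet K'),
      (∀ a ∈ K, ∀ b ∈ K', w ≤ dist a b) → ∀ f, SuppIn f K → ‖cutoff hK' (A f)‖ ≤ ε * ‖f‖ := by
  obtain ⟨B, hB, hAB⟩ := Metric.mem_closure_iff.1 hA ε hε
  obtain ⟨w, hw, h⟩ := exists_cutoff_comp_eq_zero hB
  refine ⟨w, hw, fun K K' hK hK' hd f hf => ?_⟩
  have h0 : cutoff hK' (B f) = 0 := by
    have := congrArg (fun C => C f) (h K K' hK hK' hd)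
    simpa [hf.cutoff_eq hK] using this
  have h₁ : cutoff hK' (A f) = cutoff hK' ((A - B) f) := by
    rw [sub_apply, map_sub, h0, sub_zero]
  rw [h₁]
  refine (norm_cutoff_apply_le hK' _).trans ?_
  refine (A - B).le_of_opNorm_le ?_ f
  rw [← dist_eq_norm]
  exact hAB.le

end Band

namespace ShiftSystem

variable {X : Type*} [MetricSpace X] [MeasurableSpace X] [ProperSpace X] [BorelSpace X]
  {μ : Measure X} [μ.Regular] {p : ℝ≥0} [Fact (1 ≤ (p : ℝ≥0∞))]

/-- The conjugates of a band-dominated operator by shifts are band-dominated uniformly. -/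
lemma exists_norm_conj_sub_ballCut_le (S : ShiftSystem μ p) {B : Lp ℂ p μ →L[ℂ] Lp ℂ p μ}
    (hB : B ∈ BDO μ p) {ε : ℝ} (hε : 0 < ε) : ∃ w : ℝ, 0 ≤ w ∧
      (∀ y r f, SuppIn f (Metric.closedBall S.base r) →
        ‖S.conj B y f - ballCut S.base (r + w) (S.conj B y f)‖ ≤ ε * ‖f‖) ∧
      (∀ y r f, SuppIn f (Metric.closedBall S.base (r + w))ᶜ →
        ‖ballCut S.base r (S.conj B y f)‖ ≤ ε * ‖f‖) := by
  obtain ⟨w, hw, h⟩ := exists_norm_cutoff_le hB hε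
  have hmeas : ∀ (y : X) (r : ℝ), MeasurableSet (Metric.closedBall y r) := fun y r =>
    Metric.isClosed_closedBall.measurableSet
  refine ⟨w, hw, fun y r f hf => ?_, fun y r f hf => ?_⟩
  · rw [conj_apply, ← U_ballCut, ← map_sub, LinearIsometryEquiv.norm_map, ballCut,
      ← cutoff_compl]
    refine (h _ _ (hmeas y r) (hmeas y (r + w)).compl (fun a ha b hb => ?_) _
      (S.suppIn_U_symm_closedBall y hf)).trans_eq (by rw [LinearIsometryEquiv.norm_map])
    rw [mem_compl_iff, Metric.mem_closedBall, not_le] at hb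
    rw [Metric.mem_closedBall] at ha
    linarith [dist_triangle_left b y a]
  · have hf' := S.suppIn_U_symm y hf
    rw [preimage_compl, S.preimage_symm_closedBall] at hf'
    rw [conj_apply, ← U_ballCut, LinearIsometryEquiv.norm_map]
    refine (h _ _ (hmeas y (r + w)).compl (hmeas y r) (fun a ha b hb => ?_) _ hf').trans_eq
      (by rw [LinearIsometryEquiv.norm_map])
    rw [mem_compl_iff, Metric.mem_closedBall, not_le] at ha
    rw [Metric.mem_closedBall] at hb
    linarith [dist_triangle a b y]

end ShiftSystem

/-! ### The boundary of the Stone-Čech compactification -/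

section Boundary

variable {X : Type*} [MetricSpace X] [ProperSpace X]

instance neBot_comap_stoneCechUnit (x : StoneCech X) :
    (comap (stoneCechUnit : X → StoneCech X) (𝓝 x)).NeBot :=
  comap_neBot fun _ hs =>
    let ⟨_, hy, a, ha⟩ := mem_closure_iff_nhds.1 (denseRange_stoneCechUnit x) _ hs
    ⟨a, ha ▸ hy⟩

lemma eventually_lt_dist_of_mem_boundary {x : StoneCech X} (hx : x ∈ boundary X) (z : X) (r : ℝ) :
    ∀ᶠ y in comap (stoneCechUnit : X → StoneCech X) (𝓝 x), r < dist y z := by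
  have hc : IsCompact (stoneCechUnit '' Metric.closedBall z r : Set (StoneCech X)) :=
    (isCompact_closedBall z r).image continuous_stoneCechUnit
  have hx' : (stoneCechUnit '' Metric.closedBall z r : Set (StoneCech X))ᶜ ∈ 𝓝 x :=
    hc.isClosed.isOpen_compl.mem_nhds fun ⟨y, _, hy⟩ => hx ⟨y, hy⟩
  filter_upwards [preimage_mem_comap hx'] with y hy
  by_contra hlt
  exact hy ⟨y, Metric.mem_closedBall.2 (not_lt.1 hlt), rfl⟩

/-- A family of points that leaves every ball along an ultrafilter converges to a point of the
boundary. -/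
lemma exists_mem_boundary_tendsto {ι : Type*} (l : Ultrafilter ι) {y : ι → X} (z : X)
    (hy : ∀ r : ℝ, ∀ᶠ i in (l : Filter ι), r < dist (y i) z) :
    ∃ x ∈ boundary X, Tendsto y l (comap stoneCechUnit (𝓝 x)) := by
  obtain ⟨x, -, hx⟩ := (isCompact_univ (X := StoneCech X)).ultrafilter_le_nhds
    (l.map fun i => stoneCechUnit (y i)) (by simp)
  have hx' : Tendsto (fun i => (stoneCechUnit (y i) : StoneCech X)) l (𝓝 x) := hx
  refine ⟨x, ?_, tendsto_comap_iff.2 hx'⟩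
  rintro ⟨a, rfl⟩
  have ha : Tendsto y l (𝓝 a) := isInducing_stoneCechUnit.tendsto_nhds_iff.2 hx'
  have h₁ := ha (Metric.ball_mem_nhds a one_pos)
  obtain ⟨i, hi, hi'⟩ := ((hy (1 + dist a z)).and h₁).exists
  have h₂ : dist (y i) a < 1 := hi'
  linarith [dist_triangle (y i) a z]

/-- A bounded continuous function converges along the trace of the neighbourhoods of each point of
the Stone-Čech compactification. -/
lemma exists_tendsto_of_bounded {g : X → ℂ} (hg : Continuous g) {R : ℝ} (hR : ∀ y, ‖g y‖ ≤ R)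
    (x : StoneCech X) : ∃ z, Tendsto g (comap stoneCechUnit (𝓝 x)) (𝓝 z) := by
  have hcs : CompactSpace (Metric.closedBall (0 : ℂ) R) :=
    isCompact_iff_compactSpace.1 (isCompact_closedBall 0 R)
  set g' : X → Metric.closedBall (0 : ℂ) R := fun y => ⟨g y, mem_closedBall_zero_iff.2 (hR y)⟩
  have hg' : Continuous g' := hg.subtype_mk _
  refine ⟨(stoneCechExtend hg' x : Metric.closedBall (0 : ℂ) R), ?_⟩
  have h : Tendsto (fun y => ((stoneCechExtend hg' (stoneCechUnit y) :
      Metric.closedBall (0 : ℂ) R) : ℂ)) (comap stoneCechUnit (𝓝 x))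
      (𝓝 ((stoneCechExtend hg' x : Metric.closedBall (0 : ℂ) R) : ℂ)) :=
    ((continuous_subtype_val.comp (continuous_stoneCechExtend hg')).tendsto x).comp tendsto_comap
  simpa [stoneCechExtend_stoneCechUnit] using h

end Boundary

/-! ### Existence of limit operators -/

namespace ShiftSystem

variable {X : Type*} [MetricSpace X] [MeasurableSpace X] [ProperSpace X] [BorelSpace X]
  {μ : Measure X} [μ.Regular] {p : ℝ≥0} [Fact (1 ≤ (p : ℝ≥0∞))]

/-- The properties of the projection `Q` of `L_p` onto the subspace in question on which the
theory of limit operators relies. -/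
structure IsLocallyCompactProjection (S : ShiftSystem μ p) (Q : Lp ℂ p μ →L[ℂ] Lp ℂ p μ) :
    Prop where
  mem_BDO : Q ∈ BDO μ p
  idem : ∀ f, Q (Q f) = Q f
  compact_left : ∀ x r, IsCompactOperator (ballCut x r ∘L Q)
  compact_right : ∀ x r, IsCompactOperator (Q ∘L ballCut x r)
  extendsTo : S.ExtendsToStoneCech Q

/-- The operator `B'` is the limit of the conjugates `U_y B U_y⁻¹` in the strong operator topology
as `y ∈ X` tends to the point `x` of the Stone-Čech compactification. -/
def IsStrongLimit (S : ShiftSystem μ p) (B : Lp ℂ p μ →L[ℂ] Lp ℂ p μ) (x : StoneCech X)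
    (B' : Lp ℂ p μ →L[ℂ] Lp ℂ p μ) : Prop :=
  ∀ f, Tendsto (fun y => S.conj B y f) (comap stoneCechUnit (𝓝 x)) (𝓝 (B' f))

lemma IsStrongLimit.isWeakLimit {S : ShiftSystem μ p} {B B' : Lp ℂ p μ →L[ℂ] Lp ℂ p μ}
    {x : StoneCech X} (h : S.IsStrongLimit B x B') : S.IsWeakLimit B x B' := by
  refine ContinuousLinearMapWOT.tendsto_iff_forall_dual_apply_tendsto.2 fun f ℓ => ?_
  exact (ℓ.continuous.tendsto _).comp (h f)

lemma IsWeakLimit.unique {S : ShiftSystem μ p} {B B₁ B₂ : Lp ℂ p μ →L[ℂ] Lp ℂ p μ}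
    {x : StoneCech X} (h₁ : S.IsWeakLimit B x B₁) (h₂ : S.IsWeakLimit B x B₂) : B₁ = B₂ :=
  ContinuousLinearMapWOT.ofCLM_injective (tendsto_nhds_unique h₁ h₂)

variable {S : ShiftSystem μ p} {Q T : Lp ℂ p μ →L[ℂ] Lp ℂ p μ}

/-- The local compactness of the projection `Q`: bounded families are mapped by conjugates of `Q`
to families that converge locally along ultrafilters. This is where the norm continuous extension
to the Stone-Čech compactification enters. -/
lemma IsLocallyCompactProjection.exists_tendsto_ballCut (hQ : S.IsLocallyCompactProjection Q)
    {ι : Type*} (l : Ultrafilter ι) {y : ι → X} {x : StoneCech X}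
    (hy : Tendsto y l (comap stoneCechUnit (𝓝 x))) {g : ι → Lp ℂ p μ} {C : ℝ}
    (hg : ∀ i, ‖g i‖ ≤ C) (r : ℝ) :
    ∃ z, Tendsto (fun i => ballCut S.base r (S.conj Q (y i) (g i))) l (𝓝 z) := by
  refine exists_tendsto_of_approx l fun ε hε => ?_
  have hC : 0 < |C| + 1 := by positivity
  obtain ⟨w, -, -, hw⟩ := S.exists_norm_conj_sub_ballCut_le hQ.mem_BDO
    (show 0 < ε / (|C| + 1) by positivity)
  refine ⟨fun i => ballCut S.base r (S.conj Q (y i) (ballCut S.base (r + w) (g i))), ?_,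
    fun i => ?_⟩
  · obtain ⟨F, hF, hFe⟩ := hQ.extendsTo _ _ (isCompact_closedBall S.base r)
      (isCompact_closedBall S.base (r + w))
    have hcomp : ∀ y, IsCompactOperator (F (stoneCechUnit y)) := by
      intro y
      have h1 : F (stoneCechUnit y) = (S.U y : Lp ℂ p μ →L[ℂ] Lp ℂ p μ) ∘L
          ((ballCut y r ∘L Q) ∘L (((S.U y).symm : Lp ℂ p μ →L[ℂ] Lp ℂ p μ) ∘L
            ballCut S.base (r + w))) := by
        rw [hFe]
        ext1 f
        exact (S.U_ballCut y r _).symm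
      rw [h1]
      exact ((hQ.compact_left y r).comp_clm (((S.U y).symm : Lp ℂ p μ →L[ℂ] Lp ℂ p μ) ∘L
        ballCut S.base (r + w))).clm_comp (S.U y : Lp ℂ p μ →L[ℂ] Lp ℂ p μ)
    have hFx : IsCompactOperator (F x) := by
      have hcl : IsClosed {z | IsCompactOperator (F z)} :=
        (isClosed_setOfPred_isCompactOperator (σ₁₂ := RingHom.id ℂ)
          (M₁ := Lp ℂ p μ) (M₂ := Lp ℂ p μ)).preimage hF
      exact hcl.closure_subset_iff.2 (by rintro _ ⟨y, rfl⟩; exact hcomp y)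
        (denseRange_stoneCechUnit x)
    obtain ⟨z, hz⟩ := exists_tendsto_of_isCompactOperator hFx l hg
    refine ⟨z, ?_⟩
    have hdiff : Tendsto (fun i => (F (stoneCechUnit (y i)) - F x) (g i)) l (𝓝 0) := by
      have h1 : Tendsto (fun i => ‖F (stoneCechUnit (y i)) - F x‖ * C) l (𝓝 0) := by
        have h2 := ((hF.tendsto x).comp (tendsto_comap_iff.1 hy))
        simpa using (tendsto_iff_norm_sub_tendsto_zero.1 h2).mul_const C
      refine squeeze_zero_norm (fun i => ?_) h1
      exact (ContinuousLinearMap.le_opNorm _ _).trans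
        (mul_le_mul_of_nonneg_left (hg i) (norm_nonneg _))
    have := hdiff.add hz
    rw [zero_add] at this
    refine this.congr fun i => ?_
    rw [sub_apply, sub_add_cancel, hFe]
    rfl
  · rw [← map_sub, ← map_sub]
    refine (hw (y i) r _ (suppIn_sub_ballCut S.base (r + w) (g i))).trans ?_
    have h1 : ‖g i - ballCut S.base (r + w) (g i)‖ ≤ |C| + 1 :=
      (norm_sub_cutoff_le _ _).trans ((hg i).trans ((le_abs_self C).trans (by linarith)))
    calc ε / (|C| + 1) * ‖g i - ballCut S.base (r + w) (g i)‖ ≤ ε / (|C| + 1) * (|C| + 1) := by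
          gcongr
      _ = ε := by field_simp

/-- Conjugates of `Q` map bounded families with supports in a common ball to families that converge
along ultrafilters. -/
lemma IsLocallyCompactProjection.exists_tendsto (hQ : S.IsLocallyCompactProjection Q)
    {ι : Type*} (l : Ultrafilter ι) {y : ι → X} {x : StoneCech X}
    (hy : Tendsto y l (comap stoneCechUnit (𝓝 x))) {g : ι → Lp ℂ p μ} {C : ℝ}
    (hg : ∀ i, ‖g i‖ ≤ C) {r : ℝ} (hr : ∀ i, SuppIn (g i) (Metric.closedBall S.base r)) :
    ∃ z, Tendsto (fun i => S.conj Q (y i) (g i)) l (𝓝 z) := by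
  refine exists_tendsto_of_approx l fun ε hε => ?_
  obtain ⟨w, -, hw, -⟩ := S.exists_norm_conj_sub_ballCut_le hQ.mem_BDO
    (show 0 < ε / (|C| + 1) by positivity)
  refine ⟨_, hQ.exists_tendsto_ballCut l hy hg (r + w), fun i => ?_⟩
  refine (hw (y i) r (g i) (hr i)).trans ?_
  calc ε / (|C| + 1) * ‖g i‖ ≤ ε / (|C| + 1) * (|C| + 1) := by
        gcongr
        exact (hg i).trans ((le_abs_self C).trans (by linarith))
    _ = ε := by field_simp

/-- Strong limits exist at all points of the Stone-Čech compactification for band-dominated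
operators with values in the range of `Q`. Local compactness gives limits along all
ultrafilters; that they coincide is seen by testing against functionals, since bounded continuous
functions extend to the compactification. -/
lemma IsLocallyCompactProjection.exists_isStrongLimit (hQ : S.IsLocallyCompactProjection Q)
    (hT : T ∈ BDO μ p) (hQT : ∀ f, Q (T f) = T f) (x : StoneCech X) :
    ∃ T', S.IsStrongLimit T x T' := by
  have hconj : ∀ y f, S.conj Q y (S.conj T y f) = S.conj T y f := by
    intro y f
    rw [conj_conj]
    simp [conj_apply, hQT]
  have hlim : ∀ f, ∃ z, Tendsto (fun y => S.conj T y f) (comap stoneCechUnit (𝓝 x)) (𝓝 z) := by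
    intro f
    have hu : ∀ u : Ultrafilter X, (u : Filter X) ≤ comap stoneCechUnit (𝓝 x) →
        ∃ z, Tendsto (fun y => S.conj T y f) u (𝓝 z) := by
      intro u hu
      refine exists_tendsto_of_approx u fun ε hε => ?_
      obtain ⟨n, hn⟩ := exists_norm_sub_ballCut_le S.base f
        (show 0 < ε / (2 * (‖T‖ + 1)) by positivity)
      obtain ⟨w, -, hw, -⟩ := S.exists_norm_conj_sub_ballCut_le hT
        (show 0 < ε / (2 * (‖f‖ + 1)) by positivity)
      set g := ballCut S.base n f with hg
      refine ⟨fun y => ballCut S.base (n + w) (S.conj T y g), ?_, fun y => ?_⟩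
      · have h := hQ.exists_tendsto_ballCut u (y := id) (x := x) hu
          (g := fun y => S.conj T y g) (fun y => S.norm_conj_apply_le T y g) (n + w)
        simpa only [hconj, id] using h
      · have h₁ : ‖S.conj T y f - S.conj T y g‖ ≤ ε / 2 := by
          rw [← map_sub]
          calc ‖S.conj T y (f - g)‖ ≤ ‖T‖ * ‖f - g‖ := S.norm_conj_apply_le T y _
            _ ≤ (‖T‖ + 1) * (ε / (2 * (‖T‖ + 1))) := by gcongr; linarith
            _ = ε / 2 := by field_simp
        have h₂ : ‖S.conj T y g - ballCut S.base (n + w) (S.conj T y g)‖ ≤ ε / 2 := by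
          refine (hw y n g (suppIn_ballCut _ _ _)).trans ?_
          calc ε / (2 * (‖f‖ + 1)) * ‖g‖ ≤ ε / (2 * (‖f‖ + 1)) * (‖f‖ + 1) := by
                gcongr
                exact (norm_ballCut_apply_le _ _ _).trans (by linarith)
            _ = ε / 2 := by field_simp
        have h₃ := norm_add_le (S.conj T y f - S.conj T y g)
          (S.conj T y g - ballCut S.base (n + w) (S.conj T y g))
        rw [sub_add_sub_cancel] at h₃
        linarith
    obtain ⟨z, hz⟩ := hu (Ultrafilter.of _) (Ultrafilter.of_le _)
    refine ⟨z, tendsto_iff_ultrafilter _ _ _ |>.2 fun u hul => ?_⟩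
    obtain ⟨z', hz'⟩ := hu u hul
    suffices z' = z by rwa [← this]
    rw [SeparatingDual.eq_iff_forall_dual_eq (R := ℂ)]
    intro ℓ
    obtain ⟨c, hc⟩ := exists_tendsto_of_bounded (ℓ.continuous.comp (S.continuous_conj T f))
      (R := ‖ℓ‖ * (‖T‖ * ‖f‖)) (fun y => (ℓ.le_opNorm _).trans
        (mul_le_mul_of_nonneg_left (S.norm_conj_apply_le T y f) (norm_nonneg _))) x
    have h₁ := tendsto_nhds_unique ((ℓ.continuous.tendsto z').comp hz') (hc.mono_left hul)
    have h₂ := tendsto_nhds_unique ((ℓ.continuous.tendsto z).comp hz)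
      (hc.mono_left (Ultrafilter.of_le _))
    rw [h₁, h₂]
  choose T' hT' using hlim
  refine ⟨ContinuousLinearMap.ofTendstoOfBoundedRange T' (fun y => S.conj T y)
    (tendsto_pi_nhds.2 hT') ?_, fun f => ?_⟩
  · refine isBounded_iff_forall_norm_le.2 ⟨‖T‖, ?_⟩
    rintro _ ⟨y, rfl⟩
    exact ContinuousLinearMap.opNorm_le_bound _ (norm_nonneg _) (S.norm_conj_apply_le T y)
  · simpa using hT' f

end ShiftSystem

/-! ### Limit operators of Fredholm operators -/

lemma isCompactOperator_of_hasNoetherianRange {E F : Type*} [NormedAddCommGroup E]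
    [NormedSpace ℂ E] [NormedAddCommGroup F] [NormedSpace ℂ F] {D : E →L[ℂ] F}
    (hD : D.toLinearMap.HasNoetherianRange) : IsCompactOperator D := by
  have hfin : FiniteDimensional ℂ D.range := Module.Finite.of_fg hD.hasFiniteRange
  have : ProperSpace D.range := FiniteDimensional.proper ℂ _
  set D' : E →L[ℂ] D.range := D.codRestrict D.range fun f => ⟨f, rfl⟩
  have h : IsCompactOperator (D.range.subtypeL : D.range →L[ℂ] F) :=
    isCompactOperator_of_locallyCompactSpace_rng _
  exact h.comp_clm D'

/-- A Fredholm operator is invertible modulo compact operators. -/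
lemma exists_inverse_mod_compact {E : Type*} [NormedAddCommGroup E] [NormedSpace ℂ E]
    {A : E →L[ℂ] E} (hA : A.IsFredholm) : ∃ R : E →L[ℂ] E,
      IsCompactOperator (R ∘L A - ContinuousLinearMap.id ℂ E) ∧
      IsCompactOperator (A ∘L R - ContinuousLinearMap.id ℂ E) := by
  obtain ⟨R, h₁, h₂⟩ := ContinuousLinearMap.isFredholm_iff_exists_isQuasiInverse.1 hA
  exact ⟨R, isCompactOperator_of_hasNoetherianRange
      (LinearMap.FiniteRangeSetoid.equiv_iff_hasNoetherianRange.1 h₁),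
    isCompactOperator_of_hasNoetherianRange
      (LinearMap.FiniteRangeSetoid.equiv_iff_hasNoetherianRange.1 h₂)⟩

namespace ShiftSystem

variable {X : Type*} [MetricSpace X] [MeasurableSpace X] [ProperSpace X] [BorelSpace X]
  {μ : Measure X} [μ.Regular] {p : ℝ≥0} [Fact (1 ≤ (p : ℝ≥0∞))]
  {S : ShiftSystem μ p} {x : StoneCech X}

section Algebra

variable {B B' C C' : Lp ℂ p μ →L[ℂ] Lp ℂ p μ}

lemma IsStrongLimit.unique (h : S.IsStrongLimit B x B') (h' : S.IsStrongLimit B x C') : B' = C' :=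
  ContinuousLinearMap.ext fun f => tendsto_nhds_unique (h f) (h' f)

lemma IsStrongLimit.apply_tendsto {ι : Type*} {l : Filter ι} {y : ι → X}
    (h : S.IsStrongLimit B x B') (hy : Tendsto y l (comap stoneCechUnit (𝓝 x)))
    {f : ι → Lp ℂ p μ} {g : Lp ℂ p μ} (hf : Tendsto f l (𝓝 g)) :
    Tendsto (fun i => S.conj B (y i) (f i)) l (𝓝 (B' g)) := by
  have h₁ : Tendsto (fun i => S.conj B (y i) (f i - g)) l (𝓝 0) := by
    refine squeeze_zero_norm (fun i => S.norm_conj_apply_le B (y i) (f i - g)) ?_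
    simpa using (tendsto_iff_norm_sub_tendsto_zero.1 hf).const_mul ‖B‖
  simpa using h₁.add ((h g).comp hy)

lemma IsStrongLimit.comp (hB : S.IsStrongLimit B x B') (hC : S.IsStrongLimit C x C') :
    S.IsStrongLimit (B ∘L C) x (B' ∘L C') := fun f => by
  refine (hB.apply_tendsto tendsto_id (hC f)).congr fun y => ?_
  rw [id, conj_conj]

lemma IsStrongLimit.add (hB : S.IsStrongLimit B x B') (hC : S.IsStrongLimit C x C') :
    S.IsStrongLimit (B + C) x (B' + C') := fun f => by
  simpa [conj_apply] using (hB f).add (hC f)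

lemma IsStrongLimit.sub (hB : S.IsStrongLimit B x B') (hC : S.IsStrongLimit C x C') :
    S.IsStrongLimit (B - C) x (B' - C') := fun f => by
  simpa [conj_apply] using (hB f).sub (hC f)

lemma IsStrongLimit.smul (c : ℂ) (hB : S.IsStrongLimit B x B') :
    S.IsStrongLimit (c • B) x (c • B') := fun f => by
  simpa [conj_apply] using (hB f).const_smul c

lemma isStrongLimit_id : S.IsStrongLimit (ContinuousLinearMap.id ℂ _) x
    (ContinuousLinearMap.id ℂ _) := fun f => by
  simp [conj_apply]

end Algebra

/-- Inverse shifts to infinity followed by a compact operator tend to zero strongly: the shifted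
functions live far away and hence tend to zero weakly. -/
lemma tendsto_compact_U_symm (hp1 : 1 < p) (hx : x ∈ boundary X) {E : Type*}
    [NormedAddCommGroup E] [NormedSpace ℂ E] {K : Lp ℂ p μ →L[ℂ] E} (hK : IsCompactOperator K)
    (f : Lp ℂ p μ) :
    Tendsto (fun y => K ((S.U y).symm f)) (comap stoneCechUnit (𝓝 x)) (𝓝 0) := by
  refine tendsto_zero_of_weakly_null hK (C := ‖f‖) (fun y => by simp) fun ℓ => ?_
  rw [Metric.tendsto_nhds]
  intro ε hε
  obtain ⟨n, hn⟩ := exists_norm_sub_ballCut_le S.base f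
    (show 0 < ε / (3 * (‖ℓ‖ + 1)) by positivity)
  obtain ⟨m, hm⟩ := exists_norm_functional_le hp1 S.base ℓ
    (show 0 < ε / (3 * (‖f‖ + 1)) by positivity)
  filter_upwards [eventually_lt_dist_of_mem_boundary hx S.base (n + m)] with y hy
  set g := ballCut S.base n f with hg
  have h₁ : ‖ℓ ((S.U y).symm g)‖ ≤ ε / 3 := by
    refine (hm _ ((S.suppIn_U_symm_closedBall y (suppIn_ballCut S.base n f)).mono
      fun a ha ha' => ?_)).trans ?_
    · rw [Metric.mem_closedBall] at ha ha'
      linarith [dist_triangle_left y S.base a]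
    · rw [LinearIsometryEquiv.norm_map]
      calc ε / (3 * (‖f‖ + 1)) * ‖g‖ ≤ ε / (3 * (‖f‖ + 1)) * (‖f‖ + 1) := by
            gcongr
            exact (norm_ballCut_apply_le _ _ _).trans (by linarith)
        _ = ε / 3 := by field_simp
  have h₂ : ‖ℓ ((S.U y).symm (f - g))‖ ≤ ε / 3 := by
    refine (ℓ.le_opNorm _).trans ?_
    rw [LinearIsometryEquiv.norm_map]
    calc ‖ℓ‖ * ‖f - g‖ ≤ (‖ℓ‖ + 1) * (ε / (3 * (‖ℓ‖ + 1))) := by gcongr; linarith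
      _ = ε / 3 := by field_simp
  rw [dist_zero_right]
  have h₃ : ℓ ((S.U y).symm f) = ℓ ((S.U y).symm (f - g)) + ℓ ((S.U y).symm g) := by
    rw [← map_add, ← map_add, sub_add_cancel]
  rw [h₃]
  linarith [norm_add_le (ℓ ((S.U y).symm (f - g))) (ℓ ((S.U y).symm g))]

variable {M : Submodule ℂ (Lp ℂ p μ)} {P : Lp ℂ p μ →L[ℂ] M}

/-- The projection of the setting has the properties used in the theory of limit operators. -/
lemma isLocallyCompactProjection (hP : IsAdmissibleProjection M P)
    (hS : S.ExtendsToStoneCech (M.subtypeL ∘L P)) :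
    S.IsLocallyCompactProjection (M.subtypeL ∘L P) where
  mem_BDO := hP.mem_BDO
  idem f := by simp [hP.apply_coe]
  compact_left y r := hP.compact_left _ (isCompact_closedBall y r)
  compact_right y r := hP.compact_right _ (isCompact_closedBall y r)
  extendsTo := hS

variable {A : M →L[ℂ] M} {Q' N : Lp ℂ p μ →L[ℂ] Lp ℂ p μ}

/-- Limit operators of Fredholm operators are injective: the estimate `‖f‖ ≤ C ‖A f‖ + ‖D f‖` with
`D` compact is shifted to infinity, where `D` disappears. -/
lemma limit_injective_of_isFredholm (hp1 : 1 < p) (hA : A.IsFredholm)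
    (hx : x ∈ boundary X) (hQ' : S.IsStrongLimit (M.subtypeL ∘L P) x Q')
    (hN : S.IsStrongLimit (compProj P A) x N) {f : Lp ℂ p μ} (hf : N f = 0) : Q' f = 0 := by
  obtain ⟨R, hR, -⟩ := exists_inverse_mod_compact hA
  set D := R ∘L A - ContinuousLinearMap.id ℂ M with hD
  have hbd : ∀ g, ‖(M.subtypeL ∘L P) g‖ ≤ ‖R‖ * ‖compProj P A g‖ + ‖(D ∘L P) g‖ := by
    intro g
    have h₁ : P g = R (A (P g)) - D (P g) := by simp [hD]
    calc ‖(M.subtypeL ∘L P) g‖ = ‖P g‖ := rfl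
      _ = ‖R (A (P g)) - D (P g)‖ := by rw [← h₁]
      _ ≤ ‖R (A (P g))‖ + ‖D (P g)‖ := norm_sub_le _ _
      _ ≤ ‖R‖ * ‖compProj P A g‖ + ‖(D ∘L P) g‖ :=
        add_le_add (R.le_opNorm _) le_rfl
  have hDP : IsCompactOperator (D ∘L P) := hR.comp_clm P
  have hlim : ‖Q' f‖ ≤ ‖R‖ * ‖N f‖ + ‖(0 : M)‖ := by
    refine le_of_tendsto_of_tendsto' (hQ' f).norm
      (((hN f).norm.const_mul ‖R‖).add (S.tendsto_compact_U_symm hp1 hx hDP f).norm) fun y => ?_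
    rw [conj_apply, conj_apply, LinearIsometryEquiv.norm_map, LinearIsometryEquiv.norm_map]
    exact hbd _
  rw [hf, norm_zero, norm_zero, mul_zero, add_zero] at hlim
  exact norm_le_zero_iff.1 hlim

/-- Limit operators of Fredholm operators are surjective: if `R` inverts `A` modulo compact
operators, then the shifts of `R` applied to `f` converge locally along an ultrafilter, and the
local limit is a preimage of `f`. -/
lemma limit_surjective_of_isFredholm (hp1 : 1 < p) (hP : IsAdmissibleProjection M P)
    (hQ : S.IsLocallyCompactProjection (M.subtypeL ∘L P)) (hAB : A ∈ bandDominatedOn P)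
    (hA : A.IsFredholm) (hx : x ∈ boundary X)
    (hQ' : S.IsStrongLimit (M.subtypeL ∘L P) x Q')
    (hN : S.IsStrongLimit (compProj P A) x N) (f : Lp ℂ p μ) : ∃ g, N g = Q' f := by
  obtain ⟨R, -, hR⟩ := exists_inverse_mod_compact hA
  set D := A ∘L R - ContinuousLinearMap.id ℂ M with hD
  set T := compProj P A with hT
  set g : X → Lp ℂ p μ := fun y => S.conj (compProj P R) y f with hg
  have hgC : ∀ y, ‖g y‖ ≤ ‖compProj P R‖ * ‖f‖ := fun y => S.norm_conj_apply_le _ y f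
  set C := ‖compProj P R‖ * ‖f‖ with hC
  have hQg : ∀ y, S.conj (M.subtypeL ∘L P) y (g y) = g y := by
    intro y
    rw [hg, conj_conj]
    simp [conj_apply, compProj, hP.apply_coe]
  have hTg : ∀ y, S.conj T y (g y) =
      S.conj (M.subtypeL ∘L P) y f + S.U y ((M.subtypeL ∘L (D ∘L P)) ((S.U y).symm f)) := by
    intro y
    rw [hg, conj_conj, conj_apply, conj_apply, ← map_add]
    congr 1
    simp [hT, hD, compProj, hP.apply_coe]
  set u : Ultrafilter X := Ultrafilter.of (comap stoneCechUnit (𝓝 x)) with hu_def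
  have hu : (u : Filter X) ≤ comap stoneCechUnit (𝓝 x) := Ultrafilter.of_le _
  have hTglim : Tendsto (fun y => S.conj T y (g y)) u (𝓝 (Q' f)) := by
    have hDP : IsCompactOperator (M.subtypeL ∘L (D ∘L P)) := (hR.comp_clm P).clm_comp M.subtypeL
    have h₁ := (S.tendsto_compact_U_symm hp1 hx hDP f).mono_left hu
    have h₂ : Tendsto (fun y => S.U y ((M.subtypeL ∘L (D ∘L P)) ((S.U y).symm f))) u (𝓝 0) := by
      rw [tendsto_zero_iff_norm_tendsto_zero] at h₁ ⊢
      simpa only [LinearIsometryEquiv.norm_map] using h₁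
    have h₃ := ((hQ' f).mono_left hu).add h₂
    rw [add_zero] at h₃
    exact h₃.congr fun y => (hTg y).symm
  have hloc : ∀ n : ℕ, ∃ z, Tendsto (fun y => ballCut S.base n (g y)) u (𝓝 z) := by
    intro n
    have h := hQ.exists_tendsto_ballCut u (y := id) hu hgC n
    simpa only [id, hQg] using h
  choose r hr using hloc
  have hrC : ∀ n, ‖r n‖ ≤ C := fun n =>
    le_of_tendsto' (hr n).norm fun y => (norm_ballCut_apply_le _ _ _).trans (hgC y)
  obtain ⟨h, hh⟩ := exists_forall_ballCut_eq S.base hrC fun m n hnm => by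
    refine tendsto_nhds_unique (((ballCut S.base n).continuous.tendsto _).comp (hr m)) ?_
    refine (hr n).congr fun y => ?_
    exact (ballCut_ballCut (by exact_mod_cast hnm) (g y)).symm
  refine ⟨h, (sub_eq_zero.1 (eq_zero_of_forall_ballCut S.base fun n => ?_)).symm⟩
  -- both sides agree on the ball of radius `n` up to every positive error
  have hlim := ((ballCut S.base n).continuous.tendsto _).comp
    (hTglim.sub ((hN h).mono_left hu))
  have hsmall : ∀ ε : ℝ, 0 < ε → ‖ballCut S.base n (Q' f - N h)‖ ≤ ε * (C + ‖h‖) := by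
    intro ε hε
    obtain ⟨w, hw, -, hband⟩ := S.exists_norm_conj_sub_ballCut_le (B := T) hAB hε
    obtain ⟨m, hm⟩ := exists_nat_ge (n + w)
    have hbound : ∀ y, ‖ballCut S.base n (S.conj T y (g y) - S.conj T y h)‖ ≤
        ε * (C + ‖h‖) + ‖T‖ * ‖ballCut S.base m (g y) - r m‖ := by
      intro y
      set d := g y - h with hd
      have hd' : ballCut S.base m d = ballCut S.base m (g y) - r m := by
        rw [hd, map_sub, hh]
      have h₁ := hband y n (d - ballCut S.base m d) ((suppIn_sub_ballCut S.base m d).mono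
        (compl_subset_compl.2 (Metric.closedBall_subset_closedBall hm)))
      have h₂ : ‖ballCut S.base n (S.conj T y (ballCut S.base m d))‖ ≤
          ‖T‖ * ‖ballCut S.base m d‖ :=
        (norm_ballCut_apply_le _ _ _).trans (S.norm_conj_apply_le T y _)
      have h₃ : ‖d - ballCut S.base m d‖ ≤ C + ‖h‖ :=
        (norm_sub_cutoff_le _ d).trans ((norm_sub_le _ _).trans (by gcongr; exact hgC y))
      rw [← map_sub, ← hd', ← hd]
      have h₄ := norm_add_le (ballCut S.base n (S.conj T y (d - ballCut S.base m d)))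
        (ballCut S.base n (S.conj T y (ballCut S.base m d)))
      rw [← map_add, ← map_add, sub_add_cancel] at h₄
      have h₅ : ε * ‖d - ballCut S.base m d‖ ≤ ε * (C + ‖h‖) := by gcongr
      linarith
    have h₀ : Tendsto (fun y => ε * (C + ‖h‖) + ‖T‖ * ‖ballCut S.base m (g y) - r m‖) u
        (𝓝 (ε * (C + ‖h‖) + ‖T‖ * 0)) :=
      ((tendsto_iff_norm_sub_tendsto_zero.1 (hr m)).const_mul _).const_add _
    rw [mul_zero, add_zero] at h₀
    exact le_of_tendsto_of_tendsto' hlim.norm h₀ hbound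
  have hCh : 0 ≤ C + ‖h‖ := by positivity
  refine norm_le_zero_iff.1 (le_of_forall_pos_le_add fun ε hε => ?_)
  refine (hsmall (ε / (C + ‖h‖ + 1)) (by positivity)).trans ?_
  rw [zero_add, div_mul_eq_mul_div, div_le_iff₀ (by positivity)]
  nlinarith

end ShiftSystem

/-! ### Decomposition of the space into cells -/

section Cells

/-- A decomposition of a metric space into countably many measurable cells of bounded diameter,
such that the number of cells near a given one is bounded. Cells may be empty, and the empty ones
are not counted. -/
structure CellDecomposition (X : Type*) [MetricSpace X] [MeasurableSpace X] where
  cell : ℕ → Set X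
  center : ℕ → X
  radius : ℝ
  measurableSet_cell : ∀ k, MeasurableSet (cell k)
  disjoint_cell : Pairwise (Function.onFun Disjoint cell)
  iUnion_cell : ⋃ k, cell k = univ
  dist_center_le : ∀ k, ∀ x ∈ cell k, dist x (center k) ≤ radius
  nbr : ℝ → ℕ → Finset ℕ
  mem_nbr : ∀ W k l, l ∈ nbr W k ↔
    (cell k).Nonempty ∧ (cell l).Nonempty ∧ dist (center k) (center l) ≤ W
  bound : ℝ → ℕ
  card_nbr_le : ∀ W k, (nbr W k).card ≤ bound W

variable {X : Type*} [MetricSpace X]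

/-- In a space of bounded geometry, separated sets have a bounded number of points in balls of a
given radius. -/
lemma exists_ncard_le {ε : ℝ}
    (h : ∀ r : ℝ, 0 < r → ∃ N : ℕ, ∀ x : X, ∃ s : Finset X,
      s.card ≤ N ∧ Metric.ball x r ⊆ ⋃ y ∈ s, Metric.ball y ε)
    {Z : Set X} (hZ : Z.Pairwise fun a b => 2 * ε ≤ dist a b) (W : ℝ) :
    ∃ N : ℕ, ∀ x, (Z ∩ Metric.closedBall x W).Finite ∧ (Z ∩ Metric.closedBall x W).ncard ≤ N := by
  obtain ⟨N, hN⟩ := h (|W| + 1) (by positivity)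
  refine ⟨N, fun x => ?_⟩
  obtain ⟨s, hs, hcov⟩ := hN x
  have hex : ∀ a ∈ Z ∩ Metric.closedBall x W, ∃ y ∈ s, dist a y < ε := by
    intro a ha
    have h1 : a ∈ Metric.ball x (|W| + 1) := by
      have := Metric.mem_closedBall.1 ha.2
      exact Metric.mem_ball.2 (by linarith [le_abs_self W])
    simpa using hcov h1
  have : Nonempty X := ⟨x⟩
  choose! c hc hcd using hex
  have hinj : InjOn c (Z ∩ Metric.closedBall x W) := by
    intro a ha b hb hab
    by_contra hne
    have h1 := hZ ha.1 hb.1 hne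
    have h2 := hcd a ha
    have h3 := hcd b hb
    rw [hab] at h2
    linarith [dist_triangle_right a b (c b)]
  have hmaps : MapsTo c (Z ∩ Metric.closedBall x W) (s : Set X) := fun a ha => hc a ha
  refine ⟨Finite.of_injOn hmaps hinj s.finite_toSet, ?_⟩
  refine (ncard_le_ncard_of_injOn c hmaps hinj s.finite_toSet).trans ?_
  rwa [ncard_coe_finset]

/-- Spaces of bounded geometry have cell decompositions: the centres are the points of a maximal
separated set, and each point belongs to the cell of the first centre close to it. -/
lemma nonempty_cellDecomposition [MeasurableSpace X] [BorelSpace X] [Nonempty X]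
    (h : BoundedGeometry X) : Nonempty (CellDecomposition X) := by
  obtain ⟨ε, hε, h⟩ := h
  obtain ⟨Z, hZ⟩ := zorn_subset {Z : Set X | Z.Pairwise fun a b => 2 * ε ≤ dist a b} (by
    intro c hc hchain
    exact ⟨⋃₀ c, (pairwise_sUnion hchain.directedOn).2 hc, fun s hs => subset_sUnion_of_mem hs⟩)
  have hsep : Z.Pairwise fun a b => 2 * ε ≤ dist a b := hZ.prop
  have hcover : ∀ x, ∃ z ∈ Z, dist x z < 2 * ε := by
    intro x
    by_contra! hx
    have hins : (insert x Z).Pairwise fun a b => 2 * ε ≤ dist a b := by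
      refine hsep.insert fun b hb _ => ⟨hx b hb, ?_⟩
      rw [dist_comm]
      exact hx b hb
    have hxZ : x ∈ Z := hZ.le_of_ge hins (subset_insert x Z) (mem_insert x Z)
    have := hx x hxZ
    rw [dist_self] at this
    linarith
  have hcard := exists_ncard_le h hsep
  have hZne : Z.Nonempty := by
    obtain ⟨z, hz, -⟩ := hcover (Classical.arbitrary X)
    exact ⟨z, hz⟩
  have hZc : Z.Countable := by
    have hZu : Z = ⋃ n : ℕ, Z ∩ Metric.closedBall (Classical.arbitrary X) (n : ℝ) := by
      rw [← inter_iUnion, Metric.iUnion_closedBall_nat, inter_univ]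
    rw [hZu]
    refine countable_iUnion fun n => ?_
    obtain ⟨N, hN⟩ := hcard n
    exact (hN _).1.countable
  obtain ⟨e, he⟩ := hZc.exists_eq_range hZne
  set b : ℕ → Set X := fun n => Metric.ball (e n) (2 * ε) with hb
  have hfirst : ∀ k l, (disjointed b k).Nonempty → (disjointed b l).Nonempty → e k = e l →
      k = l := by
    have key : ∀ k l, (disjointed b l).Nonempty → e k = e l → ¬ k < l := by
      rintro k l ⟨x, hx⟩ hkl hlt
      rw [disjointed_eq_inter_compl] at hx
      have h1 : x ∈ b l := hx.1
      have h2 : x ∉ b k := by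
        have := hx.2
        simp only [mem_iInter] at this
        exact this k hlt
      exact h2 (by rw [hb] at h1 ⊢; simpa [hkl] using h1)
    intro k l hk hl hkl
    exact le_antisymm (not_lt.1 (key l k hk hkl.symm)) (not_lt.1 (key k l hl hkl))
  have hnbr : ∀ W : ℝ, ∃ N : ℕ, ∀ k, ∃ t : Finset ℕ, t.card ≤ N ∧ ∀ l, l ∈ t ↔
      (disjointed b k).Nonempty ∧ (disjointed b l).Nonempty ∧ dist (e k) (e l) ≤ W := by
    intro W
    obtain ⟨N, hN⟩ := hcard W
    refine ⟨N, fun k => ?_⟩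
    set t : Set ℕ := {l | (disjointed b k).Nonempty ∧ (disjointed b l).Nonempty ∧
      dist (e k) (e l) ≤ W} with ht
    have hmaps : MapsTo e t (Z ∩ Metric.closedBall (e k) W) := fun l hl =>
      ⟨he ▸ mem_range_self l, by rw [Metric.mem_closedBall, dist_comm]; exact hl.2.2⟩
    have hinj : InjOn e t := fun l hl m hm hlm => hfirst l m hl.2.1 hm.2.1 hlm
    have hfin : t.Finite := Finite.of_injOn hmaps hinj (hN _).1
    refine ⟨hfin.toFinset, ?_, fun l => by simp [ht]⟩
    rw [← ncard_eq_toFinset_card t hfin]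
    exact (ncard_le_ncard_of_injOn e hmaps hinj (hN _).1).trans (hN _).2
  choose D t htD ht using hnbr
  exact ⟨{
    cell := disjointed b
    center := e
    radius := 2 * ε
    measurableSet_cell := fun k => MeasurableSet.disjointed (fun n => measurableSet_ball) k
    disjoint_cell := disjoint_disjointed b
    iUnion_cell := by
      rw [iUnion_disjointed, eq_univ_iff_forall]
      intro x
      obtain ⟨z, hz, hxz⟩ := hcover x
      rw [he] at hz
      obtain ⟨n, rfl⟩ := hz
      exact mem_iUnion.2 ⟨n, hxz⟩
    dist_center_le := fun k x hx => (Metric.mem_ball.1 (disjointed_subset b k hx)).le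
    nbr := t
    mem_nbr := ht
    bound := D
    card_nbr_le := htD }⟩

end Cells

/-! ### Slowly varying partitions of unity -/

section Partition

variable {X : Type*} [MetricSpace X] [MeasurableSpace X]

/-- A partition of unity that is constant on the cells of `C`. The function with index `j` takes
the value `weight j k` on the cell with index `k`; its values on cells with centres at
distance at most `W` differ by at most `t` in `ℓ¹`, and its support lies in a ball of radius
`radius`, whose centre is `center j`. -/
structure SlowPartition (C : CellDecomposition X) (W t : ℝ) where
  weight : ℕ → ℕ → ℝ≥0
  tsum_weight : ∀ k, ∑' j, (weight j k : ℝ≥0∞) = 1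
  variation_le : ∀ k l, dist (C.center k) (C.center l) ≤ W →
    ∑' j, ‖(weight j k : ℝ) - weight j l‖ₑ ≤ ENNReal.ofReal t
  center : ℕ → X
  radius : ℝ
  cell_subset : ∀ j k, weight j k ≠ 0 → C.cell k ⊆ Metric.closedBall (center j) radius
  finite_meets : ∀ x s, {j | ∃ k, weight j k ≠ 0 ∧
    (C.cell k ∩ Metric.closedBall x s).Nonempty}.Finite

/-- Property A′ provides slowly varying partitions of unity which are constant on cells: sample the
given functions at the centres of the cells. -/
lemma nonempty_slowPartition [Nonempty X] (hA' : PropertyAPrime X) (C : CellDecomposition X)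
    (W : ℝ) {t : ℝ} (ht : 0 < t) : Nonempty (SlowPartition C W t) := by
  set t' := min t (1 / max W 1) with ht'
  have hW : 0 < max W 1 := lt_max_of_lt_right one_pos
  have ht'0 : 0 < t' := lt_min ht (by positivity)
  have hWt : W ≤ 1 / t' := by
    rw [le_div_iff₀ ht'0]
    calc W * t' ≤ max W 1 * (1 / max W 1) := by
          gcongr
          · exact le_max_left _ _
          · exact min_le_right _ _
      _ = 1 := by field_simp
  obtain ⟨ϱ, -, -, hmem, hsum, hdiam, hvar, hfin⟩ := hA' t' ht'0
  set d := ⨆ j, Metric.ediam (tsupport (ϱ j)) with hd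
  have hsupp : ∀ j x, ϱ j x ≠ 0 → x ∈ tsupport (ϱ j) := fun j x hx =>
    subset_tsupport _ (Function.mem_support.2 hx)
  have hcent : ∀ j, ∃ y, ∀ k, ϱ j (C.center k) ≠ 0 →
      C.cell k ⊆ Metric.closedBall y (d.toReal + C.radius) := by
    intro j
    by_cases hj : ∃ k, ϱ j (C.center k) ≠ 0
    · obtain ⟨k₀, hk₀⟩ := hj
      refine ⟨C.center k₀, fun k hk x hx => ?_⟩
      have h₁ : edist (C.center k) (C.center k₀) ≤ d :=
        (Metric.edist_le_ediam_of_mem (hsupp j _ hk) (hsupp j _ hk₀)).trans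
          (le_iSup (fun j => Metric.ediam (tsupport (ϱ j))) j)
      have h₂ : dist (C.center k) (C.center k₀) ≤ d.toReal := by
        rw [dist_edist]
        exact ENNReal.toReal_mono hdiam.ne h₁
      have h₃ := C.dist_center_le k x hx
      rw [Metric.mem_closedBall]
      linarith [dist_triangle x (C.center k) (C.center k₀)]
    · push Not at hj
      exact ⟨Classical.arbitrary X, fun k hk => absurd (hj k) hk⟩
  choose y hy using hcent
  have hne : ∀ j x, (ϱ j x).toNNReal ≠ 0 → ϱ j x ≠ 0 := by
    intro j x h h0
    exact h (by rw [h0, Real.toNNReal_zero])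
  exact ⟨{
    weight := fun j k => (ϱ j (C.center k)).toNNReal
    tsum_weight := fun k => by
      have h := hsum (C.center k)
      have h' := ENNReal.ofReal_tsum_of_nonneg (fun j => (hmem j (C.center k)).1) h.summable
      rw [h.tsum_eq, ENNReal.ofReal_one] at h'
      exact h'.symm
    variation_le := fun k l hkl => by
      have h := hvar (C.center k) (C.center l) (hkl.trans hWt)
      have hs : Summable fun j => |ϱ j (C.center k) - ϱ j (C.center l)| := by
        refine Summable.of_nonneg_of_le (fun j => abs_nonneg _) (fun j => ?_)
          ((hsum (C.center k)).summable.add (hsum (C.center l)).summable)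
        have h₁ := (hmem j (C.center k)).1
        have h₂ := (hmem j (C.center l)).1
        exact abs_sub_le_iff.2 ⟨by linarith, by linarith⟩
      have h' := ENNReal.ofReal_tsum_of_nonneg (fun j => abs_nonneg _) hs
      calc ∑' j, ‖((ϱ j (C.center k)).toNNReal : ℝ) - (ϱ j (C.center l)).toNNReal‖ₑ
          = ∑' j, ENNReal.ofReal |ϱ j (C.center k) - ϱ j (C.center l)| := by
            refine tsum_congr fun j => ?_
            rw [Real.coe_toNNReal _ (hmem j _).1, Real.coe_toNNReal _ (hmem j _).1,
              Real.enorm_eq_ofReal_abs]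
        _ = ENNReal.ofReal (∑' j, |ϱ j (C.center k) - ϱ j (C.center l)|) := h'.symm
        _ ≤ ENNReal.ofReal t := ENNReal.ofReal_le_ofReal (h.le.trans (min_le_left _ _))
    center := y
    radius := d.toReal + C.radius
    cell_subset := fun j k hk => hy j k (hne j _ hk)
    finite_meets := fun x s => by
      refine (hfin x (|s| + |C.radius| + 1) (by positivity)).subset ?_
      rintro j ⟨k, hk, a, ha, has⟩
      refine ⟨C.center k, hsupp j _ (hne j _ hk), ?_⟩
      have h₁ := C.dist_center_le k a ha
      have h₂ := Metric.mem_closedBall.1 has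
      rw [Metric.mem_ball]
      linarith [dist_triangle_left (C.center k) x a, le_abs_self s, le_abs_self C.radius] }⟩

end Partition

/-! ### Norms and operators relative to the cells -/

namespace CellDecomposition

variable {X : Type*} [MetricSpace X] [MeasurableSpace X] (C : CellDecomposition X)

lemma exists_mem_cell (x : X) : ∃ k, x ∈ C.cell k :=
  mem_iUnion.1 (C.iUnion_cell ▸ mem_univ x)

/-- The index of the cell that contains a point. -/
def index (x : X) : ℕ := (C.exists_mem_cell x).choose

lemma mem_cell_index (x : X) : x ∈ C.cell (C.index x) := (C.exists_mem_cell x).choose_spec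

lemma index_eq {x : X} {k : ℕ} (hx : x ∈ C.cell k) : C.index x = k := by
  by_contra h
  exact disjoint_left.1 (C.disjoint_cell h) (C.mem_cell_index x) hx

lemma measurable_index : Measurable C.index := by
  refine measurable_to_countable' fun k => ?_
  have : C.index ⁻¹' {k} = C.cell k := by
    ext x
    exact ⟨fun h => h ▸ C.mem_cell_index x, fun h => C.index_eq h⟩
  rw [this]
  exact C.measurableSet_cell k

lemma isMultiplier_step {c : ℕ → ℝ≥0} (hc : ∀ k, c k ≤ 1) :
    IsMultiplier fun x => ((c (C.index x) : ℝ) : ℂ) := by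
  refine ⟨Complex.measurable_ofReal.comp (measurable_of_countable (fun k => (c k : ℝ)) |>.comp
    C.measurable_index), fun x => ?_⟩
  rw [Complex.norm_real, Real.norm_of_nonneg (c _).coe_nonneg]
  exact_mod_cast hc _

variable {μ : Measure X} {p : ℝ≥0} [Fact (1 ≤ (p : ℝ≥0∞))]

/-- Restriction of `L_p` functions to a cell. -/
def cellCut (k : ℕ) : Lp ℂ p μ →L[ℂ] Lp ℂ p μ := cutoff (C.measurableSet_cell k)

/-- Multiplication by a function that is constant on the cells. -/
def stepOp {c : ℕ → ℝ≥0} (hc : ∀ k, c k ≤ 1) : Lp ℂ p μ →L[ℂ] Lp ℂ p μ :=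
  mulOp (C.isMultiplier_step hc)

lemma cellCut_stepOp {c : ℕ → ℝ≥0} (hc : ∀ k, c k ≤ 1) (k : ℕ) (f : Lp ℂ p μ) :
    C.cellCut k (C.stepOp hc f) = ((c k : ℝ) : ℂ) • C.cellCut k f := by
  refine Lp.ext ?_
  filter_upwards [cutoff_ae (C.measurableSet_cell k) (C.stepOp hc f),
    cutoff_ae (C.measurableSet_cell k) f, mulOp_ae (C.isMultiplier_step hc) f,
    Lp.coeFn_smul ((c k : ℝ) : ℂ) (C.cellCut k f)] with x h₁ h₂ h₃ h₄
  rw [h₄, Pi.smul_apply, cellCut, h₁, h₂]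
  by_cases hx : x ∈ C.cell k
  · rw [indicator_of_mem hx, indicator_of_mem hx, stepOp, h₃, C.index_eq hx, smul_eq_mul]
  · rw [indicator_of_notMem hx, indicator_of_notMem hx, smul_zero]

/-- The `p`-th power of the norm is the sum of its parts in the cells. -/
lemma enorm_rpow_eq_tsum (f : Lp ℂ p μ) :
    ‖f‖ₑ ^ (p : ℝ) = ∑' k, ‖C.cellCut k f‖ₑ ^ (p : ℝ) := by
  have hp : (0 : ℝ) < p := exponent_pos
  have h : ∀ k, ‖C.cellCut k f‖ₑ ^ (p : ℝ) = ∫⁻ x in C.cell k, ‖f x‖ₑ ^ (p : ℝ) ∂μ := by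
    intro k
    rw [enorm_rpow_eq_lintegral, ← lintegral_indicator (C.measurableSet_cell k)]
    refine lintegral_congr_ae ?_
    filter_upwards [cutoff_ae (C.measurableSet_cell k) f] with x hx
    rw [cellCut, hx]
    by_cases hxk : x ∈ C.cell k
    · rw [indicator_of_mem hxk, indicator_of_mem hxk]
    · rw [indicator_of_notMem hxk, indicator_of_notMem hxk, enorm_zero,
        ENNReal.zero_rpow_of_pos hp]
  simp_rw [h]
  rw [← lintegral_iUnion C.measurableSet_cell C.disjoint_cell, C.iUnion_cell,
    Measure.restrict_univ, enorm_rpow_eq_lintegral]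

lemma eq_of_forall_cellCut {f g : Lp ℂ p μ} (h : ∀ k, C.cellCut k f = C.cellCut k g) : f = g := by
  have hp : (0 : ℝ) < p := exponent_pos
  have h₁ := C.enorm_rpow_eq_tsum (f - g)
  simp_rw [map_sub, h, sub_self, enorm_zero, ENNReal.zero_rpow_of_pos hp, tsum_zero] at h₁
  rw [ENNReal.rpow_eq_zero_iff_of_pos hp, enorm_eq_zero, sub_eq_zero] at h₁
  exact h₁

lemma suppIn_sub_sum_cellCut (t : Finset ℕ) (f : Lp ℂ p μ) :
    SuppIn (f - ∑ l ∈ t, C.cellCut l f) (⋃ l ∈ t, C.cell l)ᶜ := by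
  induction t using Finset.induction_on with
  | empty => exact Eventually.of_forall fun x hx => by simp at hx
  | insert a t ha ih =>
    set g := f - ∑ l ∈ t, C.cellCut l f with hg
    have h₁ : C.cellCut a g = C.cellCut a f := by
      rw [hg, map_sub, map_sum, Finset.sum_eq_zero, sub_zero]
      intro l hl
      refine (suppIn_cutoff (C.measurableSet_cell l) f).cutoff_eq_zero _
        (C.disjoint_cell fun h => ha (h ▸ hl))
    have h₂ : f - ∑ l ∈ insert a t, C.cellCut l f = g - C.cellCut a g := by
      rw [Finset.sum_insert ha, h₁, hg]
      abel
    rw [h₂]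
    have h₃ : SuppIn (g - C.cellCut a g) (C.cell a)ᶜ := suppIn_sub_cutoff _ g
    have h₄ : SuppIn (g - C.cellCut a g) (⋃ l ∈ t, C.cell l)ᶜ := by
      have := ih.add ((ih.cutoff (C.measurableSet_cell a)).smul (-1))
      rwa [neg_one_smul, ← sub_eq_add_neg] at this
    refine (h₃.inter h₄).mono fun x hx => ?_
    simp only [Finset.mem_insert, iUnion_iUnion_eq_or_left, compl_union]
    exact hx

/-- An operator of finite propagation maps functions in a cell to neighbouring cells. -/
lemma exists_cellCut_apply_eq_sum {T : Lp ℂ p μ →L[ℂ] Lp ℂ p μ} (hT : propagation T < ∞) :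
    ∃ W : ℝ, ∀ k f, C.cellCut k (T f) = ∑ l ∈ C.nbr W k, C.cellCut k (T (C.cellCut l f)) := by
  obtain ⟨w, hw, h⟩ := exists_cutoff_comp_eq_zero hT
  refine ⟨w + 2 * C.radius, fun k f => ?_⟩
  set t := C.nbr (w + 2 * C.radius) k with ht
  have hU : MeasurableSet (⋃ l ∈ t, C.cell l) :=
    t.measurableSet_biUnion fun l _ => C.measurableSet_cell l
  have hsupp := C.suppIn_sub_sum_cellCut t f
  have h0 : C.cellCut k (T (f - ∑ l ∈ t, C.cellCut l f)) = 0 := by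
    have h1 := h _ _ hU.compl (C.measurableSet_cell k) (fun a ha b hb => ?_)
    · have h2 := congrArg (fun D => D (f - ∑ l ∈ t, C.cellCut l f)) h1
      simp only [ContinuousLinearMap.comp_apply, hsupp.cutoff_eq hU.compl] at h2
      exact h2
    · by_contra hlt
      refine ha (mem_iUnion₂.2 ⟨C.index a, ?_, C.mem_cell_index a⟩)
      rw [ht, C.mem_nbr]
      refine ⟨⟨b, hb⟩, ⟨a, C.mem_cell_index a⟩, ?_⟩
      have h2 := C.dist_center_le k b hb
      have h3 := C.dist_center_le _ a (C.mem_cell_index a)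
      have h4 := dist_triangle4 (C.center k) b a (C.center (C.index a))
      rw [dist_comm b a, dist_comm (C.center k) b] at h4
      linarith [not_le.1 hlt]
  rw [map_sub, map_sub, sub_eq_zero, map_sum, map_sum] at h0
  exact h0

/-- The commutator of an operator of finite propagation with a function that is constant on the
cells, seen in one cell. -/
lemma cellCut_commutator {T : Lp ℂ p μ →L[ℂ] Lp ℂ p μ} {W : ℝ}
    (hW : ∀ k f, C.cellCut k (T f) = ∑ l ∈ C.nbr W k, C.cellCut k (T (C.cellCut l f)))
    {c : ℕ → ℝ≥0} (hc : ∀ k, c k ≤ 1) (k : ℕ) (f : Lp ℂ p μ) :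
    C.cellCut k (T (C.stepOp hc f) - C.stepOp hc (T f)) =
      ∑ l ∈ C.nbr W k, (((c l : ℝ) - c k : ℝ) : ℂ) • C.cellCut k (T (C.cellCut l f)) := by
  rw [map_sub, C.cellCut_stepOp, hW k (C.stepOp hc f), hW k f, Finset.smul_sum,
    ← Finset.sum_sub_distrib]
  refine Finset.sum_congr rfl fun l _ => ?_
  rw [C.cellCut_stepOp, map_smul, map_smul, Complex.ofReal_sub, sub_smul]

lemma enorm_cellCut_commutator_le {T : Lp ℂ p μ →L[ℂ] Lp ℂ p μ} {W : ℝ}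
    (hW : ∀ k f, C.cellCut k (T f) = ∑ l ∈ C.nbr W k, C.cellCut k (T (C.cellCut l f)))
    {c : ℕ → ℝ≥0} (hc : ∀ k, c k ≤ 1) (k : ℕ) (f : Lp ℂ p μ) :
    ‖C.cellCut k (T (C.stepOp hc f) - C.stepOp hc (T f))‖ₑ ≤
      ∑ l ∈ C.nbr W k, ‖T‖ₑ * (‖(c l : ℝ) - c k‖ₑ * ‖C.cellCut l f‖ₑ) := by
  rw [C.cellCut_commutator hW]
  refine (enorm_sum_le _ _).trans (Finset.sum_le_sum fun l _ => ?_)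
  rw [enorm_smul, mul_left_comm]
  have h₁ : ‖(((c l : ℝ) - c k : ℝ) : ℂ)‖ₑ = ‖(c l : ℝ) - c k‖ₑ := by
    rw [← ofReal_norm, Complex.norm_real, ofReal_norm]
  have h₂ : ‖C.cellCut k (T (C.cellCut l f))‖ₑ ≤ ‖T‖ₑ * ‖C.cellCut l f‖ₑ := by
    rw [← ofReal_norm, ← ofReal_norm, ← ofReal_norm, ← ENNReal.ofReal_mul (norm_nonneg _)]
    exact ENNReal.ofReal_le_ofReal ((norm_cutoff_apply_le _ _).trans (T.le_opNorm _))
  rw [h₁]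
  gcongr

/-- Summation over neighbours loses at most the bound for the number of neighbours. -/
lemma tsum_sum_nbr_le (W : ℝ) (a : ℕ → ℝ≥0∞) :
    ∑' k, ∑ l ∈ C.nbr W k, a l ≤ C.bound W * ∑' l, a l := by
  have h₁ : ∀ k, ∑ l ∈ C.nbr W k, a l = ∑' l, if l ∈ C.nbr W k then a l else 0 := by
    intro k
    rw [tsum_eq_sum (s := C.nbr W k) fun l hl => if_neg hl]
    exact Finset.sum_congr rfl fun l hl => (if_pos hl).symm
  simp_rw [h₁]
  rw [ENNReal.tsum_comm, ← ENNReal.tsum_mul_left]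
  refine ENNReal.tsum_le_tsum fun l => ?_
  have hsymm : ∀ k, l ∈ C.nbr W k ↔ k ∈ C.nbr W l := by
    intro k
    rw [C.mem_nbr, C.mem_nbr, dist_comm]
    tauto
  simp_rw [hsymm]
  rw [tsum_eq_sum (s := C.nbr W l) fun k hk => if_neg hk,
    Finset.sum_congr rfl fun k hk => if_pos hk, Finset.sum_const, nsmul_eq_mul]
  gcongr
  exact C.card_nbr_le W l

end CellDecomposition

lemma sum_rpow_le_card_mul {ι : Type*} (s : Finset ι) (x : ι → ℝ≥0∞) {e : ℝ} (he : 0 < e) :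
    (∑ l ∈ s, x l) ^ e ≤ (s.card : ℝ≥0∞) ^ e * ∑ l ∈ s, x l ^ e := by
  have h : ∑ l ∈ s, x l ≤ s.card * (∑ l ∈ s, x l ^ e) ^ e⁻¹ := by
    rw [← nsmul_eq_mul]
    refine Finset.sum_le_card_nsmul _ _ _ fun l hl => ?_
    rw [← ENNReal.rpow_rpow_inv he.ne' (x l)]
    gcongr
    exact Finset.single_le_sum (f := fun l => x l ^ e) (fun _ _ => zero_le) hl
  calc (∑ l ∈ s, x l) ^ e ≤ (s.card * (∑ l ∈ s, x l ^ e) ^ e⁻¹) ^ e := by gcongr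
    _ = _ := by rw [ENNReal.mul_rpow_of_nonneg _ _ he.le, ENNReal.rpow_inv_rpow he.ne']

lemma enorm_rpow_inv_sub_rpow_inv_le (a b : ℝ≥0) {e : ℝ} (he : 1 ≤ e) :
    ‖((a ^ e⁻¹ : ℝ≥0) : ℝ) - (b ^ e⁻¹ : ℝ≥0)‖ₑ ^ e ≤ ‖(a : ℝ) - b‖ₑ := by
  have he0 : 0 < e := one_pos.trans_le he
  wlog hab : b ≤ a generalizing a b
  · have := this b a (le_of_not_ge hab)
    rwa [← enorm_neg, neg_sub, ← enorm_neg ((a : ℝ) - b), neg_sub]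
  have h₁ : ‖(a : ℝ) - b‖ₑ = ((a - b : ℝ≥0) : ℝ≥0∞) := by
    rw [← NNReal.coe_sub hab]
    simp
  have hab' : b ^ e⁻¹ ≤ a ^ e⁻¹ := NNReal.rpow_le_rpow hab (by positivity)
  have h₂ : ‖((a ^ e⁻¹ : ℝ≥0) : ℝ) - (b ^ e⁻¹ : ℝ≥0)‖ₑ = ((a ^ e⁻¹ - b ^ e⁻¹ : ℝ≥0) : ℝ≥0∞) := by
    rw [← NNReal.coe_sub hab']
    simp
  have h₃ : a ^ e⁻¹ - b ^ e⁻¹ ≤ (a - b) ^ e⁻¹ := by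
    rw [tsub_le_iff_left]
    calc a ^ e⁻¹ = (b + (a - b)) ^ e⁻¹ := by rw [add_tsub_cancel_of_le hab]
      _ ≤ _ := NNReal.rpow_add_le_add_rpow _ _ (by positivity) (inv_le_one_of_one_le₀ he)
  rw [h₁, h₂, ← ENNReal.coe_rpow_of_nonneg _ he0.le, ENNReal.coe_le_coe]
  calc (a ^ e⁻¹ - b ^ e⁻¹) ^ e ≤ ((a - b) ^ e⁻¹) ^ e := by gcongr
    _ = a - b := NNReal.rpow_inv_rpow he0.ne' _

/-! ### Commutators with slowly varying partitions of unity -/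

namespace SlowPartition

variable {X : Type*} [MetricSpace X] [MeasurableSpace X] {C : CellDecomposition X} {W t : ℝ}
  (ϱ : SlowPartition C W t) {μ : Measure X} {p : ℝ≥0} [Fact (1 ≤ (p : ℝ≥0∞))]

lemma weight_rpow_le_one {e : ℝ} (he : 1 ≤ e) (j k : ℕ) : ϱ.weight j k ^ e⁻¹ ≤ 1 := by
  refine NNReal.rpow_le_one ?_ (by positivity)
  have h : (ϱ.weight j k : ℝ≥0∞) ≤ 1 := by
    rw [← ϱ.tsum_weight k]
    exact ENNReal.le_tsum j
  exact_mod_cast h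

/-- Multiplication by the `1 / e`-th power of a function of the partition of unity. -/
def op {e : ℝ} (he : 1 ≤ e) (j : ℕ) : Lp ℂ p μ →L[ℂ] Lp ℂ p μ :=
  C.stepOp fun k => ϱ.weight_rpow_le_one he j k

lemma suppIn_op {e : ℝ} (he : 1 ≤ e) (j : ℕ) (f : Lp ℂ p μ) :
    SuppIn (ϱ.op he j f) (Metric.closedBall (ϱ.center j) ϱ.radius) := by
  refine suppIn_mulOp (C.isMultiplier_step fun k => ϱ.weight_rpow_le_one he j k) f fun x hx => ?_
  have h0 : ϱ.weight j (C.index x) = 0 := by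
    by_contra h
    exact hx (ϱ.cell_subset j _ h (C.mem_cell_index x))
  rw [h0, NNReal.zero_rpow (by positivity)]
  simp

lemma suppIn_op_of_suppIn {e : ℝ} (he : 1 ≤ e) (j : ℕ) {f : Lp ℂ p μ} {K : Set X}
    (hf : SuppIn f K) : SuppIn (ϱ.op he j f) K :=
  hf.mulOp (C.isMultiplier_step fun k => ϱ.weight_rpow_le_one he j k)

lemma enorm_cellCut_op_rpow {e : ℝ} (he : 1 ≤ e) (j k : ℕ) (f : Lp ℂ p μ) :
    ‖C.cellCut k (ϱ.op he j f)‖ₑ = (ϱ.weight j k : ℝ≥0∞) ^ e⁻¹ * ‖C.cellCut k f‖ₑ := by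
  rw [op, C.cellCut_stepOp, enorm_smul]
  congr 1
  rw [← ENNReal.coe_rpow_of_nonneg _ (by positivity), ← ofReal_norm, Complex.norm_real,
    ofReal_norm, Real.enorm_of_nonneg (NNReal.coe_nonneg _), ENNReal.ofReal_coe_nnreal]

/-- The partition of unity splits the `p`-th power of the norm. -/
lemma tsum_enorm_op_rpow (f : Lp ℂ p μ) :
    ∑' j, ‖ϱ.op (one_le_exponent (p := p)) j f‖ₑ ^ (p : ℝ) = ‖f‖ₑ ^ (p : ℝ) := by
  have hp : (0 : ℝ) < p := exponent_pos
  rw [C.enorm_rpow_eq_tsum f, tsum_congr fun j =>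
    C.enorm_rpow_eq_tsum (ϱ.op (one_le_exponent (p := p)) j f)]
  simp_rw [enorm_cellCut_op_rpow, ENNReal.mul_rpow_of_nonneg _ _ hp.le,
    ENNReal.rpow_inv_rpow hp.ne']
  rw [ENNReal.tsum_comm]
  refine tsum_congr fun k => ?_
  rw [ENNReal.tsum_mul_right, ϱ.tsum_weight, one_mul]

variable {q : ℝ} (hpq : (p : ℝ).HolderConjugate q)
include hpq

/-- By Hölder's inequality, gluing with the `1 / q`-th powers of the partition of unity does not
increase norms, in the sense of `ℓ_p`. -/
lemma enorm_sum_op_rpow_le (J : Finset ℕ) (g : ℕ → Lp ℂ p μ) :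
    ‖∑ j ∈ J, ϱ.op hpq.symm.lt.le j (g j)‖ₑ ^ (p : ℝ) ≤ ∑ j ∈ J, ‖g j‖ₑ ^ (p : ℝ) := by
  have hp : (0 : ℝ) < p := exponent_pos
  have hq : 0 < q := hpq.symm.pos
  have hcell : ∀ k, ‖C.cellCut k (∑ j ∈ J, ϱ.op hpq.symm.lt.le j (g j))‖ₑ ^ (p : ℝ) ≤
      ∑ j ∈ J, ‖C.cellCut k (g j)‖ₑ ^ (p : ℝ) := by
    intro k
    rw [map_sum]
    have h₁ : ‖∑ j ∈ J, C.cellCut k (ϱ.op hpq.symm.lt.le j (g j))‖ₑ ≤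
        (∑ j ∈ J, ‖C.cellCut k (g j)‖ₑ ^ (p : ℝ)) ^ (1 / (p : ℝ)) := by
      refine (enorm_sum_le _ _).trans ?_
      simp_rw [enorm_cellCut_op_rpow]
      refine (ENNReal.inner_le_Lp_mul_Lq J _ _ hpq.symm).trans ?_
      simp_rw [ENNReal.rpow_inv_rpow hq.ne']
      refine mul_le_of_le_one_left zero_le (ENNReal.rpow_le_one ?_ (by positivity))
      rw [← ϱ.tsum_weight k]
      exact ENNReal.sum_le_tsum J
    calc _ ≤ ((∑ j ∈ J, ‖C.cellCut k (g j)‖ₑ ^ (p : ℝ)) ^ (1 / (p : ℝ))) ^ (p : ℝ) := by gcongr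
      _ = _ := by rw [one_div, ENNReal.rpow_inv_rpow hp.ne']
  rw [C.enorm_rpow_eq_tsum]
  refine (ENNReal.tsum_le_tsum hcell).trans_eq ?_
  rw [Summable.tsum_finsetSum fun _ _ => ENNReal.summable]
  exact Finset.sum_congr rfl fun j _ => (C.enorm_rpow_eq_tsum _).symm

/-- The two families of multiplication operators form a resolution of the identity, which is
finite on functions of bounded support. -/
lemma exists_sum_op_op_eq {f : Lp ℂ p μ} {x : X} {s : ℝ} (hf : SuppIn f (Metric.closedBall x s)) :
    ∃ J : Finset ℕ, ∑ j ∈ J, ϱ.op hpq.symm.lt.le j (ϱ.op (one_le_exponent (p := p)) j f) = f := by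
  refine ⟨(ϱ.finite_meets x s).toFinset, C.eq_of_forall_cellCut fun k => ?_⟩
  set J := (ϱ.finite_meets x s).toFinset with hJ
  by_cases hk : (C.cell k ∩ Metric.closedBall x s).Nonempty
  · have hsum : ∑ j ∈ J, ϱ.weight j k = 1 := by
      have h := ϱ.tsum_weight k
      rw [tsum_eq_sum (s := J) fun j hj => ?_] at h
      · exact_mod_cast h
      · by_contra hne
        refine hj ((ϱ.finite_meets x s).mem_toFinset.2 ⟨k, ?_, hk⟩)
        exact_mod_cast hne
    have hterm : ∀ j, C.cellCut k (ϱ.op hpq.symm.lt.le j (ϱ.op (one_le_exponent (p := p)) j f)) =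
        ((ϱ.weight j k : ℝ) : ℂ) • C.cellCut k f := by
      intro j
      rw [op, C.cellCut_stepOp, op, C.cellCut_stepOp, smul_smul, ← Complex.ofReal_mul,
        ← NNReal.coe_mul]
      congr 3
      by_cases h0 : ϱ.weight j k = 0
      · rw [h0, NNReal.zero_rpow (inv_ne_zero hpq.symm.ne_zero), zero_mul]
      · rw [← NNReal.rpow_add h0, hpq.symm.inv_add_inv_eq_one, NNReal.rpow_one]
    rw [map_sum, Finset.sum_congr rfl fun j _ => hterm j, ← Finset.sum_smul]
    rw [← Complex.ofReal_sum, ← NNReal.coe_sum, hsum]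
    simp
  · have hdisj : Disjoint (C.cell k) (Metric.closedBall x s) :=
      disjoint_iff_inter_eq_empty.2 (not_nonempty_iff_eq_empty.1 hk)
    rw [map_sum, Finset.sum_eq_zero]
    · exact (hf.cutoff_eq_zero _ hdisj).symm
    · intro j _
      exact (ϱ.suppIn_op_of_suppIn _ j (ϱ.suppIn_op_of_suppIn _ j hf)).cutoff_eq_zero _ hdisj

omit hpq

variable {T : Lp ℂ p μ →L[ℂ] Lp ℂ p μ}
  (hW : ∀ k f, C.cellCut k (T f) = ∑ l ∈ C.nbr W k, C.cellCut k (T (C.cellCut l f)))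
include hW

lemma enorm_cellCut_commutator_rpow_le (j k : ℕ) (f : Lp ℂ p μ) :
    ‖C.cellCut k (T (ϱ.op (one_le_exponent (p := p)) j f) -
        ϱ.op (one_le_exponent (p := p)) j (T f))‖ₑ ^ (p : ℝ) ≤
      (C.bound W : ℝ≥0∞) ^ (p : ℝ) * ∑ l ∈ C.nbr W k, ‖T‖ₑ ^ (p : ℝ) *
        (‖(ϱ.weight j l : ℝ) - ϱ.weight j k‖ₑ * ‖C.cellCut l f‖ₑ ^ (p : ℝ)) := by
  have hp : (0 : ℝ) < p := exponent_pos
  refine (ENNReal.rpow_le_rpow (C.enorm_cellCut_commutator_le hW _ k f) hp.le).trans ?_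
  refine (sum_rpow_le_card_mul _ _ hp).trans ?_
  gcongr with l hl
  · exact C.card_nbr_le W k
  · rw [ENNReal.mul_rpow_of_nonneg _ _ hp.le, ENNReal.mul_rpow_of_nonneg _ _ hp.le]
    gcongr
    exact enorm_rpow_inv_sub_rpow_inv_le _ _ one_le_exponent

/-- Commutators with the `1 / p`-th powers of the partition of unity are small in the sense of
`ℓ_p`, for operators of finite propagation. -/
lemma tsum_enorm_commutator_rpow_le (f : Lp ℂ p μ) :
    ∑' j, ‖T (ϱ.op (one_le_exponent (p := p)) j f) -
        ϱ.op (one_le_exponent (p := p)) j (T f)‖ₑ ^ (p : ℝ) ≤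
      (C.bound W : ℝ≥0∞) ^ (p : ℝ) * ‖T‖ₑ ^ (p : ℝ) * C.bound W * ENNReal.ofReal t *
        ‖f‖ₑ ^ (p : ℝ) := by
  rw [C.enorm_rpow_eq_tsum f, tsum_congr fun j => C.enorm_rpow_eq_tsum
    (T (ϱ.op (one_le_exponent (p := p)) j f) - ϱ.op (one_le_exponent (p := p)) j (T f))]
  rw [ENNReal.tsum_comm]
  set D := ((C.bound W : ℕ) : ℝ≥0∞) with hD
  set a : ℕ → ℝ≥0∞ := fun l => D ^ (p : ℝ) * (‖T‖ₑ ^ (p : ℝ) *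
    (ENNReal.ofReal t * ‖C.cellCut l f‖ₑ ^ (p : ℝ))) with ha
  have hk : ∀ k, ∑' j, ‖C.cellCut k (T (ϱ.op (one_le_exponent (p := p)) j f) -
      ϱ.op (one_le_exponent (p := p)) j (T f))‖ₑ ^ (p : ℝ) ≤ ∑ l ∈ C.nbr W k, a l := by
    intro k
    refine (ENNReal.tsum_le_tsum fun j =>
      ϱ.enorm_cellCut_commutator_rpow_le hW j k f).trans ?_
    rw [ENNReal.tsum_mul_left, Summable.tsum_finsetSum fun _ _ => ENNReal.summable,
      Finset.mul_sum]
    refine Finset.sum_le_sum fun l hl => ?_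
    rw [ENNReal.tsum_mul_left, ENNReal.tsum_mul_right, ha]
    beta_reduce
    gcongr
    refine ϱ.variation_le l k ?_
    rw [dist_comm]
    exact ((C.mem_nbr W k l).1 hl).2.2
  refine (ENNReal.tsum_le_tsum hk).trans ((C.tsum_sum_nbr_le W a).trans_eq ?_)
  rw [ha]
  simp_rw [ENNReal.tsum_mul_left]
  ring

include hpq in
/-- Commutators with the `1 / q`-th powers of the partition of unity are small in a sense dual to
that of `tsum_enorm_commutator_rpow_le`, for operators of finite propagation. -/
lemma enorm_sum_commutator_rpow_le (J : Finset ℕ) (g : ℕ → Lp ℂ p μ) :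
    ‖∑ j ∈ J, (T (ϱ.op hpq.symm.lt.le j (g j)) - ϱ.op hpq.symm.lt.le j (T (g j)))‖ₑ ^ (p : ℝ) ≤
      (C.bound W : ℝ≥0∞) ^ (p : ℝ) * ‖T‖ₑ ^ (p : ℝ) * C.bound W *
        ENNReal.ofReal t ^ ((p : ℝ) / q) * ∑ j ∈ J, ‖g j‖ₑ ^ (p : ℝ) := by
  have hp : (0 : ℝ) < p := exponent_pos
  have hq : 0 < q := hpq.symm.pos
  set D := ((C.bound W : ℕ) : ℝ≥0∞) with hD
  set a : ℕ → ℝ≥0∞ := fun l => D ^ (p : ℝ) * (‖T‖ₑ ^ (p : ℝ) *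
    (ENNReal.ofReal t ^ ((p : ℝ) / q) * ∑ j ∈ J, ‖C.cellCut l (g j)‖ₑ ^ (p : ℝ))) with ha
  have hk : ∀ k, ‖C.cellCut k (∑ j ∈ J, (T (ϱ.op hpq.symm.lt.le j (g j)) -
      ϱ.op hpq.symm.lt.le j (T (g j))))‖ₑ ^ (p : ℝ) ≤ ∑ l ∈ C.nbr W k, a l := by
    intro k
    have h₁ : ‖C.cellCut k (∑ j ∈ J, (T (ϱ.op hpq.symm.lt.le j (g j)) -
        ϱ.op hpq.symm.lt.le j (T (g j))))‖ₑ ≤ ∑ l ∈ C.nbr W k, ‖T‖ₑ *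
          (ENNReal.ofReal t ^ (1 / q) *
            (∑ j ∈ J, ‖C.cellCut l (g j)‖ₑ ^ (p : ℝ)) ^ (1 / (p : ℝ))) := by
      rw [map_sum]
      refine (enorm_sum_le _ _).trans ?_
      refine (Finset.sum_le_sum fun j _ => C.enorm_cellCut_commutator_le hW _ k (g j)).trans ?_
      rw [Finset.sum_comm]
      refine Finset.sum_le_sum fun l hl => ?_
      rw [← Finset.mul_sum]
      gcongr
      refine (ENNReal.inner_le_Lp_mul_Lq J _ _ hpq.symm).trans ?_
      gcongr
      calc _ ≤ ∑ j ∈ J, ‖(ϱ.weight j l : ℝ) - ϱ.weight j k‖ₑ :=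
            Finset.sum_le_sum fun j _ => enorm_rpow_inv_sub_rpow_inv_le _ _ hpq.symm.lt.le
        _ ≤ _ := ENNReal.sum_le_tsum J
        _ ≤ _ := ϱ.variation_le l k (by rw [dist_comm]; exact ((C.mem_nbr W k l).1 hl).2.2)
    refine (ENNReal.rpow_le_rpow h₁ hp.le).trans ?_
    refine (sum_rpow_le_card_mul _ _ hp).trans ?_
    rw [Finset.mul_sum]
    refine Finset.sum_le_sum fun l _ => ?_
    rw [ENNReal.mul_rpow_of_nonneg _ _ hp.le, ENNReal.mul_rpow_of_nonneg _ _ hp.le,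
      ← ENNReal.rpow_mul, ← ENNReal.rpow_mul, one_div_mul_cancel hp.ne', ENNReal.rpow_one,
      one_div_mul_eq_div]
    rw [ha]
    beta_reduce
    gcongr
    exact Nat.cast_le.2 (C.card_nbr_le W k)
  rw [C.enorm_rpow_eq_tsum]
  refine (ENNReal.tsum_le_tsum hk).trans ((C.tsum_sum_nbr_le W a).trans_eq ?_)
  rw [ha]
  simp_rw [ENNReal.tsum_mul_left]
  rw [Summable.tsum_finsetSum fun _ _ => ENNReal.summable]
  simp_rw [← C.enorm_rpow_eq_tsum]
  ring

end SlowPartition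

/-! ### Localisation of band-dominated operators -/

lemma add_add_rpow_le (x y z : ℝ≥0∞) {e : ℝ} (he : 0 < e) :
    (x + y + z) ^ e ≤ 3 ^ e * (x ^ e + y ^ e + z ^ e) := by
  have h := sum_rpow_le_card_mul (Finset.univ : Finset (Fin 3)) ![x, y, z] he
  simpa [Fin.sum_univ_three] using h

lemma tsum_add_rpow_le (a b : ℕ → ℝ≥0∞) {e : ℝ} (he : 1 ≤ e) :
    (∑' j, (a j + b j) ^ e) ^ (1 / e) ≤
      (∑' j, a j ^ e) ^ (1 / e) + (∑' j, b j ^ e) ^ (1 / e) := by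
  have h := ENNReal.lintegral_Lp_add_le (μ := Measure.count)
    (measurable_of_countable a).aemeasurable
    (measurable_of_countable b).aemeasurable he
  simpa [lintegral_count] using h

lemma exists_pos_mul_rpow_le {c : ℝ≥0∞} (hc : c ≠ ∞) {e : ℝ} (he : 0 < e) {b : ℝ≥0∞} (hb : b ≠ 0) :
    ∀ᶠ t in 𝓝[>] (0 : ℝ), c * ENNReal.ofReal t ^ e ≤ b := by
  have h₁ : Tendsto (fun t : ℝ => ENNReal.ofReal t ^ e) (𝓝[>] 0) (𝓝 0) := by
    have h := ((ENNReal.continuous_rpow_const (y := e)).comp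
      ENNReal.continuous_ofReal).tendsto (0 : ℝ)
    simp only [Function.comp_apply, ENNReal.ofReal_zero, ENNReal.zero_rpow_of_pos he] at h
    exact h.mono_left nhdsWithin_le_nhds
  have h₂ := ENNReal.Tendsto.const_mul h₁ (Or.inr hc)
  rw [mul_zero] at h₂
  exact h₂.eventually_le_const (pos_iff_ne_zero.2 hb)

section Localisation

variable {X : Type*} [MetricSpace X] [MeasurableSpace X] [BorelSpace X] {μ : Measure X} {p : ℝ≥0}
  [Fact (1 ≤ (p : ℝ≥0∞))]

lemma enorm_apply_rpow_le {D : Lp ℂ p μ →L[ℂ] Lp ℂ p μ} {η : ℝ≥0} (hD : ‖D‖ ≤ η) (f : Lp ℂ p μ) :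
    ‖D f‖ₑ ^ (p : ℝ) ≤ (η : ℝ≥0∞) ^ (p : ℝ) * ‖f‖ₑ ^ (p : ℝ) := by
  rw [← ENNReal.mul_rpow_of_nonneg _ _ p.coe_nonneg]
  gcongr
  rw [enorm_eq_nnnorm, enorm_eq_nnnorm, ← ENNReal.coe_mul, ENNReal.coe_le_coe]
  exact D.le_of_opNorm_le hD f

/-- For every band-dominated operator there are partitions of unity with small commutators. The
operator is approximated by one of finite propagation, and the partition is chosen to vary slowly
enough for that operator. -/
lemma exists_slowPartition [Nonempty X] (hgeom : BoundedGeometry X) (hA' : PropertyAPrime X)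
    {q : ℝ} (hpq : (p : ℝ).HolderConjugate q) {G : Lp ℂ p μ →L[ℂ] Lp ℂ p μ} (hG : G ∈ BDO μ p)
    {δ : ℝ≥0} (hδ : 0 < δ) :
    ∃ (C : CellDecomposition X) (W t : ℝ) (ϱ : SlowPartition C W t),
      (∀ f, ∑' j, ‖G (ϱ.op (one_le_exponent (p := p)) j f) -
          ϱ.op (one_le_exponent (p := p)) j (G f)‖ₑ ^ (p : ℝ) ≤
        (δ : ℝ≥0∞) ^ (p : ℝ) * ‖f‖ₑ ^ (p : ℝ)) ∧
      ∀ (J : Finset ℕ) (g : ℕ → Lp ℂ p μ),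
        ‖∑ j ∈ J, (G (ϱ.op hpq.symm.lt.le j (g j)) - ϱ.op hpq.symm.lt.le j (G (g j)))‖ₑ ^ (p : ℝ) ≤
          (δ : ℝ≥0∞) ^ (p : ℝ) * ∑ j ∈ J, ‖g j‖ₑ ^ (p : ℝ) := by
  have hp : (0 : ℝ) < p := exponent_pos
  have hq : 0 < q := hpq.symm.pos
  obtain ⟨C⟩ := nonempty_cellDecomposition hgeom
  set η : ℝ≥0 := δ / 9 with hη
  have hη0 : 0 < η := by positivity
  obtain ⟨T, hT, hGT⟩ := Metric.mem_closure_iff.1 hG η hη0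
  rw [dist_eq_norm] at hGT
  obtain ⟨W, hW⟩ := C.exists_cellCut_apply_eq_sum (T := T) hT
  set κ : ℝ≥0∞ := (C.bound W : ℝ≥0∞) ^ (p : ℝ) * ‖T‖ₑ ^ (p : ℝ) * (C.bound W : ℝ≥0∞) with hκ
  have hκtop : κ ≠ ∞ := ENNReal.mul_ne_top (ENNReal.mul_ne_top
    (ENNReal.rpow_ne_top_of_nonneg hp.le (ENNReal.natCast_ne_top _))
    (ENNReal.rpow_ne_top_of_nonneg hp.le enorm_ne_top)) (ENNReal.natCast_ne_top _)
  have hηp : (η : ℝ≥0∞) ^ (p : ℝ) ≠ 0 :=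
    (ENNReal.rpow_pos (by exact_mod_cast hη0) ENNReal.coe_ne_top).ne'
  obtain ⟨t, ⟨ht₁, ht₂⟩, ht⟩ := (((exists_pos_mul_rpow_le hκtop one_pos hηp).and
    (exists_pos_mul_rpow_le hκtop (div_pos hp hq) hηp)).and self_mem_nhdsWithin).exists
  rw [ENNReal.rpow_one] at ht₁
  obtain ⟨ϱ⟩ := nonempty_slowPartition hA' C W ht
  have hsmall : (3 : ℝ≥0∞) ^ (p : ℝ) * (3 * (η : ℝ≥0∞) ^ (p : ℝ)) ≤ (δ : ℝ≥0∞) ^ (p : ℝ) := by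
    have h₃ : (3 : ℝ≥0∞) ≤ 3 ^ (p : ℝ) := by
      calc (3 : ℝ≥0∞) = 3 ^ (1 : ℝ) := (ENNReal.rpow_one _).symm
        _ ≤ 3 ^ (p : ℝ) := ENNReal.rpow_le_rpow_of_exponent_le (by norm_num) one_le_exponent
    calc _ ≤ (3 : ℝ≥0∞) ^ (p : ℝ) * (3 ^ (p : ℝ) * (η : ℝ≥0∞) ^ (p : ℝ)) := by gcongr
      _ = (δ : ℝ≥0∞) ^ (p : ℝ) := by
        rw [← ENNReal.mul_rpow_of_nonneg _ _ hp.le, ← ENNReal.mul_rpow_of_nonneg _ _ hp.le]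
        congr 1
        have : (3 : ℝ≥0) * (3 * η) = δ := by
          rw [hη]
          field_simp
          norm_num
        exact_mod_cast this
  have hcomb : ∀ {x y z s : ℝ≥0∞}, x ≤ (η : ℝ≥0∞) ^ (p : ℝ) * s → y ≤ (η : ℝ≥0∞) ^ (p : ℝ) * s →
      z ≤ (η : ℝ≥0∞) ^ (p : ℝ) * s →
      (3 : ℝ≥0∞) ^ (p : ℝ) * (x + y + z) ≤ (δ : ℝ≥0∞) ^ (p : ℝ) * s := by
    intro x y z s hx hy hz
    calc _ ≤ (3 : ℝ≥0∞) ^ (p : ℝ) * ((η : ℝ≥0∞) ^ (p : ℝ) * s + (η : ℝ≥0∞) ^ (p : ℝ) * s +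
          (η : ℝ≥0∞) ^ (p : ℝ) * s) := by gcongr
      _ = (3 : ℝ≥0∞) ^ (p : ℝ) * (3 * (η : ℝ≥0∞) ^ (p : ℝ)) * s := by ring
      _ ≤ _ := by gcongr
  set D := G - T with hD
  have hGD : ∀ f, G f = T f + D f := fun f => by simp [hD]
  have hDη : ‖D‖ ≤ η := hGT.le
  refine ⟨C, W, t, ϱ, fun f => ?_, fun J g => ?_⟩
  · have hj : ∀ j, ‖G (ϱ.op (one_le_exponent (p := p)) j f) -
        ϱ.op (one_le_exponent (p := p)) j (G f)‖ₑ ^ (p : ℝ) ≤ 3 ^ (p : ℝ) *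
        (‖T (ϱ.op (one_le_exponent (p := p)) j f) -
          ϱ.op (one_le_exponent (p := p)) j (T f)‖ₑ ^ (p : ℝ) +
        ‖D (ϱ.op (one_le_exponent (p := p)) j f)‖ₑ ^ (p : ℝ) +
        ‖ϱ.op (one_le_exponent (p := p)) j (D f)‖ₑ ^ (p : ℝ)) := by
      intro j
      refine le_trans (ENNReal.rpow_le_rpow ?_ hp.le) (add_add_rpow_le _ _ _ hp)
      rw [hGD, hGD, map_add]
      refine le_trans (le_of_eq (congrArg _ ?_))
        (enorm_sub_le.trans (by gcongr; exact enorm_add_le _ _))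
      abel
    refine (ENNReal.tsum_le_tsum hj).trans ?_
    rw [ENNReal.tsum_mul_left, ENNReal.tsum_add, ENNReal.tsum_add]
    refine hcomb ?_ ?_ ?_
    · refine (ϱ.tsum_enorm_commutator_rpow_le hW f).trans ?_
      gcongr
    · refine (ENNReal.tsum_le_tsum fun j => enorm_apply_rpow_le hDη _).trans_eq ?_
      rw [ENNReal.tsum_mul_left, ϱ.tsum_enorm_op_rpow]
    · rw [ϱ.tsum_enorm_op_rpow]
      exact enorm_apply_rpow_le hDη f
  · refine le_trans (ENNReal.rpow_le_rpow (y := ‖∑ j ∈ J, (T (ϱ.op hpq.symm.lt.le j (g j)) -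
      ϱ.op hpq.symm.lt.le j (T (g j)))‖ₑ + ‖D (∑ j ∈ J, ϱ.op hpq.symm.lt.le j (g j))‖ₑ +
      ‖∑ j ∈ J, ϱ.op hpq.symm.lt.le j (D (g j))‖ₑ) ?_ hp.le) ((add_add_rpow_le _ _ _ hp).trans
        (hcomb ?_ ?_ ?_))
    · refine le_trans (le_of_eq (congrArg _ ?_))
        (enorm_sub_le.trans (by gcongr; exact enorm_add_le _ _))
      rw [map_sum, ← Finset.sum_add_distrib, ← Finset.sum_sub_distrib]
      refine Finset.sum_congr rfl fun j _ => ?_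
      rw [hGD, hGD, map_add]
      abel
    · refine (ϱ.enorm_sum_commutator_rpow_le hpq hW J g).trans ?_
      gcongr
    · refine (enorm_apply_rpow_le hDη _).trans ?_
      gcongr
      exact ϱ.enorm_sum_op_rpow_le hpq J g
    · refine (ϱ.enorm_sum_op_rpow_le hpq J _).trans ?_
      rw [Finset.mul_sum]
      exact Finset.sum_le_sum fun j _ => enorm_apply_rpow_le hDη _

/-- Almost minimisers of `‖G f‖ / ‖f‖` can be chosen with support in balls of a fixed radius. -/
lemma exists_localisation [Nonempty X] (hgeom : BoundedGeometry X) (hA' : PropertyAPrime X)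
    (hp1 : 1 < p) {G : Lp ℂ p μ →L[ℂ] Lp ℂ p μ} (hG : G ∈ BDO μ p) {δ : ℝ} (hδ : 0 < δ) :
    ∃ r : ℝ, ∀ f, f ≠ 0 → ∀ c : ℝ, ‖G f‖ ≤ c * ‖f‖ → ∃ y h, h ≠ 0 ∧
      SuppIn h (Metric.closedBall y r) ∧ (∀ K, SuppIn f K → SuppIn h K) ∧
      ‖G h‖ ≤ (c + δ) * ‖h‖ := by
  have hp : (0 : ℝ) < p := exponent_pos
  have hpq : (p : ℝ).HolderConjugate (Real.conjExponent p) :=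
    Real.HolderConjugate.conjExponent (by exact_mod_cast hp1)
  set η : ℝ≥0 := ⟨δ / 2, by positivity⟩ with hη
  obtain ⟨C, W, t, ϱ, hϱ, -⟩ := exists_slowPartition hgeom hA' hpq hG (δ := η)
    (by rw [← NNReal.coe_pos]; exact half_pos hδ)
  refine ⟨ϱ.radius, fun f hf c hc => ?_⟩
  have hf0 : 0 < ‖f‖ := norm_pos_iff.2 hf
  have hc0 : 0 ≤ c := nonneg_of_mul_nonneg_left ((norm_nonneg _).trans hc) hf0
  by_contra! hcon
  have hj : ∀ j, ENNReal.ofReal (c + δ) * ‖ϱ.op (one_le_exponent (p := p)) j f‖ₑ ≤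
      ‖ϱ.op (one_le_exponent (p := p)) j (G f)‖ₑ + ‖G (ϱ.op (one_le_exponent (p := p)) j f) -
        ϱ.op (one_le_exponent (p := p)) j (G f)‖ₑ := by
    intro j
    refine le_trans ?_ ((enorm_add_le _ _).trans' (le_of_eq (congrArg _
      (add_sub_cancel _ (G (ϱ.op (one_le_exponent (p := p)) j f))).symm)))
    by_cases h0 : ϱ.op (one_le_exponent (p := p)) j f = 0
    · simp [h0]
    · have h := hcon (ϱ.center j) _ h0 (ϱ.suppIn_op _ j f)
        fun K hK => ϱ.suppIn_op_of_suppIn _ j hK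
      rw [← ofReal_norm, ← ofReal_norm, ← ENNReal.ofReal_mul (by positivity)]
      exact ENNReal.ofReal_le_ofReal h.le
  have h₁ : ENNReal.ofReal (c + δ) * ‖f‖ₑ ≤ ‖G f‖ₑ + η * ‖f‖ₑ := by
    calc ENNReal.ofReal (c + δ) * ‖f‖ₑ
        = (∑' j, (ENNReal.ofReal (c + δ) *
            ‖ϱ.op (one_le_exponent (p := p)) j f‖ₑ) ^ (p : ℝ)) ^ (1 / (p : ℝ)) := by
          simp_rw [ENNReal.mul_rpow_of_nonneg _ _ hp.le]
          rw [ENNReal.tsum_mul_left, ϱ.tsum_enorm_op_rpow, ← ENNReal.mul_rpow_of_nonneg _ _ hp.le,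
            one_div, ENNReal.rpow_rpow_inv hp.ne']
      _ ≤ (∑' j, (‖ϱ.op (one_le_exponent (p := p)) j (G f)‖ₑ +
            ‖G (ϱ.op (one_le_exponent (p := p)) j f) -
              ϱ.op (one_le_exponent (p := p)) j (G f)‖ₑ) ^ (p : ℝ)) ^ (1 / (p : ℝ)) :=
          ENNReal.rpow_le_rpow (ENNReal.tsum_le_tsum fun j =>
            ENNReal.rpow_le_rpow (hj j) hp.le) (by positivity)
      _ ≤ _ := tsum_add_rpow_le _ _ one_le_exponent
      _ ≤ (‖G f‖ₑ ^ (p : ℝ)) ^ (1 / (p : ℝ)) +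
            ((η : ℝ≥0∞) ^ (p : ℝ) * ‖f‖ₑ ^ (p : ℝ)) ^ (1 / (p : ℝ)) := by
          gcongr
          · exact (ϱ.tsum_enorm_op_rpow _).le
          · exact hϱ f
      _ = ‖G f‖ₑ + η * ‖f‖ₑ := by
          rw [← ENNReal.mul_rpow_of_nonneg _ _ hp.le, one_div, ENNReal.rpow_rpow_inv hp.ne',
            ENNReal.rpow_rpow_inv hp.ne']
  have h₂ : (c + δ) * ‖f‖ ≤ ‖G f‖ + δ / 2 * ‖f‖ := by
    rw [← ENNReal.ofReal_le_ofReal_iff (by positivity),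
      ENNReal.ofReal_mul (show 0 ≤ c + δ by positivity),
      ENNReal.ofReal_add (norm_nonneg _) (by positivity),
      ENNReal.ofReal_mul (show 0 ≤ δ / 2 by positivity), ofReal_norm, ofReal_norm]
    rwa [← ENNReal.ofReal_coe_nnreal (p := η)] at h₁
  nlinarith

/-- Iterated localisation, from large scales to small ones: a function which `G` almost
annihilates has modifications of controlled size around one common centre, of increasing quality. -/
lemma exists_localisation_chain [Nonempty X] (hgeom : BoundedGeometry X) (hA' : PropertyAPrime X)
    (hp1 : 1 < p) {G : Lp ℂ p μ →L[ℂ] Lp ℂ p μ} (hG : G ∈ BDO μ p) :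
    ∃ R : ℕ → ℝ, ∀ (n : ℕ) (K : Set X) (f : Lp ℂ p μ) (c : ℝ), f ≠ 0 → SuppIn f K →
      ‖G f‖ ≤ c * ‖f‖ → ∃ y, (K ∩ Metric.closedBall y (R 0)).Nonempty ∧ ∀ k ≤ n,
        ∃ g : Lp ℂ p μ, g ≠ 0 ∧ SuppIn g (Metric.closedBall y (R k)) ∧
          ‖G g‖ ≤ (c + 2 * (1 / 2) ^ k) * ‖g‖ := by
  have hloc := fun k : ℕ => exists_localisation hgeom hA' hp1 hG (δ := (1 / 2) ^ k) (by positivity)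
  choose r hr using hloc
  have hne : ∀ (h : Lp ℂ p μ) (K : Set X), h ≠ 0 → SuppIn h K → K.Nonempty := by
    intro h K h0 hK
    by_contra hemp
    rw [not_nonempty_iff_eq_empty] at hemp
    exact h0 (hemp ▸ hK).eq_zero
  set R : ℕ → ℝ := fun k => |r 0| + 2 * |r k| with hR
  have hr0R : ∀ k, |r 0| ≤ R k := fun k => by
    have := abs_nonneg (r k)
    simp only [hR]
    linarith
  -- the extra term on the left leaves room for the losses at the larger scales
  have key : ∀ (n : ℕ) (K : Set X) (f : Lp ℂ p μ) (c : ℝ), f ≠ 0 → SuppIn f K →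
      ‖G f‖ ≤ c * ‖f‖ → ∃ (y : X) (h : Lp ℂ p μ), h ≠ 0 ∧ SuppIn h (K ∩ Metric.closedBall y (r 0)) ∧
        ∀ k ≤ n, ∃ g : Lp ℂ p μ, g ≠ 0 ∧ SuppIn g (Metric.closedBall y (R k)) ∧
          ‖G g‖ + (1 / 2) ^ n * ‖g‖ ≤ (c + 2 * (1 / 2) ^ k) * ‖g‖ := by
    intro n
    induction n with
    | zero =>
      intro K f c hf hK hc
      obtain ⟨y, h, h0, hy, hK', hh⟩ := hr 0 f hf c hc
      refine ⟨y, h, h0, (hK' K hK).inter hy, fun k hk => ⟨h, h0, ?_, ?_⟩⟩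
      · exact hy.mono (Metric.closedBall_subset_closedBall ((le_abs_self _).trans (hr0R k)))
      · obtain rfl : k = 0 := by omega
        simp only [pow_zero] at hh ⊢
        linarith
    | succ n ih =>
      intro K f c hf hK hc
      obtain ⟨y₁, h₁, h₁0, hy₁, hK₁, hh₁⟩ := hr (n + 1) f hf c hc
      obtain ⟨y, h, h0, hsupp, hg⟩ := ih (K ∩ Metric.closedBall y₁ (r (n + 1))) h₁ _ h₁0
        ((hK₁ K hK).inter hy₁) hh₁
      refine ⟨y, h, h0, hsupp.mono fun x hx => ⟨hx.1.1, hx.2⟩, fun k hk => ?_⟩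
      rcases Nat.le_succ_iff.1 hk with hk | rfl
      · obtain ⟨g, hg0, hgs, hgn⟩ := hg k hk
        refine ⟨g, hg0, hgs, ?_⟩
        rw [pow_succ] at hgn ⊢
        linarith
      · obtain ⟨x, hx⟩ := hne h _ h0 hsupp
        refine ⟨h₁, h₁0, hy₁.mono fun z hz => ?_, by rw [Nat.succ_eq_add_one]; linarith⟩
        have hz₁ := Metric.mem_closedBall.1 hz
        have hx₁ := Metric.mem_closedBall.1 hx.1.2
        have hx₂ := Metric.mem_closedBall.1 hx.2
        rw [Metric.mem_closedBall]
        have := dist_triangle4 z y₁ x y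
        rw [dist_comm y₁ x] at this
        simp only [hR, Nat.succ_eq_add_one]
        linarith [le_abs_self (r 0), le_abs_self (r (n + 1))]
  refine ⟨R, fun n K f c hf hK hc => ?_⟩
  obtain ⟨y, h, h0, hsupp, hg⟩ := key n K f c hf hK hc
  obtain ⟨x, hx⟩ := hne h _ h0 hsupp
  refine ⟨y, ⟨x, hx.1, Metric.closedBall_subset_closedBall
    ((le_abs_self _).trans (hr0R 0)) hx.2⟩, fun k hk => ?_⟩
  obtain ⟨g, hg0, hgs, hgn⟩ := hg k hk
  exact ⟨g, hg0, hgs, by linarith [show 0 ≤ (1 / 2 : ℝ) ^ n * ‖g‖ by positivity]⟩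

end Localisation

/-! ### Estimates away from a ball from limit operators -/

lemma exists_bounded_below_of_bijective {E : Type*} [NormedAddCommGroup E] [NormedSpace ℂ E]
    [CompleteSpace E] {G : E →L[ℂ] E} (hG : Function.Bijective G) :
    ∃ c : ℝ, 0 < c ∧ ∀ f, c * ‖f‖ ≤ ‖G f‖ := by
  set e := ContinuousLinearEquiv.ofBijective G (LinearMap.ker_eq_bot.2 hG.1)
    (LinearMap.range_eq_top.2 hG.2) with he
  refine ⟨(‖(e.symm : E →L[ℂ] E)‖ + 1)⁻¹, by positivity, fun f => ?_⟩
  rw [inv_mul_le_iff₀ (by positivity)]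
  have h : (e.symm : E →L[ℂ] E) (G f) = f := e.symm_apply_apply f
  calc ‖f‖ = ‖(e.symm : E →L[ℂ] E) (G f)‖ := by rw [h]
    _ ≤ ‖(e.symm : E →L[ℂ] E)‖ * ‖G f‖ := ContinuousLinearMap.le_opNorm _ _
    _ ≤ _ := by
      gcongr
      linarith

namespace ShiftSystem

variable {X : Type*} [MetricSpace X] [MeasurableSpace X] [ProperSpace X] [BorelSpace X]
  {μ : Measure X} [μ.Regular] {p : ℝ≥0} [Fact (1 ≤ (p : ℝ≥0∞))] {S : ShiftSystem μ p}
  {Q G : Lp ℂ p μ →L[ℂ] Lp ℂ p μ}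

/-- If all limits of `G` at the boundary are invertible, then `G` is bounded below off some ball.
Otherwise iterated localisation gives, at some boundary point, unit vectors for which the limit of
`G` is arbitrarily small. -/
lemma exists_bounded_below_off_ball (hgeom : BoundedGeometry X) (hA' : PropertyAPrime X)
    (hp1 : 1 < p) (hQ : S.IsLocallyCompactProjection Q) (hG : G ∈ BDO μ p)
    (hG₁ : ∀ f, G (f - Q f) = f - Q f) (hG₂ : ∀ f, G f - Q (G f) = f - Q f)
    (hlim : ∀ x ∈ boundary X, ∃ G', S.IsStrongLimit G x G' ∧ Function.Bijective G') :
    ∃ c : ℝ, 0 < c ∧ ∃ n : ℕ, ∀ f, SuppIn f (Metric.closedBall S.base n)ᶜ → c * ‖f‖ ≤ ‖G f‖ := by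
  have : Nonempty X := ⟨S.base⟩
  by_contra! hcon
  obtain ⟨R, hR⟩ := exists_localisation_chain hgeom hA' hp1 hG
  have hex : ∀ n : ℕ, ∃ y : X,
      ((Metric.closedBall S.base n)ᶜ ∩ Metric.closedBall y (R 0)).Nonempty ∧
      ∀ k : ℕ, ∃ u : Lp ℂ p μ, SuppIn u (Metric.closedBall y (R k)) ∧ ‖u‖ ≤ 1 ∧
        (k ≤ n → ‖u‖ = 1 ∧ ‖G u‖ ≤ 1 / ((n : ℝ) + 1) + 2 * (1 / 2) ^ k) := by
    intro n
    obtain ⟨f, hf, hGf⟩ := hcon (1 / ((n : ℝ) + 1)) (by positivity) n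
    have hf0 : f ≠ 0 := by
      rintro rfl
      simp at hGf
    obtain ⟨y, hy, h⟩ := hR n _ f _ hf0 hf hGf.le
    refine ⟨y, hy, fun k => ?_⟩
    by_cases hk : k ≤ n
    · obtain ⟨g, hg0, hg, hGg⟩ := h k hk
      have hg0' : 0 < ‖g‖ := norm_pos_iff.2 hg0
      have hnorm : ‖((‖g‖⁻¹ : ℝ) : ℂ)‖ = ‖g‖⁻¹ := by
        rw [Complex.norm_real, Real.norm_of_nonneg (by positivity)]
      have h1 : ‖((‖g‖⁻¹ : ℝ) : ℂ) • g‖ = 1 := by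
        rw [norm_smul, hnorm, inv_mul_cancel₀ hg0'.ne']
      refine ⟨((‖g‖⁻¹ : ℝ) : ℂ) • g, hg.smul _, h1.le, fun _ => ⟨h1, ?_⟩⟩
      rw [map_smul, norm_smul, hnorm, inv_mul_le_iff₀ hg0', mul_comm]
      exact hGg
    · refine ⟨0, ?_, by simp, fun h => absurd h hk⟩
      filter_upwards [Lp.coeFn_zero ℂ (p : ℝ≥0∞) μ] with x hx _
      rw [hx, Pi.zero_apply]
  choose y hy u hu hu1 hGu using hex
  set l : Ultrafilter ℕ := hyperfilter ℕ with hl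
  have hl' : (l : Filter ℕ) ≤ atTop := Nat.hyperfilter_le_atTop
  have hinf : ∀ r : ℝ, ∀ᶠ n in (l : Filter ℕ), r < dist (y n) S.base := by
    intro r
    filter_upwards [hl' (tendsto_natCast_atTop_atTop.eventually_gt_atTop (r + R 0))] with n hn
    obtain ⟨z, hz, hz'⟩ := hy n
    rw [mem_compl_iff, Metric.mem_closedBall, not_le] at hz
    rw [Metric.mem_closedBall] at hz'
    have hn' : r + R 0 < n := hn
    linarith [dist_triangle z (y n) S.base]
  obtain ⟨x, hx, hyx⟩ := exists_mem_boundary_tendsto l S.base hinf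
  obtain ⟨G', hG', hbij⟩ := hlim x hx
  obtain ⟨c, hc, hcG⟩ := exists_bounded_below_of_bijective hbij
  have hk : ∀ k : ℕ, c * (1 - (1 + ‖Q‖) * (2 * (1 / 2) ^ k)) ≤
      (2 + ‖Q‖) * (2 * (1 / 2) ^ k) := by
    intro k
    obtain ⟨z, hz⟩ := hQ.exists_tendsto l hyx (g := fun n => S.U (y n) (u n k)) (C := 1)
      (fun n => by simpa using hu1 n k) (r := R k) fun n => S.suppIn_U_closedBall _ (hu n k)
    have hz' : Tendsto (fun n => S.U (y n) (Q (u n k))) l (𝓝 z) := by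
      simpa [conj_apply] using hz
    have hGz : Tendsto (fun n => S.U (y n) (G (Q (u n k)))) l (𝓝 (G' z)) := by
      simpa [conj_apply] using hG'.apply_tendsto hyx hz'
    have hε : Tendsto (fun n : ℕ => 1 / ((n : ℝ) + 1) + 2 * (1 / 2) ^ k) l
        (𝓝 (2 * (1 / 2) ^ k)) := by
      simpa using (tendsto_one_div_add_atTop_nhds_zero_nat.mono_left hl').add_const
        (2 * (1 / 2 : ℝ) ^ k)
    have hkl : ∀ᶠ n in (l : Filter ℕ), k ≤ n := hl' (eventually_ge_atTop k)
    have hcomp : ∀ n, k ≤ n → ‖u n k - Q (u n k)‖ ≤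
        (1 + ‖Q‖) * (1 / ((n : ℝ) + 1) + 2 * (1 / 2) ^ k) := by
      intro n hn
      rw [← hG₂]
      calc ‖G (u n k) - Q (G (u n k))‖ ≤ ‖G (u n k)‖ + ‖Q (G (u n k))‖ := norm_sub_le _ _
        _ ≤ ‖G (u n k)‖ + ‖Q‖ * ‖G (u n k)‖ := by
          gcongr
          exact Q.le_opNorm _
        _ = (1 + ‖Q‖) * ‖G (u n k)‖ := by ring
        _ ≤ _ := by
          gcongr
          exact (hGu n k hn).2
    have h₁ : 1 - (1 + ‖Q‖) * (2 * (1 / 2) ^ k) ≤ ‖z‖ := by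
      refine le_of_tendsto_of_tendsto (tendsto_const_nhds.sub (hε.const_mul _)) hz'.norm ?_
      filter_upwards [hkl] with n hn
      have h1 := hcomp n hn
      have h2 := norm_le_norm_add_norm_sub' (u n k) (Q (u n k))
      rw [(hGu n k hn).1] at h2
      rw [LinearIsometryEquiv.norm_map]
      linarith
    have h₂ : ‖G' z‖ ≤ (2 + ‖Q‖) * (2 * (1 / 2) ^ k) := by
      refine le_of_tendsto_of_tendsto hGz.norm (hε.const_mul _) ?_
      filter_upwards [hkl] with n hn
      have h1 := hcomp n hn
      have h2 : G (Q (u n k)) = G (u n k) - (u n k - Q (u n k)) := by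
        rw [← hG₁ (u n k), map_sub]
        abel
      rw [LinearIsometryEquiv.norm_map, h2]
      refine (norm_sub_le _ _).trans ?_
      linarith [(hGu n k hn).2]
    exact (mul_le_mul_of_nonneg_left h₁ hc.le).trans ((hcG z).trans h₂)
  have hpow : Tendsto (fun k : ℕ => 2 * (1 / 2 : ℝ) ^ k) atTop (𝓝 0) := by
    simpa using (tendsto_pow_atTop_nhds_zero_of_lt_one (by norm_num : (0 : ℝ) ≤ 1 / 2)
      (by norm_num)).const_mul 2
  have hfin := le_of_tendsto_of_tendsto' ((tendsto_const_nhds.sub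
    (hpow.const_mul (1 + ‖Q‖))).const_mul c) (hpow.const_mul (2 + ‖Q‖)) hk
  rw [mul_zero, mul_zero, sub_zero, mul_one] at hfin
  exact absurd hfin (not_le.2 hc)

/-- A lower bound for `G` off a ball is inherited by the limits of `G` at the boundary. -/
lemma IsStrongLimit.le_norm_of_off_ball {G' : Lp ℂ p μ →L[ℂ] Lp ℂ p μ} {x : StoneCech X}
    (hx : x ∈ boundary X) (hG' : S.IsStrongLimit G x G') {c : ℝ} {n : ℕ}
    (hc : ∀ f, SuppIn f (Metric.closedBall S.base n)ᶜ → c * ‖f‖ ≤ ‖G f‖) (f : Lp ℂ p μ) :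
    c * ‖f‖ ≤ ‖G' f‖ := by
  have := neBot_comap_stoneCechUnit x
  have h : ∀ m : ℕ, c * ‖ballCut S.base m f‖ ≤ ‖G' (ballCut S.base m f)‖ := by
    intro m
    refine ge_of_tendsto (hG' (ballCut S.base m f)).norm ?_
    filter_upwards [eventually_lt_dist_of_mem_boundary hx S.base (n + m)] with y hy
    rw [conj_apply, LinearIsometryEquiv.norm_map]
    have h1 := S.suppIn_U_symm_closedBall y (suppIn_ballCut S.base m f)
    refine (le_of_eq (by rw [LinearIsometryEquiv.norm_map])).trans (hc _ (h1.mono fun z hz => ?_))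
    rw [mem_compl_iff, Metric.mem_closedBall, not_le]
    have := Metric.mem_closedBall.1 hz
    rw [dist_comm] at this
    linarith [dist_triangle y z S.base]
  have ht := tendsto_ballCut S.base f
  exact le_of_tendsto_of_tendsto' (ht.norm.const_mul c) ((G'.continuous.tendsto f).comp ht).norm h

/-- If all limits of `G` at the boundary are invertible, then `G g = f` has approximate solutions
for all `f` with support in a ball of fixed radius far away, with uniformly bounded norms. -/
lemma exists_local_solution (hQ : S.IsLocallyCompactProjection Q)
    (hG₁ : ∀ f, G (f - Q f) = f - Q f) {c : ℝ} (hc : 0 < c)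
    (hlim : ∀ x ∈ boundary X, ∃ G', S.IsStrongLimit G x G' ∧ Function.Surjective G' ∧
      ∀ f, c * ‖f‖ ≤ ‖G' f‖) (r : ℝ) {ε : ℝ} (hε : 0 < ε) :
    ∃ N : ℕ, ∀ y, N < dist y S.base → ∀ f, SuppIn f (Metric.closedBall y r) →
      ∃ g, ‖g‖ ≤ (‖Q‖ / c + 1 + ‖Q‖) * ‖f‖ ∧ ‖G g - f‖ ≤ ε * ‖f‖ := by
  by_contra! hcon
  have hex : ∀ n : ℕ, ∃ y : X, n < dist y S.base ∧ ∃ f : Lp ℂ p μ,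
      SuppIn f (Metric.closedBall y r) ∧ ‖f‖ = 1 ∧
      ∀ g, ‖g‖ ≤ ‖Q‖ / c + 1 + ‖Q‖ → ε < ‖G g - f‖ := by
    intro n
    obtain ⟨y, hy, f, hf, hg⟩ := hcon n
    have hf0 : f ≠ 0 := by
      rintro rfl
      have := hg 0 (by simp)
      simp at this
    have hf0' : 0 < ‖f‖ := norm_pos_iff.2 hf0
    have hnorm : ‖((‖f‖⁻¹ : ℝ) : ℂ)‖ = ‖f‖⁻¹ := by
      rw [Complex.norm_real, Real.norm_of_nonneg (by positivity)]
    refine ⟨y, hy, ((‖f‖⁻¹ : ℝ) : ℂ) • f, hf.smul _, ?_, fun g hgC => ?_⟩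
    · rw [norm_smul, hnorm, inv_mul_cancel₀ hf0'.ne']
    · have hnorm' : ‖((‖f‖ : ℝ) : ℂ)‖ = ‖f‖ := by
        rw [Complex.norm_real, norm_norm]
      have h := hg (((‖f‖ : ℝ) : ℂ) • g) (by
        rw [norm_smul, hnorm', mul_comm]
        gcongr)
      have h' : G (((‖f‖ : ℝ) : ℂ) • g) - f =
          ((‖f‖ : ℝ) : ℂ) • (G g - ((‖f‖⁻¹ : ℝ) : ℂ) • f) := by
        rw [smul_sub, map_smul, smul_smul, ← Complex.ofReal_mul, mul_inv_cancel₀ hf0'.ne',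
          Complex.ofReal_one, one_smul]
      rw [h', norm_smul, hnorm', mul_comm] at h
      exact lt_of_mul_lt_mul_left h hf0'.le
  choose y hy f hf hf1 hg using hex
  set l : Ultrafilter ℕ := hyperfilter ℕ with hl
  have hl' : (l : Filter ℕ) ≤ atTop := Nat.hyperfilter_le_atTop
  have hinf : ∀ r : ℝ, ∀ᶠ n in (l : Filter ℕ), r < dist (y n) S.base := by
    intro r
    filter_upwards [hl' (tendsto_natCast_atTop_atTop.eventually_gt_atTop r)] with n hn
    exact lt_trans hn (hy n)
  obtain ⟨x, hx, hyx⟩ := exists_mem_boundary_tendsto l S.base hinf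
  obtain ⟨G', hG', hsurj, hcG⟩ := hlim x hx
  obtain ⟨z, hz⟩ := hQ.exists_tendsto l hyx (g := fun n => S.U (y n) (f n)) (C := 1)
    (fun n => by simp [hf1]) (r := r) fun n => S.suppIn_U_closedBall _ (hf n)
  have hz' : Tendsto (fun n => S.U (y n) (Q (f n))) l (𝓝 z) := by
    simpa [conj_apply] using hz
  obtain ⟨w, hw⟩ := hsurj z
  have hQf : ∀ n, ‖Q (f n)‖ ≤ ‖Q‖ := fun n => by
    simpa [hf1] using Q.le_opNorm (f n)
  have hzQ : ‖z‖ ≤ ‖Q‖ := le_of_tendsto' hz'.norm fun n => by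
    rw [LinearIsometryEquiv.norm_map]
    exact hQf n
  have hwn : ‖w‖ ≤ ‖Q‖ / c := by
    rw [le_div_iff₀ hc, mul_comm]
    exact (hcG w).trans (hw ▸ hzQ)
  set g : ℕ → Lp ℂ p μ := fun n => (S.U (y n)).symm w + (f n - Q (f n)) with hg_def
  have hgn : ∀ n, ‖g n‖ ≤ ‖Q‖ / c + 1 + ‖Q‖ := by
    intro n
    refine (norm_add_le _ _).trans ?_
    rw [LinearIsometryEquiv.norm_map]
    linarith [norm_sub_le (f n) (Q (f n)), hQf n, hf1 n]
  have hlim0 : Tendsto (fun n => ‖G (g n) - f n‖) l (𝓝 0) := by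
    have h1 : Tendsto (fun n => S.conj G (y n) w - S.U (y n) (Q (f n))) l (𝓝 (G' w - z)) :=
      ((hG' w).comp hyx).sub hz'
    rw [hw, sub_self, tendsto_zero_iff_norm_tendsto_zero] at h1
    refine h1.congr fun n => ?_
    rw [conj_apply, ← map_sub, LinearIsometryEquiv.norm_map, hg_def]
    simp only [map_add, hG₁]
    congr 1
    abel
  obtain ⟨n, hn⟩ := (hlim0.eventually_lt_const hε).exists
  exact absurd (hg n (g n) (hgn n)) (not_lt.2 hn.le)

/-- Local approximate solutions are glued along a partition of unity, for which the commutators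
with `G` are small. -/
lemma exists_solution_off_ball (hgeom : BoundedGeometry X) (hA' : PropertyAPrime X)
    (hp1 : 1 < p) (z : X) (hG : G ∈ BDO μ p) {C : ℝ} (hC : 0 < C)
    (hloc : ∀ r ε : ℝ, 0 < ε → ∃ N : ℕ, ∀ y, N < dist y z → ∀ f : Lp ℂ p μ,
      SuppIn f (Metric.closedBall y r) → ∃ g, ‖g‖ ≤ C * ‖f‖ ∧ ‖G g - f‖ ≤ ε * ‖f‖)
    {ε : ℝ} (hε : 0 < ε) :
    ∃ N : ℕ, ∀ f, SuppIn f (Metric.closedBall z N)ᶜ → ∀ s, SuppIn f (Metric.closedBall z s) →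
      ∃ g, ‖G g - f‖ ≤ ε * ‖f‖ := by
  have : Nonempty X := ⟨z⟩
  have hp : (0 : ℝ) < p := exponent_pos
  have hpq : (p : ℝ).HolderConjugate (Real.conjExponent p) :=
    Real.HolderConjugate.conjExponent (by exact_mod_cast hp1)
  set δ : ℝ≥0 := ⟨ε / (2 * C), by positivity⟩ with hδ
  obtain ⟨D, W, t, ϱ, -, hϱ⟩ := exists_slowPartition hgeom hA' hpq hG (δ := δ)
    (by rw [← NNReal.coe_pos]; exact div_pos hε (by positivity))
  obtain ⟨N, hN⟩ := hloc ϱ.radius (ε / 2) (half_pos hε)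
  obtain ⟨N', hN'⟩ := exists_nat_ge (N + ϱ.radius)
  refine ⟨N', fun f hf s hfs => ?_⟩
  set F : ℕ → Lp ℂ p μ := fun j => ϱ.op (one_le_exponent (p := p)) j f with hF
  have hsol : ∀ j, ∃ g, ‖g‖ ≤ C * ‖F j‖ ∧ ‖G g - F j‖ ≤ ε / 2 * ‖F j‖ := by
    intro j
    by_cases h0 : F j = 0
    · exact ⟨0, by simp [h0], by simp [h0]⟩
    · refine hN (ϱ.center j) ?_ _ (ϱ.suppIn_op _ j f)
      by_contra! hle
      refine h0 (SuppIn.eq_zero (((ϱ.suppIn_op _ j f).inter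
        (ϱ.suppIn_op_of_suppIn _ j hf)).mono fun a ha => ?_))
      have h1 := Metric.mem_closedBall.1 ha.1
      have h2 := ha.2
      rw [mem_compl_iff, Metric.mem_closedBall, not_le] at h2
      linarith [dist_triangle a (ϱ.center j) z]
  choose g hg hGg using hsol
  obtain ⟨J, hJ⟩ := ϱ.exists_sum_op_op_eq hpq hfs
  have hsum : ∑ j ∈ J, ‖F j‖ₑ ^ (p : ℝ) ≤ ‖f‖ₑ ^ (p : ℝ) :=
    (ENNReal.sum_le_tsum J).trans_eq (ϱ.tsum_enorm_op_rpow f)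
  have hscale : ∀ {u v : Lp ℂ p μ} {a : ℝ}, 0 ≤ a → ‖u‖ ≤ a * ‖v‖ →
      ‖u‖ₑ ^ (p : ℝ) ≤ ENNReal.ofReal a ^ (p : ℝ) * ‖v‖ₑ ^ (p : ℝ) := by
    intro u v a ha h
    rw [← ENNReal.mul_rpow_of_nonneg _ _ hp.le, ← ofReal_norm, ← ofReal_norm,
      ← ENNReal.ofReal_mul ha]
    exact ENNReal.rpow_le_rpow (ENNReal.ofReal_le_ofReal h) hp.le
  have hback : ∀ {u : Lp ℂ p μ} {a : ℝ}, 0 ≤ a →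
      ‖u‖ₑ ^ (p : ℝ) ≤ ENNReal.ofReal a ^ (p : ℝ) * ‖f‖ₑ ^ (p : ℝ) → ‖u‖ ≤ a * ‖f‖ := by
    intro u a ha h
    rw [← ENNReal.mul_rpow_of_nonneg _ _ hp.le, ENNReal.rpow_le_rpow_iff hp, ← ofReal_norm,
      ← ofReal_norm, ← ENNReal.ofReal_mul ha, ENNReal.ofReal_le_ofReal_iff (by positivity)] at h
    exact h
  refine ⟨∑ j ∈ J, ϱ.op hpq.symm.lt.le j (g j), ?_⟩
  have hsplit : G (∑ j ∈ J, ϱ.op hpq.symm.lt.le j (g j)) - f =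
      ∑ j ∈ J, (G (ϱ.op hpq.symm.lt.le j (g j)) - ϱ.op hpq.symm.lt.le j (G (g j))) +
      ∑ j ∈ J, ϱ.op hpq.symm.lt.le j (G (g j) - F j) := by
    simp_rw [map_sub, Finset.sum_sub_distrib]
    rw [hJ, map_sum]
    abel
  have h₁ : ‖∑ j ∈ J, (G (ϱ.op hpq.symm.lt.le j (g j)) -
      ϱ.op hpq.symm.lt.le j (G (g j)))‖ ≤ ε / 2 * ‖f‖ := by
    refine hback (by positivity) ((hϱ J g).trans ?_)
    have hδC : (δ : ℝ≥0∞) * ENNReal.ofReal C = ENNReal.ofReal (ε / 2) := by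
      rw [← ENNReal.ofReal_coe_nnreal, ← ENNReal.ofReal_mul δ.coe_nonneg]
      congr 1
      change ε / (2 * C) * C = ε / 2
      field_simp
    calc (δ : ℝ≥0∞) ^ (p : ℝ) * ∑ j ∈ J, ‖g j‖ₑ ^ (p : ℝ)
        ≤ (δ : ℝ≥0∞) ^ (p : ℝ) * ∑ j ∈ J, ENNReal.ofReal C ^ (p : ℝ) * ‖F j‖ₑ ^ (p : ℝ) := by
          gcongr with j _
          exact hscale hC.le (hg j)
      _ = ENNReal.ofReal (ε / 2) ^ (p : ℝ) * ∑ j ∈ J, ‖F j‖ₑ ^ (p : ℝ) := by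
          rw [← Finset.mul_sum, ← mul_assoc, ← ENNReal.mul_rpow_of_nonneg _ _ hp.le, hδC]
      _ ≤ _ := by gcongr
  have h₂ : ‖∑ j ∈ J, ϱ.op hpq.symm.lt.le j (G (g j) - F j)‖ ≤ ε / 2 * ‖f‖ := by
    refine hback (by positivity) ((ϱ.enorm_sum_op_rpow_le hpq J _).trans ?_)
    calc ∑ j ∈ J, ‖G (g j) - F j‖ₑ ^ (p : ℝ)
        ≤ ∑ j ∈ J, ENNReal.ofReal (ε / 2) ^ (p : ℝ) * ‖F j‖ₑ ^ (p : ℝ) :=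
          Finset.sum_le_sum fun j _ => hscale (half_pos hε).le (hGg j)
      _ ≤ _ := by
          rw [← Finset.mul_sum]
          gcongr
  rw [hsplit]
  refine (norm_add_le _ _).trans ?_
  linarith

end ShiftSystem

/-! ### Fredholmness and the spectra of the limit operators -/

lemma isCompactOperator_of_forall_approx {E F : Type*} [NormedAddCommGroup E] [NormedSpace ℂ E]
    [NormedAddCommGroup F] [NormedSpace ℂ F] [CompleteSpace F] {B : E →L[ℂ] F}
    (h : ∀ ε : ℝ, 0 < ε → ∃ K : E →L[ℂ] F, IsCompactOperator K ∧ ∀ f, ‖(B - K) f‖ ≤ ε * ‖f‖) :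
    IsCompactOperator B := by
  have hcl : IsClosed {K : E →L[ℂ] F | IsCompactOperator K} :=
    isClosed_setOfPred_isCompactOperator
  have hmem : B ∈ closure {K : E →L[ℂ] F | IsCompactOperator K} := by
    refine Metric.mem_closure_iff.2 fun ε hε => ?_
    obtain ⟨K, hK, hBK⟩ := h (ε / 2) (half_pos hε)
    refine ⟨K, hK, ?_⟩
    rw [dist_eq_norm]
    exact (ContinuousLinearMap.opNorm_le_bound _ (half_pos hε).le hBK).trans_lt (half_lt_self hε)
  rw [hcl.closure_eq] at hmem
  exact hmem

/-- A quotient map of a retract is compact if the retraction `B` is compact up to small errors and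
elements of the subspace. -/
lemma isCompactOperator_mkQL_of_forall_approx {E F : Type*} [NormedAddCommGroup E]
    [NormedSpace ℂ E] [NormedAddCommGroup F] [NormedSpace ℂ F] [CompleteSpace F]
    {V : Submodule ℂ F} (hV : IsClosed (V : Set F)) {B : E →L[ℂ] F} {ι : F →L[ℂ] E}
    (hι : ∀ f, B (ι f) = f)
    (h : ∀ ε : ℝ, 0 < ε → ∃ K : E →L[ℂ] F, IsCompactOperator K ∧
      ∀ f, ∃ v ∈ V, ‖B f - K f - v‖ ≤ ε * ‖f‖) :
    IsCompactOperator (V.mkQL : F →L[ℂ] F ⧸ V) := by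
  have := hV
  have hcomp : IsCompactOperator (V.mkQL ∘L B) := by
    refine isCompactOperator_of_forall_approx fun ε hε => ?_
    obtain ⟨K, hK, hBK⟩ := h ε hε
    refine ⟨V.mkQL ∘L K, hK.clm_comp V.mkQL, fun f => ?_⟩
    obtain ⟨v, hv, hfv⟩ := hBK f
    have h₁ : (V.mkQL ∘L B - V.mkQL ∘L K) f = V.mkQ (B f - K f - v) := by
      have hv0 : V.mkQ v = 0 := (Submodule.Quotient.mk_eq_zero V).2 hv
      rw [map_sub V.mkQ, hv0, sub_zero, map_sub]
      rfl
    rw [h₁]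
    exact (Submodule.Quotient.norm_mk_le V _).trans hfv
  have h₂ : (V.mkQL : F →L[ℂ] F ⧸ V) = (V.mkQL ∘L B) ∘L ι := by
    ext1 f
    simp [hι]
  rw [h₂]
  exact hcomp.comp_clm ι

namespace ShiftSystem

variable {X : Type*} [MetricSpace X] [MeasurableSpace X] [ProperSpace X] [BorelSpace X]
  {μ : Measure X} [μ.Regular] {p : ℝ≥0} [Fact (1 ≤ (p : ℝ≥0∞))] {S : ShiftSystem μ p}
  {M : Submodule ℂ (Lp ℂ p μ)} {P : Lp ℂ p μ →L[ℂ] M} {A : M →L[ℂ] M}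

/-- If `A P + (1 - P)` has invertible limits at the boundary, then `A` is Fredholm: `A` is bounded
below modulo a compact operator, and the projection onto the cokernel of `A` is compact. -/
lemma isFredholm_of_limit_bijective (hgeom : BoundedGeometry X) (hA' : PropertyAPrime X)
    (hp1 : 1 < p) (hP : IsAdmissibleProjection M P)
    (hS : S.ExtendsToStoneCech (M.subtypeL ∘L P)) (hA : A ∈ bandDominatedOn P)
    (hlim : ∀ x ∈ boundary X, ∃ G', S.IsStrongLimit
      (compProj P A + (ContinuousLinearMap.id ℂ _ - M.subtypeL ∘L P)) x G' ∧
      Function.Bijective G') : A.IsFredholm := by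
  have hQ := isLocallyCompactProjection hP hS
  set Q := M.subtypeL ∘L P with hQdef
  set G := compProj P A + (ContinuousLinearMap.id ℂ _ - Q) with hGdef
  have hM : CompleteSpace M := hP.isClosed.completeSpace_coe
  have hPP : ∀ f, P (P f : Lp ℂ p μ) = P f := fun f => hP.apply_coe (P f)
  have hGapp : ∀ f, G f = (A (P f) : Lp ℂ p μ) + (f - P f) := fun f => rfl
  have hQapp : ∀ f, Q f = (P f : Lp ℂ p μ) := fun f => rfl
  have hG : G ∈ BDO μ p := add_mem_BDO hA (sub_mem_BDO id_mem_BDO hP.mem_BDO)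
  have hG₁ : ∀ f, G (f - Q f) = f - Q f := fun f => by
    rw [hGapp, hQapp, map_sub, hPP, sub_self]
    simp
  have hG₂ : ∀ f, G f - Q (G f) = f - Q f := fun f => by
    rw [hQapp, hQapp, hGapp, map_add, map_sub, hPP, hP.apply_coe]
    simp
  have hPG : ∀ f, P (G f) = A (P f) := fun f => by
    rw [hGapp, map_add, map_sub, hPP, hP.apply_coe]
    simp
  have hGM : ∀ f : M, G f = (A f : Lp ℂ p μ) := fun f => by
    rw [hGapp, hP.apply_coe]
    simp
  obtain ⟨c, hc, n, hcn⟩ := exists_bounded_below_off_ball hgeom hA' hp1 hQ hG hG₁ hG₂ hlim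
  have hsol := fun (ε : ℝ) (hε : 0 < ε) => exists_solution_off_ball hgeom hA' hp1 S.base hG
    (C := ‖Q‖ / c + 1 + ‖Q‖) (by positivity)
    (fun r ε hε => exists_local_solution hQ hG₁ hc (fun x hx => by
      obtain ⟨G', hG', hbij⟩ := hlim x hx
      exact ⟨G', hG', hbij.2, hG'.le_norm_of_off_ball hx hcn⟩) r hε) hε
  have hcut : IsCompactOperator (ballCut S.base n ∘L M.subtypeL) := by
    have h : ballCut S.base n ∘L M.subtypeL = (ballCut S.base n ∘L Q) ∘L M.subtypeL := by
      ext1 f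
      simp [hQapp, hP.apply_coe]
    rw [h]
    exact (hQ.compact_left S.base n).comp_clm M.subtypeL
  refine isFredholm_of_bounded_below_mod_compact (C := (1 + ‖G‖) / c + 1) hcut (fun f => ?_)
    fun hcl => ?_
  · set b := ballCut S.base n (f : Lp ℂ p μ) with hb
    have h₁ := hcn (f - b) (suppIn_sub_ballCut S.base n _)
    have h₂ : ‖G ((f : Lp ℂ p μ) - b)‖ ≤ ‖A f‖ + ‖G‖ * ‖b‖ := by
      rw [map_sub, hGM]
      refine (norm_sub_le _ _).trans ?_
      gcongr
      · exact le_rfl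
      · exact G.le_opNorm b
    have h₃ : ‖f‖ ≤ ‖(f : Lp ℂ p μ) - b‖ + ‖b‖ := by
      have := norm_add_le ((f : Lp ℂ p μ) - b) b
      rwa [sub_add_cancel] at this
    have h₄ : ‖(f : Lp ℂ p μ) - b‖ ≤ (‖A f‖ + ‖G‖ * ‖b‖) / c := by
      rw [le_div_iff₀ hc, mul_comm]
      exact h₁.trans h₂
    have h₅ : (‖A f‖ + ‖G‖ * ‖b‖) / c ≤ (1 + ‖G‖) / c * (‖A f‖ + ‖b‖) := by
      rw [div_mul_eq_mul_div]
      gcongr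
      nlinarith [norm_nonneg (A f), norm_nonneg b, norm_nonneg G]
    change ‖f‖ ≤ ((1 + ‖G‖) / c + 1) * (‖A f‖ + ‖b‖)
    nlinarith [norm_nonneg (A f)]
  · refine isCompactOperator_mkQL_of_forall_approx hcl (B := P) (ι := M.subtypeL) hP.apply_coe
      fun ε hε => ?_
    obtain ⟨N, hN⟩ := hsol (ε / (2 * (‖P‖ + 1))) (by positivity)
    have hcutP : P ∘L ballCut S.base N = P ∘L (Q ∘L ballCut S.base N) := by
      ext1 f
      simp [hQapp, hPP]
    refine ⟨P ∘L ballCut S.base N, ?_, fun f => ?_⟩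
    · rw [hcutP]
      exact (hQ.compact_right S.base N).clm_comp P
    · by_cases hf0 : f = 0
      · exact ⟨0, zero_mem _, by simp [hf0]⟩
      have hf : 0 < ‖f‖ := norm_pos_iff.2 hf0
      -- replace `f` by a function of bounded support
      obtain ⟨m, hm⟩ := exists_norm_sub_ballCut_le S.base f
        (show 0 < ε / (2 * (‖P‖ + 1)) * ‖f‖ by positivity)
      set d := f - ballCut S.base m f with hd
      set v := ballCut S.base m f - ballCut S.base N (ballCut S.base m f) with hv
      have hvm : SuppIn v (Metric.closedBall S.base m) := by
        have h := (suppIn_ballCut S.base m f).add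
          (((suppIn_ballCut S.base m f).cutoff
            (Metric.isClosed_closedBall (x := S.base) (ε := N)).measurableSet).smul (-1))
        rw [neg_one_smul, ← sub_eq_add_neg] at h
        exact h
      obtain ⟨g, hg⟩ := hN v (suppIn_sub_ballCut S.base N _) m hvm
      have hvf : ‖v‖ ≤ ‖f‖ := (norm_sub_cutoff_le _ _).trans (norm_ballCut_apply_le S.base m f)
      refine ⟨A (P g), ⟨P g, rfl⟩, ?_⟩
      have hsplit : P f - (P ∘L ballCut S.base N) f - A (P g) =
          P ((d - ballCut S.base N d) - (G g - v)) := by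
        rw [← hPG, ContinuousLinearMap.comp_apply, ← map_sub, ← map_sub]
        congr 1
        rw [hd, hv, map_sub]
        abel
      rw [hsplit]
      calc ‖P ((d - ballCut S.base N d) - (G g - v))‖
          ≤ ‖P‖ * (ε / (2 * (‖P‖ + 1)) * ‖f‖ + ε / (2 * (‖P‖ + 1)) * ‖f‖) := by
            refine (P.le_opNorm _).trans ?_
            gcongr
            refine (norm_sub_le _ _).trans (add_le_add ((norm_sub_cutoff_le _ d).trans hm)
              (hg.trans ?_))
            gcongr
        _ ≤ (‖P‖ + 1) * (ε / (2 * (‖P‖ + 1)) * ‖f‖ + ε / (2 * (‖P‖ + 1)) * ‖f‖) := by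
            gcongr
            linarith
        _ = ε * ‖f‖ := by
            field_simp
            ring

/-- The limits at a point of the Stone-Čech compactification which define a limit operator. -/
lemma exists_limits (hP : IsAdmissibleProjection M P)
    (hS : S.ExtendsToStoneCech (M.subtypeL ∘L P)) (hA : A ∈ bandDominatedOn P) (x : StoneCech X) :
    ∃ Q' N, S.IsStrongLimit (M.subtypeL ∘L P) x Q' ∧ S.IsStrongLimit (compProj P A) x N ∧
      Q' ∘L Q' = Q' ∧ Q' ∘L N = N ∧ N ∘L Q' = N := by
  have hQ := isLocallyCompactProjection hP hS
  have := neBot_comap_stoneCechUnit x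
  obtain ⟨Q', hQ'⟩ := hQ.exists_isStrongLimit hQ.mem_BDO hQ.idem x
  obtain ⟨N, hN⟩ := hQ.exists_isStrongLimit hA (fun f => by simp [compProj, hP.apply_coe]) x
  refine ⟨Q', N, hQ', hN, (hQ'.comp hQ').unique ?_, (hQ'.comp hN).unique ?_,
    (hN.comp hQ').unique ?_⟩
  · convert hQ' using 1
    ext1 f
    simp [hP.apply_coe]
  · convert hN using 1
    ext1 f
    simp [compProj, hP.apply_coe]
  · convert hN using 1
    ext1 f
    simp [compProj, hP.apply_coe]

end ShiftSystem

section RangeOfProjection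

variable {E : Type*} [NormedAddCommGroup E] [NormedSpace ℂ E] {Q N : E →L[ℂ] E}

lemma apply_eq_self_of_mem_range (hQ : Q ∘L Q = Q) {v : E} (hv : v ∈ Q.range) : Q v = v := by
  obtain ⟨f, rfl⟩ := hv
  exact congrArg (fun B => B f) hQ

lemma isClosed_range_of_idem (hQ : Q ∘L Q = Q) : IsClosed (Q.range : Set E) := by
  have h : (Q.range : Set E) = {v | Q v = v} := by
    ext v
    exact ⟨fun hv => apply_eq_self_of_mem_range hQ hv, fun hv => ⟨v, hv⟩⟩
  rw [h]
  exact isClosed_eq Q.continuous continuous_id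

variable {B : Q.range →L[ℂ] Q.range}

/-- An invertible operator on the range of a projection `Q` is extended to an invertible operator
by the identity on the kernel of `Q`. -/
lemma bijective_add_of_bijective (hQ : Q ∘L Q = Q) (hQN : Q ∘L N = N) (hNQ : N ∘L Q = N)
    (hB : ∀ v : Q.range, (B v : E) = N v) (hbij : Function.Bijective B) :
    Function.Bijective (N + (ContinuousLinearMap.id ℂ E - Q)) := by
  have h₁ : ∀ f, Q (Q f) = Q f := fun f => congrArg (fun B => B f) hQ
  have h₂ : ∀ f, Q (N f) = N f := fun f => congrArg (fun B => B f) hQN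
  have h₃ : ∀ f, N (Q f) = N f := fun f => congrArg (fun B => B f) hNQ
  refine ⟨(injective_iff_map_eq_zero _).2 fun f hf => ?_, fun f => ?_⟩
  · have hf' : N f + (f - Q f) = 0 := hf
    have hNf : N f = 0 := by
      have := congrArg Q hf'
      rw [map_add, map_sub, h₁, h₂, sub_self, add_zero, map_zero] at this
      exact this
    have hBf : B ⟨Q f, f, rfl⟩ = 0 := Subtype.ext (by
      rw [hB]
      exact (h₃ f).trans hNf)
    have hQf : Q f = 0 := congrArg Subtype.val ((injective_iff_map_eq_zero B).1 hbij.1 _ hBf)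
    rwa [hNf, hQf, zero_add, sub_zero] at hf'
  · obtain ⟨v, hv⟩ := hbij.2 ⟨Q f, f, rfl⟩
    have hv' : N v = Q f := by
      rw [← hB, hv]
    have hQv : Q v = v := apply_eq_self_of_mem_range hQ v.2
    have hN0 : N (f - Q f) = 0 := by rw [map_sub, h₃, sub_self]
    refine ⟨v + (f - Q f), ?_⟩
    change N (v + (f - Q f)) + (v + (f - Q f) - Q (v + (f - Q f))) = f
    rw [map_add, hN0, hv', map_add, map_sub, h₁, hQv]
    abel

end RangeOfProjection

namespace ShiftSystem

variable {X : Type*} [MetricSpace X] [MeasurableSpace X] [ProperSpace X] [BorelSpace X]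
  {μ : Measure X} [μ.Regular] {p : ℝ≥0} [Fact (1 ≤ (p : ℝ≥0∞))] {S : ShiftSystem μ p}
  {M : Submodule ℂ (Lp ℂ p μ)} {P : Lp ℂ p μ →L[ℂ] M} {A : M →L[ℂ] M} {x : StoneCech X}

lemma compProj_algebraMap_sub (P : Lp ℂ p μ →L[ℂ] M) (A : M →L[ℂ] M) (z : ℂ) :
    compProj P (algebraMap ℂ (M →L[ℂ] M) z - A) = z • (M.subtypeL ∘L P) - compProj P A := by
  ext1 f
  simp [compProj, Algebra.algebraMap_eq_smul_one]

lemma algebraMap_sub_mem (hP : IsAdmissibleProjection M P) (hA : A ∈ bandDominatedOn P) (z : ℂ) :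
    algebraMap ℂ (M →L[ℂ] M) z - A ∈ bandDominatedOn P := by
  change compProj P _ ∈ BDO μ p
  rw [compProj_algebraMap_sub]
  exact sub_mem_BDO (smul_mem_BDO z hP.mem_BDO) hA

/-- The weak limits in the definition of a limit operator are strong limits. -/
lemma LimitOperator.exists_isStrongLimit (hP : IsAdmissibleProjection M P)
    (hS : S.ExtendsToStoneCech (M.subtypeL ∘L P)) (hA : A ∈ bandDominatedOn P)
    (L : S.LimitOperator P A x) :
    ∃ N, S.IsStrongLimit (M.subtypeL ∘L P) x L.proj ∧ S.IsStrongLimit (compProj P A) x N ∧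
      L.proj ∘L L.proj = L.proj ∧ L.proj ∘L N = N ∧ N ∘L L.proj = N ∧
      ∀ v : L.proj.range, (L.op v : Lp ℂ p μ) = N v := by
  have := neBot_comap_stoneCechUnit x
  obtain ⟨Q', N, hQ', hN, h₁, h₂, h₃⟩ := exists_limits hP hS hA x
  obtain rfl : L.proj = Q' := L.isWeakLimit_proj.unique hQ'.isWeakLimit
  obtain ⟨B, hB, hBv⟩ := L.isWeakLimit_op
  obtain rfl : B = N := hB.unique hN.isWeakLimit
  exact ⟨B, hQ', hN, h₁, h₂, h₃, hBv⟩

lemma nonempty_unique_limitOperator (hP : IsAdmissibleProjection M P)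
    (hS : S.ExtendsToStoneCech (M.subtypeL ∘L P)) (hA : A ∈ bandDominatedOn P)
    (x : StoneCech X) : Nonempty (Unique (S.LimitOperator P A x)) := by
  have := neBot_comap_stoneCechUnit x
  obtain ⟨Q', N, hQ', hN, h₁, h₂, h₃⟩ := exists_limits hP hS hA x
  refine ⟨⟨⟨⟨Q', (N ∘L Q'.range.subtypeL).codRestrict Q'.range fun v => ⟨N v, ?_⟩,
    hQ'.isWeakLimit, N, hN.isWeakLimit, fun v => rfl⟩⟩, ?_⟩⟩
  · exact congrArg (fun B => B (v : Lp ℂ p μ)) h₂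
  · rintro ⟨Q'', C, hQ'', B, hB, hC⟩
    obtain rfl : Q'' = Q' := hQ''.unique hQ'.isWeakLimit
    obtain rfl : B = N := hB.unique hN.isWeakLimit
    congr 1
    ext v
    rw [hC]
    rfl

lemma LimitOperator.notMem_spectrum_iff (L : S.LimitOperator P A x)
    (hproj : L.proj ∘L L.proj = L.proj) (z : ℂ) : z ∉ spectrum ℂ L.op ↔
      Function.Bijective (algebraMap ℂ (L.proj.range →L[ℂ] L.proj.range) z - L.op) := by
  have : CompleteSpace L.proj.range := (isClosed_range_of_idem hproj).completeSpace_coe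
  rw [spectrum.notMem_iff, ContinuousLinearMap.isUnit_iff_bijective]

lemma LimitOperator.algebraMap_sub_apply (L : S.LimitOperator P A x) {N : Lp ℂ p μ →L[ℂ] Lp ℂ p μ}
    (hN : ∀ v : L.proj.range, (L.op v : Lp ℂ p μ) = N v) (hproj : L.proj ∘L L.proj = L.proj)
    (z : ℂ) (v : L.proj.range) :
    ((algebraMap ℂ (L.proj.range →L[ℂ] L.proj.range) z - L.op) v : Lp ℂ p μ) =
      (z • L.proj - N) v := by
  have hv : L.proj v = v := apply_eq_self_of_mem_range hproj v.2
  simp [Algebra.algebraMap_eq_smul_one, hN, hv]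

/-- The essential spectrum is the union of the spectra of the limit operators. -/
lemma iUnion_spectrum_limitOperator (hgeom : BoundedGeometry X) (hA' : PropertyAPrime X)
    (hp : 1 < p) (hP : IsAdmissibleProjection M P)
    (hS : S.ExtendsToStoneCech (M.subtypeL ∘L P)) (hA : A ∈ bandDominatedOn P) :
    (⋃ x ∈ boundary X, ⋃ L : S.LimitOperator P A x, spectrum ℂ L.op) = essentialSpectrum A := by
  refine Set.ext fun z => not_iff_not.1 ?_
  simp only [mem_iUnion, not_exists, essentialSpectrum, mem_ofPred_eq, not_not]
  constructor
  · intro h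
    refine isFredholm_of_limit_bijective hgeom hA' hp hP hS (algebraMap_sub_mem hP hA z)
      fun x hx => ?_
    obtain ⟨⟨⟨L⟩, -⟩⟩ := S.nonempty_unique_limitOperator hP hS hA x
    obtain ⟨N, hQ', hN, h₁, h₂, h₃, hL⟩ := L.exists_isStrongLimit hP hS hA
    refine ⟨(z • L.proj - N) + (ContinuousLinearMap.id ℂ _ - L.proj), ?_, ?_⟩
    · rw [compProj_algebraMap_sub]
      exact ((hQ'.smul z).sub hN).add (isStrongLimit_id.sub hQ')
    · refine bijective_add_of_bijective h₁ ?_ ?_ (L.algebraMap_sub_apply hL h₁ z)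
        ((L.notMem_spectrum_iff h₁ z).1 (h x hx L))
      · rw [ContinuousLinearMap.comp_sub, ContinuousLinearMap.comp_smul, h₁, h₂]
      · rw [ContinuousLinearMap.sub_comp, ContinuousLinearMap.smul_comp, h₁, h₃]
  · intro hF x hx L
    obtain ⟨N, hQ', hN, h₁, h₂, h₃, hL⟩ := L.exists_isStrongLimit hP hS hA
    have hNz : S.IsStrongLimit (compProj P (algebraMap ℂ (M →L[ℂ] M) z - A)) x
        (z • L.proj - N) := by
      rw [compProj_algebraMap_sub]
      exact (hQ'.smul z).sub hN
    have hQN : ∀ f, (z • L.proj - N) (L.proj f) = (z • L.proj - N) f := by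
      intro f
      have h := congrArg (fun B => B f)
        (show (z • L.proj - N) ∘L L.proj = z • L.proj - N by
          rw [ContinuousLinearMap.sub_comp, ContinuousLinearMap.smul_comp, h₁, h₃])
      exact h
    rw [L.notMem_spectrum_iff h₁]
    refine ⟨(injective_iff_map_eq_zero _).2 fun v hv => ?_, fun v => ?_⟩
    · have h0 : (z • L.proj - N) v = 0 := by
        rw [← L.algebraMap_sub_apply hL h₁ z, hv]
        rfl
      have h := limit_injective_of_isFredholm hp hF hx hQ' hNz h0
      rw [apply_eq_self_of_mem_range h₁ v.2] at h
      exact Subtype.ext h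
    · obtain ⟨g, hg⟩ := limit_surjective_of_isFredholm hp hP (isLocallyCompactProjection hP hS)
        (algebraMap_sub_mem hP hA z) hF hx hQ' hNz v
      refine ⟨⟨L.proj g, g, rfl⟩, Subtype.ext ?_⟩
      rw [L.algebraMap_sub_apply hL h₁ z]
      exact (hQN g).trans (hg.trans (apply_eq_self_of_mem_range h₁ v.2))

end ShiftSystem

end BandDominated

end

theorem corollary4p33 {X : Type*} [MetricSpace X] [ProperSpace X] [MeasurableSpace X]
    [BorelSpace X] (hgeom : BandDominated.BoundedGeometry X)
    (hA' : BandDominated.PropertyAPrime X)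
    (hunb : ¬ Bornology.IsBounded (Set.univ : Set X))
    (μ : Measure X) [μ.Regular] (p : ℝ≥0) [Fact (1 ≤ (p : ℝ≥0∞))] (hp : 1 < p)
    (M : Submodule ℂ (Lp ℂ p μ)) (P : Lp ℂ p μ →L[ℂ] M)
    (hP : BandDominated.IsAdmissibleProjection M P)
    (S : BandDominated.ShiftSystem μ p) (hS : S.ExtendsToStoneCech (M.subtypeL ∘L P))
    (A : M →L[ℂ] M) (hA : A ∈ BandDominated.bandDominatedOn P) :
    (∀ x ∈ BandDominated.boundary X, Nonempty (Unique (S.LimitOperator P A x))) ∧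
      (⋃ x ∈ BandDominated.boundary X, ⋃ L : S.LimitOperator P A x, spectrum ℂ L.op) =
        BandDominated.essentialSpectrum A := by
  exact ⟨fun x _ => S.nonempty_unique_limitOperator hP hS hA x,
    S.iUnion_spectrum_limitOperator hgeom hA' hp hP hS hA⟩
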